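/- Let $k$ be a field and let $\Gamma$ be a Brauer tree of type $(m,e)$, that is, a finite tree with $e\ge 1$ edges, a cyclic (counter-clockwise) ordering of the edges around each vertex, and an exceptional vertex of multiplicity $m\ge 1$. **The algebra.** Let $A_\Gamma=kQ/I$ be the basic Brauer tree algebra of $\Gamma$. The vertices of $Q$ are the edges of $\Gamma$. For each vertex $v$ of $\Gamma$ with at least two edges there is an arrow $j_2\to j_1$ whenever $j_2$ follows $j_1$ in the cyclic ordering around $v$. If only one edge is adjacent to the exceptional vertex, there is a loop at that edge provided $m>1$ or $e=1$. So each such vertex $v$ gives an oriented cycle of $Q$, of length the valency of $v$. Put $m_v=m$ if $v$ is exceptional and $m_v=1$ otherwise. The ideal $I$ is generated by: the products $ab$ of arrows $a,b$ of different cycles; the differences $\alpha^{m_v}-\beta^{m_w}$ for an edge $vw$ and the two cycles $\alpha$ (around $v$) and $\beta$ (around $w$) that start and end at it; and the paths along the cycle around $v$ that are longer than $m_v$ times the length of this cycle. **The grading.** Number the edges $1,\dots,e$ in the order in which they are first traversed by Green's walk: it starts at the exceptional vertex along any chosen edge adjacent to it and, on arriving at a vertex along an edge, goes on along the next edge in the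 cyclic ordering around that vertex. Let $A_S$ be the path algebra of the cyclic quiver with vertices $1,\dots,e$ and arrows $j+1\to j$ (indices modulo $e$), modulo all paths of length $me+1$, graded with all arrows in degree $1$, and let $P_j=A_Se_j$, spanned by the paths that end at $j$. For an edge $i$ adjacent to the exceptional vertex let $T_i$ be $P_i$ in cohomological degree $0$. For any other edge $i$, preceded by $j$ on the shortest path from the exceptional vertex to $i$, let $T_i$ be the complex $P_j\xrightarrow{h}P_i$ with $P_i$ in cohomological degree the distance $r$ of $i$ from the exceptional vertex and $P_j$ in cohomological degree $r-1$, where $h$ is right multiplication by the shortest path from $j$ to $i$ (a homomorphism of the highest possible rank). Let $T_i'$ be $T_i$, graded so that the differentials are homogeneous of degree $0$, the top of $P_i$ is in degree $0$ if $i$ is adjacent to the exceptional vertex, and the top of each $P_j$ lies in the same degree in all the $T_i'$ in which it occurs. The grading on $A_\Gamma$ constructed by taking Green's walk is the one with the vertices of $Q$ in degree $0$ and with each arrow $i\to j$ in the lowest degree $l$ in which there is a homogeneous morphism $T_i'\to T_j'$ of degree $l$ that is non-zero in the homotopy category $K^b(A_S)$ (and, if the arrow is a loop, not an isomorphism there).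 **The claim.** This is a grading of the algebra $A_\Gamma$. Let $C$ be its graded Cartan matrix, the $e\times e$ matrix over $\mathbb Z[q,q^{-1}]$ with entries $$c_{ij}=\sum_{l\in\mathbb Z}q^l\dim_k \mathrm{Hom}(P_{S_i},P_{S_j}\langle l\rangle),$$ where $P_{S_i}$ is the graded indecomposable projective left $A_\Gamma$-module that belongs to the edge $i$, with top in degree $0$, where $M\langle l\rangle_d=M_{l+d}$, and where $\mathrm{Hom}$ denotes homomorphisms of graded modules. Then $$\det C = 1+q^{e}+q^{2e}+\dots+q^{me^2}.$$ In particular, $\det C$ depends only on the type $(m,e)$: it is the same for any two Brauer trees of the same type. -/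

import Mathlib

open CategoryTheory

universe u v w

noncomputable section

/-! ### Algebras given by a quiver with relations -/

/-- Generators of the path algebra of a quiver: its vertices and its arrows. -/
inductive QuiverGen (X Y : Type*)
  | vert : X → QuiverGen X Y
  | arr : Y → QuiverGen X Y

namespace QuiverGen

/-- The generator of the free algebra that belongs to the vertex `i`. -/
def e (k : Type*) [Field k] {X Y : Type*} (i : X) : FreeAlgebra k (QuiverGen X Y) :=
  FreeAlgebra.ι k (vert i)

/-- The generator of the free algebra that belongs to the arrow `a`. -/
def a (k : Type*) [Field k] {X Y : Type*} (y : Y) : FreeAlgebra k (QuiverGen X Y) :=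
  FreeAlgebra.ι k (arr y)

end QuiverGen

/-- The defining relations of `kQ / I`, where `Q` has (finite) vertex set `X` and arrow set `Y`
with source `src` and target `tgt`. The first five are those of the path algebra `kQ`
(paths are multiplied from left to right: `y * y'` is `y` followed by `y'`); the last one imposes
the relations `R` that generate `I`. -/
inductive QuiverRel (k : Type*) [Field k] {X Y : Type*} [Fintype X] (src tgt : Y → X)
    (R : FreeAlgebra k (QuiverGen X Y) → FreeAlgebra k (QuiverGen X Y) → Prop) :
    FreeAlgebra k (QuiverGen X Y) → FreeAlgebra k (QuiverGen X Y) → Prop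
  | idem (i : X) : QuiverRel k src tgt R (QuiverGen.e k i * QuiverGen.e k i) (QuiverGen.e k i)
  | orth (i j : X) (h : i ≠ j) :
      QuiverRel k src tgt R (QuiverGen.e k i * QuiverGen.e k j) 0
  | one : QuiverRel k src tgt R (∑ i, QuiverGen.e k i) 1
  | src (y : Y) :
      QuiverRel k src tgt R (QuiverGen.e k (src y) * QuiverGen.a k y) (QuiverGen.a k y)
  | tgt (y : Y) :
      QuiverRel k src tgt R (QuiverGen.a k y * QuiverGen.e k (tgt y)) (QuiverGen.a k y)
  | rel (x x' : FreeAlgebra k (QuiverGen X Y)) (h : R x x') : QuiverRel k src tgt R x x'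

/-- The algebra `kQ / I`. -/
abbrev QuiverAlgebra (k : Type*) [Field k] {X Y : Type*} [Fintype X] (src tgt : Y → X)
    (R : FreeAlgebra k (QuiverGen X Y) → FreeAlgebra k (QuiverGen X Y) → Prop) :=
  RingQuot (QuiverRel k src tgt R)

namespace QuiverAlgebra

variable {k : Type*} [Field k] {X Y : Type*} [Fintype X] {src tgt : Y → X}
  {R : FreeAlgebra k (QuiverGen X Y) → FreeAlgebra k (QuiverGen X Y) → Prop}

/-- The primitive idempotent at the vertex `i`. -/
def vert (R : FreeAlgebra k (QuiverGen X Y) → FreeAlgebra k (QuiverGen X Y) → Prop) (i : X) :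
    QuiverAlgebra k src tgt R :=
  RingQuot.mkAlgHom k (QuiverRel k src tgt R) (QuiverGen.e k i)

/-- The degree of a generator when the arrow `y` has degree `w y`. -/
def genDegree (w : Y → ℤ) : QuiverGen X Y → ℤ
  | QuiverGen.vert _ => 0
  | QuiverGen.arr y => w y

/-- The component of degree `d` of `kQ / I`, when the arrow `y` is put in degree `w y` (and the
vertices in degree `0`): the span of all products of generators of total degree `d`. -/
def piece (R : FreeAlgebra k (QuiverGen X Y) → FreeAlgebra k (QuiverGen X Y) → Prop)
    (w : Y → ℤ) (d : ℤ) : Submodule k (QuiverAlgebra k src tgt R) :=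
  Submodule.span k {x | ∃ L : List (QuiverGen X Y), (L.map (genDegree w)).sum = d ∧
    x = RingQuot.mkAlgHom k (QuiverRel k src tgt R) ((L.map (FreeAlgebra.ι k)).prod)}

/-- The indecomposable projective left module `P_i = A e_i`, spanned by the paths that end
at `i`. -/
abbrev proj (R : FreeAlgebra k (QuiverGen X Y) → FreeAlgebra k (QuiverGen X Y) → Prop) (i : X) :
    Ideal (QuiverAlgebra k src tgt R) :=
  Ideal.span {vert R i}

/-- The homomorphisms of degree `l` from `P_i` to `P_j`, i.e. the homomorphisms of graded modules
from `P_i` to `P_j⟨l⟩`, where `(M⟨l⟩)_d = M_{d+l}` and the top of each `P_i` is in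
degree `0`. -/
def homgr (R : FreeAlgebra k (QuiverGen X Y) → FreeAlgebra k (QuiverGen X Y) → Prop)
    (w : Y → ℤ) (i j : X) (l : ℤ) :
    Submodule k
      (proj (src := src) (tgt := tgt) R i →ₗ[QuiverAlgebra k src tgt R]
        proj (src := src) (tgt := tgt) R j) where
  carrier := {φ | ∀ (d : ℤ) (x : proj (src := src) (tgt := tgt) R i),
    (x : QuiverAlgebra k src tgt R) ∈ piece R w d →
      (φ x : QuiverAlgebra k src tgt R) ∈ piece R w (d + l)}
  add_mem' := fun hφ hψ d x hx => Submodule.add_mem _ (hφ d x hx) (hψ d x hx)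
  zero_mem' := fun _ _ _ => Submodule.zero_mem _
  smul_mem' := fun c _ hφ d x hx => Submodule.smul_mem _ c (hφ d x hx)

/-- The graded Cartan matrix, with entries
`c_{ij} = ∑_l q^l dim Homgr (P_i, P_j⟨l⟩)` in `ℤ[q, q⁻¹]`. -/
def cartan (src tgt : Y → X)
    (R : FreeAlgebra k (QuiverGen X Y) → FreeAlgebra k (QuiverGen X Y) → Prop) (w : Y → ℤ) :
    Matrix X X (LaurentPolynomial ℤ) :=
  Matrix.of fun i j => ∑ᶠ l : ℤ,
    (Module.finrank k (homgr (src := src) (tgt := tgt) R w i j l) : LaurentPolynomial ℤ) *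
      LaurentPolynomial.T l

end QuiverAlgebra

/-- Let `σ` be a permutation of `X` and let `a x` be an arrow from `σ x` to `x`. Then
`cyclePath e a σ n x` is the path of length `n` along these arrows that starts at `x`
(and is the trivial path `e x` if `n = 0`). -/
def cyclePath {A X : Type*} [Mul A] (e a : X → A) (σ : Equiv.Perm X) : ℕ → X → A
  | 0, x => e x
  | n + 1, x => a (σ.symm x) * cyclePath e a σ n (σ.symm x)

/-! ### The Brauer star algebra `A_S` of type `(m, n)` -/

/-- The relations of `A_S`: all paths of length `m n + 1` vanish. The quiver is the oriented cycle
on `Fin n` with one arrow `j + 1 ⟶ j` (cyclically) for each `j`. -/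
inductive StarRel (k : Type*) [Field k] (m n : ℕ) :
    FreeAlgebra k (QuiverGen (Fin n) (Fin n)) → FreeAlgebra k (QuiverGen (Fin n) (Fin n)) → Prop
  | long (j : Fin n) :
      StarRel k m n (cyclePath (QuiverGen.e k) (QuiverGen.a k) (finRotate n) (m * n + 1) j) 0

/-- The basic Brauer tree algebra `A_S` of the star with `n` edges and multiplicity `m`. -/
abbrev StarAlgebra (k : Type*) [Field k] (m n : ℕ) :=
  QuiverAlgebra k (fun j : Fin n => finRotate n j) (fun j : Fin n => j) (StarRel k m n)

namespace StarAlgebra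

/-- The primitive idempotents of `A_S`. -/
def vert (k : Type*) [Field k] (m n : ℕ) (j : Fin n) : StarAlgebra k m n :=
  QuiverAlgebra.vert (StarRel k m n) j

/-- The grading of `A_S` in which all arrows have degree `1`. -/
def piece (k : Type*) [Field k] (m n : ℕ) (d : ℤ) : Submodule k (StarAlgebra k m n) :=
  QuiverAlgebra.piece (StarRel k m n) (fun _ => 1) d

/-- The path of length `t` in `A_S` that starts at `j`. -/
def path (k : Type*) [Field k] (m n : ℕ) (t : ℕ) (j : Fin n) : StarAlgebra k m n :=
  RingQuot.mkAlgHom k _ (cyclePath (QuiverGen.e k) (QuiverGen.a k) (finRotate n) t j)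

end StarAlgebra

/-! ### Brauer trees -/

/-- A Brauer tree: a finite tree with a cyclic ordering of the edges around each vertex, an
exceptional vertex `exc` and its multiplicity `mult ≥ 1`. A dart `d` (an edge with a chosen end
`d.fst`) stands for the edge as seen from `d.fst`; `next d` is its successor in the
(counter-clockwise) cyclic ordering around `d.fst`. -/
structure BrauerTree (V : Type*) [Finite V] where
  graph : SimpleGraph V
  isTree : graph.IsTree
  next : Equiv.Perm graph.Dart
  next_fst : ∀ d, (next d).fst = d.fst
  next_cyclic : ∀ d d', d.fst = d'.fst → next.SameCycle d d'
  exc : V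
  mult : ℕ
  mult_pos : 0 < mult

namespace BrauerTree

variable {V : Type*} [Finite V] (Γ : BrauerTree V)

/-- The edges of a Brauer tree. -/
def Edge : Type _ := Γ.graph.edgeSet

instance : Finite Γ.Edge := inferInstanceAs (Finite Γ.graph.edgeSet)

instance : Fintype Γ.Edge := Fintype.ofFinite _

instance : DecidableEq Γ.Edge := Classical.decEq _

/-- The number `e` of edges. -/
def numEdges : ℕ := Fintype.card Γ.Edge

/-- The edge underlying a dart. -/
def edge (d : Γ.graph.Dart) : Γ.Edge := ⟨d.edge, d.edge_mem⟩

/-- The number of edges around a vertex. -/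
def valency (v : V) : ℕ := Nat.card {d : Γ.graph.Dart // d.fst = v}

open Classical in
/-- The multiplicity of a vertex. -/
def multAt (v : V) : ℕ := if v = Γ.exc then Γ.mult else 1

/-! ### The algebra `A_Γ` -/

/-- Whether the edges around `v` form an oriented cycle in the quiver of `A_Γ`: this is so if there
are at least two of them, and for the exceptional vertex also if there is only one, provided that
the multiplicity is greater than one or that `Γ` is the star with one edge
(then the cycle is a loop). -/
def HasCycle (v : V) : Prop :=
  2 ≤ Γ.valency v ∨ (Γ.valency v = 1 ∧ v = Γ.exc ∧ (1 < Γ.mult ∨ Γ.numEdges = 1))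

/-- The arrows of the quiver of `A_Γ`, the vertices being the edges of `Γ`. The dart `d` gives the
arrow from the edge that comes after `d` around `d.fst` to the edge of `d`. -/
def Arrow : Type _ := {d : Γ.graph.Dart // Γ.HasCycle d.fst}

/-- The source of an arrow. -/
def src (y : Γ.Arrow) : Γ.Edge := Γ.edge (Γ.next y.1)

/-- The target of an arrow. -/
def tgt (y : Γ.Arrow) : Γ.Edge := Γ.edge y.1

open Classical in
/-- The path of length `n` in the cycle around `d.fst` that starts at the edge of `d`
(used only if there is such a cycle). -/
def vertexPath (k : Type*) [Field k] (n : ℕ) (d : Γ.graph.Dart) :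
    FreeAlgebra k (QuiverGen Γ.Edge Γ.Arrow) :=
  cyclePath (fun d => QuiverGen.e k (Γ.edge d))
    (fun d => if h : Γ.HasCycle d.fst then QuiverGen.a k (⟨d, h⟩ : Γ.Arrow) else 0) Γ.next n d

/-- The relations of `A_Γ`. -/
inductive Rel (k : Type*) [Field k] :
    FreeAlgebra k (QuiverGen Γ.Edge Γ.Arrow) → FreeAlgebra k (QuiverGen Γ.Edge Γ.Arrow) → Prop
  /-- The product of two arrows of different cycles is zero. -/
  | zero (y y' : Γ.Arrow) (h : y.1.fst ≠ y'.1.fst) : Rel k (QuiverGen.a k y * QuiverGen.a k y') 0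
  /-- The two cycles at the same edge agree, the exceptional one being raised to the power
  `mult`. -/
  | comm (d : Γ.graph.Dart) (h : Γ.HasCycle d.fst) (h' : Γ.HasCycle d.snd) :
      Rel k (Γ.vertexPath k (Γ.multAt d.fst * Γ.valency d.fst) d)
        (Γ.vertexPath k (Γ.multAt d.snd * Γ.valency d.snd) d.symm)
  /-- Longer paths in a cycle vanish. -/
  | long (d : Γ.graph.Dart) (h : Γ.HasCycle d.fst) :
      Rel k (Γ.vertexPath k (Γ.multAt d.fst * Γ.valency d.fst + 1) d) 0

/-- The basic Brauer tree algebra `A_Γ`. -/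
abbrev BasicAlgebra (k : Type*) [Field k] := QuiverAlgebra k Γ.src Γ.tgt (Γ.Rel k)

/-! ### Green's walk -/

/-- The dart traversed at time `n` by Green's walk that starts with `d₀`: having
arrived at a vertex, continue along the next edge in the cyclic ordering around that vertex. -/
def walk (d₀ : Γ.graph.Dart) (n : ℕ) : Γ.graph.Dart := (fun d => Γ.next d.symm)^[n] d₀

/-- The time at which Green's walk first traverses an edge. -/
def firstTime (d₀ : Γ.graph.Dart) (f : Γ.Edge) : ℕ := sInf {n | Γ.edge (Γ.walk d₀ n) = f}

/-- The number of an edge (starting from `0`) in the enumeration by Green's walk. -/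
def label (d₀ : Γ.graph.Dart) (f : Γ.Edge) : Fin Γ.numEdges :=
  ⟨(Finset.univ.filter fun g => Γ.firstTime d₀ g < Γ.firstTime d₀ f).card,
    Finset.card_lt_univ_of_notMem (x := f) (by simp)⟩

/-! ### The graded complex `T'` over `A_S` given by Green's walk, and the grading on `A_Γ` -/

/-- The distance of an edge from the exceptional vertex. -/
def depth (f : Γ.Edge) : ℕ := sInf {n | ∃ v ∈ f.1, n = Γ.graph.dist Γ.exc v}

open Classical in
/-- The edge before `f` on the shortest path from the exceptional vertex to `f`
(junk if `f` is adjacent to the exceptional vertex). -/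
def parent (f : Γ.Edge) : Γ.Edge :=
  if h : ∃ g : Γ.Edge, Γ.depth g + 1 = Γ.depth f ∧ ∃ v, v ∈ g.1 ∧ v ∈ f.1 then h.choose else f

/-- The length of the shortest path of `A_S` from the vertex `parent f` to the vertex `f`; this is
the degree of the homomorphism of maximal rank from `P_{parent f}` to `P_f`. -/
def hLength (d₀ : Γ.graph.Dart) (f : Γ.Edge) : ℕ :=
  Γ.numEdges - ((Γ.label d₀ f : ℕ) - (Γ.label d₀ (Γ.parent f) : ℕ))

/-- The sum of the degrees of the maps `h` along the last `n` steps of the path from the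
exceptional vertex to `f`. -/
def shiftAux (d₀ : Γ.graph.Dart) : ℕ → Γ.Edge → ℤ
  | 0, _ => 0
  | n + 1, f => shiftAux d₀ n (Γ.parent f) + Γ.hLength d₀ f

/-- The vertical shift of `P_f` in `T'`: its top is in degree `-shift f` wherever it
occurs. -/
def shift (d₀ : Γ.graph.Dart) (f : Γ.Edge) : ℤ := Γ.shiftAux d₀ (Γ.depth f) f

section Grading

variable (k : Type*) [Field k] (d₀ : Γ.graph.Dart)

/-- The algebra `A_S` of the star of the same type. -/
abbrev Star := StarAlgebra k Γ.mult Γ.numEdges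

/-- The idempotent `ε` of `A_S` such that the term of `T_f` in (cohomological) degree `n` is
`A_S ε`: if `f` has depth `r`, then `P_f` is in degree `r` and, if `r > 0`, `P_{parent f}` is
in degree `r - 1`. -/
def termIdem (f : Γ.Edge) (n : ℤ) : Γ.Star k :=
  if n = Γ.depth f then StarAlgebra.vert k _ _ (Γ.label d₀ f)
  else if 0 < Γ.depth f ∧ n + 1 = Γ.depth f then
    StarAlgebra.vert k _ _ (Γ.label d₀ (Γ.parent f))
  else 0

/-- The term of `T_f` in degree `n`. -/
abbrev term (f : Γ.Edge) (n : ℤ) : Ideal (Γ.Star k) := Ideal.span {Γ.termIdem k d₀ f n}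

/-- The element of `A_S` such that the differential of `T_f` from degree `n` to degree `n'` is right
multiplication by it: `h : P_{parent f} ⟶ P_f` is right multiplication by the shortest path from
`parent f` to `f`. -/
def diffElt (f : Γ.Edge) (n n' : ℤ) : Γ.Star k :=
  if 0 < Γ.depth f ∧ n + 1 = Γ.depth f ∧ n' = Γ.depth f then
    StarAlgebra.path k _ _ (Γ.hLength d₀ f) (Γ.label d₀ (Γ.parent f)) * Γ.termIdem k d₀ f n'
  else 0

theorem mul_diffElt_mem (f : Γ.Edge) (n n' : ℤ) (x : Γ.Star k) :
    x * Γ.diffElt k d₀ f n n' ∈ Γ.term k d₀ f n' := by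
  unfold diffElt
  split_ifs
  · rw [← mul_assoc]
    exact Ideal.mul_mem_left _ _ (Ideal.subset_span rfl)
  · simp

theorem diffElt_mul_diffElt (f : Γ.Edge) (i j l : ℤ) :
    Γ.diffElt k d₀ f i j * Γ.diffElt k d₀ f j l = 0 := by
  unfold diffElt
  split_ifs with h h'
  · omega
  all_goals simp

/-- The differential of `T_f`. -/
def diff (f : Γ.Edge) (n n' : ℤ) : Γ.term k d₀ f n →ₗ[Γ.Star k] Γ.term k d₀ f n' where
  toFun x := ⟨x * Γ.diffElt k d₀ f n n', Γ.mul_diffElt_mem k d₀ f n n' x⟩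
  map_add' x y := by ext; simp [add_mul]
  map_smul' c x := by ext; simp [mul_assoc]

/-- The complex `T_f`: the stalk complex `P_f` in degree `0` if `f` is adjacent to the exceptional
vertex, and otherwise `P_{parent f} ⟶ P_f` in degrees `depth f - 1` and `depth f`. -/
def T (f : Γ.Edge) : CochainComplex (ModuleCat (Γ.Star k)) ℤ where
  X n := ModuleCat.of _ (Γ.term k d₀ f n)
  d n n' := ModuleCat.ofHom (Γ.diff k d₀ f n n')
  shape n n' h := by
    have h' : Γ.diff k d₀ f n n' = 0 := by
      ext x
      have : ¬ (0 < Γ.depth f ∧ n + 1 = Γ.depth f ∧ n' = Γ.depth f) := by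
        rintro ⟨-, h1, h2⟩
        exact h (by simp [h1, h2])
      simp [diff, diffElt, this]
    rw [h']
    rfl
  d_comp_d' i j l _ _ := by
    ext x
    simp [diff, mul_assoc, diffElt_mul_diffElt]

/-- The homogeneous component of degree `d` of the `n`-th term of the graded complex `T'_f`, that
is, of `T_f` with the vertical shifts which make the differentials homogeneous of degree `0` and put
the tops of all copies of the same `P_g` in the same degree. The component of degree `d` of `M⟨s⟩`
is `M_{d+s}`. -/
def TPiece (f : Γ.Edge) (n d : ℤ) : Set (Γ.term k d₀ f n) :=
  {x | (x : Γ.Star k) ∈ StarAlgebra.piece k Γ.mult Γ.numEdges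
    (d + if n = Γ.depth f then Γ.shift d₀ f else Γ.shift d₀ (Γ.parent f))}

/-- A morphism of complexes from `T'_f` to `T'_g` is homogeneous of degree `l`. -/
def IsHomogeneous (f g : Γ.Edge) (l : ℤ) (φ : Γ.T k d₀ f ⟶ Γ.T k d₀ g) : Prop :=
  ∀ (n d : ℤ) (x : Γ.term k d₀ f n), x ∈ Γ.TPiece k d₀ f n d →
    (φ.f n).hom x ∈ Γ.TPiece k d₀ g n (d + l)

/-- The class of a morphism of complexes in the homotopy category. -/
abbrev homotopyClass {f g : Γ.Edge} (φ : Γ.T k d₀ f ⟶ Γ.T k d₀ g) :=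
  (HomotopyCategory.quotient (ModuleCat (Γ.Star k)) (ComplexShape.up ℤ)).map φ

/-- The degree of an arrow `f ⟶ g` of the quiver of `A_Γ` in the grading constructed by taking
Green's walk: the lowest degree in which `Homgr (T'_f, T'_g)`, computed in the homotopy category,
is non-zero, where for a loop (`f = g`) only non-isomorphisms are considered. -/
def arrowDegree (y : Γ.Arrow) : ℤ :=
  sInf {l : ℤ | ∃ φ : Γ.T k d₀ (Γ.src y) ⟶ Γ.T k d₀ (Γ.tgt y),
    Γ.IsHomogeneous k d₀ _ _ l φ ∧ Γ.homotopyClass k d₀ φ ≠ 0 ∧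
      (Γ.src y = Γ.tgt y → ¬ IsIso (Γ.homotopyClass k d₀ φ))}

/-- The grading on `A_Γ` constructed by taking Green's walk around `Γ`. -/
def greenGrading (d : ℤ) : Submodule k (Γ.BasicAlgebra k) :=
  QuiverAlgebra.piece (Γ.Rel k) (Γ.arrowDegree k d₀) d

/-- The graded Cartan matrix of `A_Γ` for this grading. -/
def gradedCartan : Matrix Γ.Edge Γ.Edge (LaurentPolynomial ℤ) :=
  QuiverAlgebra.cartan Γ.src Γ.tgt (Γ.Rel k) (Γ.arrowDegree k d₀)

end Grading

end BrauerTree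

end

noncomputable section

set_option linter.unusedSectionVars false

namespace BrauerTree

variable {V : Type*} [Finite V] (Γ : BrauerTree V)

/-! ### Rooted structure of a Brauer tree -/

/-! Root the tree at the exceptional vertex. Green's walk is a depth-first traversal: once it enters
the subtree below an edge, it goes through all of it before coming back (`IsDown.exists_excursion`).
Two facts about the labels follow. Around each vertex they increase strictly in the cyclic order,
starting from the edge towards the root, or from `d₀` at the exceptional vertex
(`IsStart.label_lt`). An edge whose label lies strictly between those of an edge and one of its
children lies below the former (`IsDown.below_of_label_between`).

The complexes `T_f` have at most two terms, so the lowest degrees of morphisms between neighbours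
can be computed directly. Write `e` for the number of edges and `m` for the multiplicity. An arrow
around the exceptional vertex has as degree the difference of the labels of source and target,
reduced modulo `e` into `1, …, e`. Around any other vertex all arrows have degree `0`, except the
one from the parent edge to its last child, which has degree `m * e` (`arrowDegree_eq`). A full turn
thus has degree `e` at the exceptional vertex and `m * e` elsewhere, so the longest non-zero paths
all have degree `m * e`. This makes the relations homogeneous. The trivial paths, one socle element
per edge and the paths in between form a homogeneous basis: they span by straightening products, and
they are independent because the regular representation can be written down. This gives the grading,
and the entries of the Cartan matrix count paths by degree.

For the determinant let `s = 1 + q^e + ⋯ + q^((m-1)e)`, and let `S` be the matrix indexed by labels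
with `s` below, `q^e s` above and `1 + q^e s` on the diagonal. Up to conjugation by a diagonal
matrix of powers of `q` it is the graded Cartan matrix of the star. Up to sign and shift, the class
of `T_f` in the Grothendieck group is `[P_f] - [P_(parent f)]`. One therefore expects `C = D U S Uᵀ
D⁻¹`, where `U` subtracts from each row that of the parent and `D` is diagonal with entries signed
powers of `q`. This is checked entry by entry (`gradedCartan_eq_factor`). For edges without a common
vertex it rests on the second fact about labels: an edge outside the subtree below `parent g` lies
on the same side of `parent g` and of `g` in the numbering, so the differences in `U S Uᵀ` cancel.
Since parents have smaller labels, `U` is unitriangular. Finally `det S` is found from two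
triangular matrices that differ from `S` by constant matrices (`det_stairMatrix`). -/

/-- A dart pointing away from the exceptional vertex. -/
def IsDown (d : Γ.graph.Dart) : Prop :=
  Γ.graph.dist Γ.exc d.snd = Γ.graph.dist Γ.exc d.fst + 1

variable {Γ}

theorem isDown_or_symm (d : Γ.graph.Dart) : Γ.IsDown d ∨ Γ.IsDown d.symm := by
  rcases Γ.isTree.dist_eq_dist_add_one_of_adj Γ.exc d.adj with h | h
  · exact Or.inr h
  · exact Or.inl h

theorem IsDown.not_symm {d : Γ.graph.Dart} (h : Γ.IsDown d) : ¬ Γ.IsDown d.symm := by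
  simp only [IsDown, SimpleGraph.Dart.symm] at h ⊢
  simp only [Prod.swap]
  omega

theorem edge_symm (d : Γ.graph.Dart) : Γ.edge d.symm = Γ.edge d :=
  Subtype.ext d.edge_symm

theorem edge_eq_edge_iff {d d' : Γ.graph.Dart} :
    Γ.edge d = Γ.edge d' ↔ d = d' ∨ d = d'.symm := by
  rw [← SimpleGraph.dart_edge_eq_iff]
  exact Subtype.ext_iff

theorem mem_edge_iff {d : Γ.graph.Dart} {x : V} : x ∈ (Γ.edge d).1 ↔ x = d.fst ∨ x = d.snd := by
  change x ∈ s(d.fst, d.snd) ↔ _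
  simp

theorem edge_eq_of_fst_eq {d d' : Γ.graph.Dart} (h : Γ.edge d = Γ.edge d')
    (hf : d.fst = d'.fst) : d = d' := by
  rcases edge_eq_edge_iff.1 h with h | rfl
  · exact h
  · exact absurd hf d'.snd_ne_fst

theorem exists_isDown (f : Γ.Edge) : ∃ d, Γ.IsDown d ∧ Γ.edge d = f := by
  obtain ⟨⟨x, y⟩, hf⟩ := f
  let d : Γ.graph.Dart := ⟨(x, y), hf⟩
  rcases isDown_or_symm d with h | h
  · exact ⟨d, h, rfl⟩
  · exact ⟨d.symm, h, edge_symm d⟩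

theorem IsDown.eq_of_edge_eq {d d' : Γ.graph.Dart} (h : Γ.IsDown d) (h' : Γ.IsDown d')
    (he : Γ.edge d = Γ.edge d') : d = d' := by
  rcases edge_eq_edge_iff.1 he with he | rfl
  · exact he
  · exact absurd h h'.not_symm

/-- Uniqueness of the parent: the neighbour of a vertex that is closer to the root is the
penultimate vertex of the path from the root. -/
theorem IsDown.eq_of_snd_eq {d d' : Γ.graph.Dart} (h : Γ.IsDown d) (h' : Γ.IsDown d')
    (he : d.snd = d'.snd) : d = d' := by
  have key : ∀ d₁ : Γ.graph.Dart, Γ.IsDown d₁ → d₁.snd = d.snd →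
      ∀ p : Γ.graph.Walk Γ.exc d.snd, p.IsPath → d₁.fst = p.penultimate := by
    intro d₁ h₁ hs p hp
    have hadj : Γ.graph.Adj d.snd d₁.fst := hs ▸ d₁.adj.symm
    refine Γ.isTree.isAcyclic.eq_penultimate_of_adj_end hp hadj ?_
    obtain ⟨q, hq, hql⟩ := (Γ.isTree.connected Γ.exc d₁.fst).exists_path_of_dist
    refine Γ.isTree.isAcyclic.mem_support_of_ne_mem_support_of_adj_of_isPath hp hq hadj ?_
    intro hmem
    classical
    have h1 := SimpleGraph.dist_le (q.takeUntil _ hmem)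
    have h2 := q.length_takeUntil_le_length hmem
    unfold IsDown at h₁
    rw [hs] at h₁
    omega
  obtain ⟨p, hp, -⟩ := (Γ.isTree.connected Γ.exc d.snd).exists_path_of_dist
  have hf := (key d h rfl p hp).trans (key d' h' he.symm p hp).symm
  exact SimpleGraph.Dart.ext _ _ (Prod.ext hf he)

theorem IsDown.depth_edge {d : Γ.graph.Dart} (h : Γ.IsDown d) :
    Γ.depth (Γ.edge d) = Γ.graph.dist Γ.exc d.fst := by
  apply le_antisymm
  · exact Nat.sInf_le ⟨d.fst, mem_edge_iff.2 (Or.inl rfl), rfl⟩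
  · refine le_csInf ⟨_, d.fst, mem_edge_iff.2 (Or.inl rfl), rfl⟩ ?_
    rintro n ⟨x, hx, rfl⟩
    rcases mem_edge_iff.1 hx with rfl | rfl
    · exact le_rfl
    · rw [h]; omega

/-- `parent` is defined by a choice, and the choice is forced: of the four ways in which an edge of
depth one less can meet `d`, the distances leave only the one where it ends at `d.fst`. -/
theorem IsDown.parent_edge {d p : Γ.graph.Dart} (h : Γ.IsDown d) (hp : Γ.IsDown p)
    (hpd : p.snd = d.fst) : Γ.parent (Γ.edge d) = Γ.edge p := by
  have hex : ∃ g : Γ.Edge, Γ.depth g + 1 = Γ.depth (Γ.edge d) ∧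
      ∃ v, v ∈ g.1 ∧ v ∈ (Γ.edge d).1 := by
    refine ⟨Γ.edge p, ?_, d.fst, mem_edge_iff.2 (Or.inr hpd.symm), mem_edge_iff.2 (Or.inl rfl)⟩
    rw [hp.depth_edge, h.depth_edge, ← hpd, hp]
  unfold parent
  rw [dif_pos hex]
  obtain ⟨h1, x, hx, hx'⟩ := hex.choose_spec
  obtain ⟨p', hp', he⟩ := exists_isDown hex.choose
  rw [← he] at h1 hx ⊢
  rw [hp'.depth_edge, h.depth_edge] at h1
  unfold IsDown at h hp'
  congr 1
  refine IsDown.eq_of_snd_eq hp' hp ?_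
  rw [hpd]
  rcases mem_edge_iff.1 hx with rfl | rfl <;> rcases mem_edge_iff.1 hx' with h' | h'
  · rw [h'] at h1; omega
  · rw [h'] at h1; omega
  · exact h'
  · rw [h'] at hp'; omega

theorem IsDown.exists_parent {d : Γ.graph.Dart} (h : d.fst ≠ Γ.exc) :
    ∃ p, Γ.IsDown p ∧ p.snd = d.fst := by
  obtain ⟨p, hp, hpl⟩ := (Γ.isTree.connected Γ.exc d.fst).exists_path_of_dist
  have hnil : ¬ p.Nil := fun hn => h hn.eq.symm
  let q : Γ.graph.Dart := ⟨(p.penultimate, d.fst), p.adj_penultimate hnil⟩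
  have h1 := SimpleGraph.dist_le p.dropLast
  have h2 : p.dropLast.length + 1 = p.length := by
    rw [SimpleGraph.Walk.length_dropLast]
    have := SimpleGraph.Walk.not_nil_iff_lt_length.1 hnil
    omega
  refine ⟨q, ?_, rfl⟩
  rcases isDown_or_symm q with hq | hq
  · exact hq
  · exfalso
    have hq' : Γ.graph.dist Γ.exc p.penultimate = Γ.graph.dist Γ.exc d.fst + 1 := hq
    omega

theorem isDown_of_fst_eq_exc {d : Γ.graph.Dart} (h : d.fst = Γ.exc) : Γ.IsDown d := by
  rcases isDown_or_symm d with h' | h'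
  · exact h'
  · have h'' : Γ.graph.dist Γ.exc d.fst = Γ.graph.dist Γ.exc d.snd + 1 := h'
    rw [h, SimpleGraph.dist_self] at h''
    omega

theorem IsDown.of_fst_eq_snd {p d : Γ.graph.Dart} (hp : Γ.IsDown p) (h : d.fst = p.snd)
    (hne : d ≠ p.symm) : Γ.IsDown d := by
  rcases isDown_or_symm d with h' | h'
  · exact h'
  · exact absurd (by rw [← IsDown.eq_of_snd_eq h' hp h, d.symm_symm]) hne

theorem dist_exc_eq_zero {x : V} : Γ.graph.dist Γ.exc x = 0 ↔ x = Γ.exc := by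
  rw [Γ.isTree.connected.dist_eq_zero_iff, eq_comm]

/-- The truncated subtraction also covers the edges at the exceptional vertex, where `parent f` is
`f` itself. -/
theorem depth_parent (f : Γ.Edge) : Γ.depth (Γ.parent f) = Γ.depth f - 1 := by
  obtain ⟨d, hd, rfl⟩ := exists_isDown f
  by_cases h : d.fst = Γ.exc
  · have h0 : Γ.depth (Γ.edge d) = 0 := by
      rw [hd.depth_edge, dist_exc_eq_zero, h]
    have : Γ.parent (Γ.edge d) = Γ.edge d := by
      unfold parent
      rw [dif_neg]
      rintro ⟨g, hg, -⟩
      omega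
    rw [this, h0]
  · obtain ⟨p, hp, hpd⟩ := IsDown.exists_parent h
    rw [hd.parent_edge hp hpd, hp.depth_edge, hd.depth_edge, ← hpd, hp]
    rfl

/-! ### The subtree below an edge -/

variable (Γ) in
/-- The edge `f` lies in the subtree below the edge `p` (or is `p`). -/
def Below (p f : Γ.Edge) : Prop :=
  Γ.depth p ≤ Γ.depth f ∧ Γ.parent^[Γ.depth f - Γ.depth p] f = p

theorem Below.refl (f : Γ.Edge) : Γ.Below f f := ⟨le_rfl, by simp⟩

theorem Below.unique {p p' f : Γ.Edge} (h : Γ.Below p f) (h' : Γ.Below p' f)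
    (hd : Γ.depth p = Γ.depth p') : p = p' := by
  rw [← h.2, ← h'.2, hd]

theorem Below.of_parent {p c f : Γ.Edge} (h : Γ.Below c f) (hp : Γ.parent c = p)
    (hd : Γ.depth c = Γ.depth p + 1) : Γ.Below p f := by
  refine ⟨by have := h.1; omega, ?_⟩
  have h1 : Γ.depth f - Γ.depth p = (Γ.depth f - Γ.depth c) + 1 := by have := h.1; omega
  rw [h1, Function.iterate_succ_apply', h.2, hp]

theorem IsDown.depth_edge_child {p d : Γ.graph.Dart} (hp : Γ.IsDown p) (hd : Γ.IsDown d)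
    (h : d.fst = p.snd) : Γ.depth (Γ.edge d) = Γ.depth (Γ.edge p) + 1 := by
  rw [hd.depth_edge, hp.depth_edge, h, hp]

theorem next_iterate_fst (n : ℕ) (d : Γ.graph.Dart) : (Γ.next^[n] d).fst = d.fst := by
  induction n with
  | zero => rfl
  | succ n ih => rw [Function.iterate_succ_apply', Γ.next_fst, ih]

/-! ### The cycle of darts around a vertex -/

instance : Finite Γ.graph.Dart :=
  Finite.of_injective (fun d => d.toProd) (SimpleGraph.Dart.toProd_injective)

variable (Γ) in
/-- The darts that start at a vertex. -/
def dartsAt (x : V) : Finset Γ.graph.Dart := (Set.toFinite {d : Γ.graph.Dart | d.fst = x}).toFinset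

theorem mem_dartsAt {x : V} {d : Γ.graph.Dart} : d ∈ Γ.dartsAt x ↔ d.fst = x := by
  simp [dartsAt]

theorem card_dartsAt (x : V) : (Γ.dartsAt x).card = Γ.valency x := by
  rw [dartsAt, valency, ← Set.ncard_eq_toFinset_card]
  rfl

theorem isCycleOn_dartsAt (x : V) : Γ.next.IsCycleOn (Γ.dartsAt x : Set Γ.graph.Dart) := by
  have hs : (Γ.dartsAt x : Set Γ.graph.Dart) = {d | d.fst = x} := by
    ext d
    simp [mem_dartsAt]
  rw [hs]
  refine ⟨⟨fun d hd => ?_, Γ.next.injective.injOn, fun d hd => ⟨Γ.next.symm d, ?_, ?_⟩⟩, ?_⟩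
  · rw [Set.mem_ofPred_eq, Γ.next_fst]
    exact hd
  · rw [Set.mem_ofPred_eq, ← Γ.next_fst, Equiv.apply_symm_apply]
    exact hd
  · exact Equiv.apply_symm_apply _ _
  · intro d hd d' hd'
    exact Γ.next_cyclic d d' (hd.trans hd'.symm)

theorem next_iterate_eq_self_iff {n : ℕ} {d : Γ.graph.Dart} :
    Γ.next^[n] d = d ↔ Γ.valency d.fst ∣ n := by
  rw [← card_dartsAt, ← (isCycleOn_dartsAt d.fst).pow_apply_eq (mem_dartsAt.2 rfl),
    Equiv.Perm.iterate_eq_pow]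

theorem valency_pos (d : Γ.graph.Dart) : 0 < Γ.valency d.fst := by
  rw [← card_dartsAt, Finset.card_pos]
  exact ⟨d, mem_dartsAt.2 rfl⟩

theorem next_iterate_valency (d : Γ.graph.Dart) : Γ.next^[Γ.valency d.fst] d = d :=
  next_iterate_eq_self_iff.2 dvd_rfl

theorem exists_next_iterate {d d' : Γ.graph.Dart} (h : d.fst = d'.fst) :
    ∃ n < Γ.valency d.fst, Γ.next^[n] d = d' := by
  obtain ⟨n, hn, h⟩ := (isCycleOn_dartsAt d.fst).exists_pow_eq (mem_dartsAt.2 rfl)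
    (mem_dartsAt.2 h.symm)
  rw [card_dartsAt] at hn
  exact ⟨n, hn, by rw [Equiv.Perm.iterate_eq_pow, h]⟩

theorem next_iterate_mod (n : ℕ) (d : Γ.graph.Dart) :
    Γ.next^[n % Γ.valency d.fst] d = Γ.next^[n] d := by
  conv_rhs => rw [← Nat.mod_add_div n (Γ.valency d.fst), Function.iterate_add_apply,
    next_iterate_eq_self_iff.2 (Dvd.intro _ rfl)]

theorem next_iterate_inj {d : Γ.graph.Dart} {i j : ℕ} (hi : i < Γ.valency d.fst)
    (hj : j < Γ.valency d.fst) (h : Γ.next^[i] d = Γ.next^[j] d) : i = j := by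
  wlog hij : i ≤ j generalizing i j
  · exact (this hj hi h.symm (by omega)).symm
  obtain ⟨l, rfl⟩ := Nat.exists_eq_add_of_le hij
  rw [Function.iterate_add_apply] at h
  have := next_iterate_eq_self_iff.1 (Γ.next.injective.iterate i h).symm
  have := Nat.eq_zero_of_dvd_of_lt this (by omega)
  omega

end BrauerTree

namespace BrauerTree

variable {V : Type*} [Finite V] {Γ : BrauerTree V}

/-! ### Green's walk around a subtree -/

variable (Γ) in
/-- One step of Green's walk. -/
def step (d : Γ.graph.Dart) : Γ.graph.Dart := Γ.next d.symm

theorem walk_eq (d₀ : Γ.graph.Dart) (n : ℕ) : Γ.walk d₀ n = Γ.step^[n] d₀ := rfl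

theorem walk_add (d₀ : Γ.graph.Dart) (n j : ℕ) : Γ.walk d₀ (n + j) = Γ.step^[j] (Γ.walk d₀ n) := by
  rw [walk_eq, walk_eq, add_comm, Function.iterate_add_apply]

/-- Excursions concatenate: after coming back along the reverse of a dart, the next step of the walk
is the successor of that dart around the same vertex. The excursion into the `i`-th dart begins at
time `τ i`. -/
theorem exists_block {x : Γ.graph.Dart} {m : ℕ}
    (H : ∀ i < m, ∃ N, Γ.step^[N] (Γ.next^[i] x) = (Γ.next^[i] x).symm ∧
      ∀ j ≤ N, Γ.Below (Γ.edge (Γ.next^[i] x)) (Γ.edge (Γ.step^[j] (Γ.next^[i] x)))) :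
    ∃ τ : ℕ → ℕ, τ 0 = 0 ∧ (∀ i ≤ m, Γ.step^[τ i] x = Γ.next^[i] x) ∧ ∀ i < m, τ i < τ (i + 1) ∧
      ∀ j, τ i ≤ j → j < τ (i + 1) → Γ.Below (Γ.edge (Γ.next^[i] x)) (Γ.edge (Γ.step^[j] x)) := by
  choose! N hN hB using H
  -- The extra step after the `N l` steps of an excursion is the turn to the next dart.
  let τ : ℕ → ℕ := fun i => ∑ l ∈ Finset.range i, (N l + 1)
  have hτ : ∀ i, τ (i + 1) = N i + 1 + τ i := fun i => 
    (Finset.sum_range_succ (fun l => N l + 1) i).trans (add_comm _ _)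
  have h1 : ∀ i ≤ m, Γ.step^[τ i] x = Γ.next^[i] x := by
    intro i
    induction i with
    | zero => intro _; rfl
    | succ i ih =>
      intro hi
      rw [hτ, Function.iterate_add_apply, ih (by omega), Function.iterate_succ_apply',
        hN i (by omega), step, SimpleGraph.Dart.symm_symm, Function.iterate_succ_apply']
  refine ⟨τ, rfl, h1, fun i hi => ⟨by rw [hτ]; omega, fun j hj hj' => ?_⟩⟩
  rw [hτ] at hj'
  obtain ⟨l, rfl⟩ := Nat.exists_eq_add_of_le hj
  rw [add_comm, Function.iterate_add_apply, h1 i hi.le]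
  exact hB i hi l (by omega)

theorem IsDown.next_iterate_child {d : Γ.graph.Dart} (h : Γ.IsDown d) {i : ℕ}
    (hi : i + 1 < Γ.valency d.snd) : Γ.IsDown (Γ.next^[i] (Γ.next d.symm)) := by
  rw [← Function.iterate_succ_apply]
  refine h.of_fst_eq_snd (by rw [next_iterate_fst]; rfl) fun he => ?_
  have := Nat.le_of_dvd (by omega) (next_iterate_eq_self_iff.1 he)
  change Γ.valency d.snd ≤ _ at this
  omega

/-- Depth-first search: the walk makes an excursion into each child of `d` in turn and then leaves
through `d.symm`, without leaving the subtree. -/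
theorem IsDown.exists_excursion {d : Γ.graph.Dart} (h : Γ.IsDown d) :
    ∃ N, Γ.step^[N] d = d.symm ∧ ∀ j ≤ N, Γ.Below (Γ.edge d) (Γ.edge (Γ.step^[j] d)) := by
  obtain ⟨B, hB⟩ : ∃ B, ∀ x, Γ.graph.dist Γ.exc x ≤ B := by
    obtain ⟨B, hB⟩ := Set.finite_range (Γ.graph.dist Γ.exc) |>.bddAbove
    exact ⟨B, fun x => hB ⟨x, rfl⟩⟩
  -- Distances from the root are bounded by `B`, so induction on `k` is induction on a bound for the
  -- height of the subtree.
  obtain ⟨k, hk⟩ : ∃ k, B < Γ.graph.dist Γ.exc d.snd + k := ⟨B + 1, by omega⟩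
  induction k generalizing d with
  | zero => have := hB d.snd; omega
  | succ k ih =>
    have hv : 0 < Γ.valency d.snd := valency_pos d.symm
    obtain ⟨τ, h0, hτ, hlt⟩ := exists_block (Γ := Γ) (x := Γ.next d.symm)
      (m := Γ.valency d.snd - 1) (by
        intro i hi
        have hd := h.next_iterate_child (i := i) (by omega)
        refine ih hd ?_
        rw [hd, next_iterate_fst, Γ.next_fst]
        change B < Γ.graph.dist Γ.exc d.snd + 1 + k
        omega)
    refine ⟨τ (Γ.valency d.snd - 1) + 1, ?_, ?_⟩
    · rw [Function.iterate_succ_apply, step, hτ _ le_rfl, ← Function.iterate_succ_apply,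
        Nat.succ_eq_add_one, Nat.sub_add_cancel hv]
      exact next_iterate_valency d.symm
    · rintro (_ | j) hj
      · exact Below.refl _
      rw [Function.iterate_succ_apply, step]
      by_cases hj' : j = τ (Γ.valency d.snd - 1)
      · rw [hj', hτ _ le_rfl, ← Function.iterate_succ_apply, Nat.succ_eq_add_one,
          Nat.sub_add_cancel hv]
        have : Γ.next^[Γ.valency d.snd] d.symm = d.symm := next_iterate_valency d.symm
        rw [this, edge_symm]
        exact Below.refl _
      -- The least `i` with `j < τ (i + 1)` is the child whose excursion contains the time `j`.
      · have hex : ∃ i, j < τ (i + 1) := ⟨Γ.valency d.snd - 2, by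
          by_cases h1 : Γ.valency d.snd = 1
          · have e : Γ.valency d.snd - 1 = 0 := by omega
            rw [e, h0] at hj hj'
            omega
          · have : Γ.valency d.snd - 2 + 1 = Γ.valency d.snd - 1 := by omega
            rw [this]; omega⟩
        classical
        have hi := Nat.find_spec hex
        set i := Nat.find hex with hi_def
        have hle : τ i ≤ j := by
          by_cases hi0 : i = 0
          · rw [hi0, h0]; omega
          · have := Nat.find_min hex (m := i - 1) (by omega)
            rw [Nat.sub_add_cancel (by omega)] at this
            omega
        have him : i < Γ.valency d.snd - 1 := by
          by_contra hcon
          have hmono : ∀ l ≤ Γ.valency d.snd - 1, τ l ≤ j := by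
            intro l hl
            by_cases hl0 : l = 0
            · rw [hl0, h0]; omega
            · have := Nat.find_min hex (m := l - 1) (by omega)
              rw [Nat.sub_add_cancel (by omega)] at this
              omega
          have := hmono _ le_rfl
          omega
        have hd := h.next_iterate_child (i := i) (by omega)
        have hf : (Γ.next^[i] (Γ.next d.symm)).fst = d.snd := by
          rw [next_iterate_fst, Γ.next_fst]; rfl
        exact ((hlt i him).2 j hle hi).of_parent (hd.parent_edge h hf.symm)
          (h.depth_edge_child hd hf)

end BrauerTree

namespace BrauerTree

variable {V : Type*} [Finite V] {Γ : BrauerTree V}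

/-! ### First visits of Green's walk -/

/-- If none of the subtrees below `m` successive darts was visited before time `n`, then each is
entered through its top dart at time `τ i`: the walk before that only meets subtrees of earlier
siblings, and these are disjoint from it. -/
theorem exists_times {d₀ x : Γ.graph.Dart} {m n : ℕ} (hm : m ≤ Γ.valency x.fst)
    (hx : ∀ i < m, Γ.IsDown (Γ.next^[i] x)) (hn : Γ.walk d₀ n = x)
    (hB : ∀ j < n, ∀ i < m, ¬ Γ.Below (Γ.edge (Γ.next^[i] x)) (Γ.edge (Γ.walk d₀ j))) :
    ∃ τ : ℕ → ℕ, τ 0 = n ∧ ∀ i < m, τ i < τ (i + 1) ∧ Γ.walk d₀ (τ i) = Γ.next^[i] x ∧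
      (∀ j < τ i, ¬ Γ.Below (Γ.edge (Γ.next^[i] x)) (Γ.edge (Γ.walk d₀ j))) ∧
      ∀ j, n ≤ j → j < τ i →
        ∃ i' < m, Γ.Below (Γ.edge (Γ.next^[i'] x)) (Γ.edge (Γ.walk d₀ j)) := by
  obtain ⟨τ, h0, hτ, hlt⟩ := exists_block fun i hi => (hx i hi).exists_excursion
  have hloc : ∀ i ≤ m, ∀ j < τ i, ∃ i' < i,
      Γ.Below (Γ.edge (Γ.next^[i'] x)) (Γ.edge (Γ.step^[j] x)) := by
    intro i
    induction i with
    | zero => intro _ j hj; omega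
    | succ i ih =>
      intro hi j hj
      by_cases hji : j < τ i
      · obtain ⟨i', hi', h⟩ := ih (by omega) j hji
        exact ⟨i', by omega, h⟩
      · exact ⟨i, by omega, (hlt i hi).2 j (by omega) hj⟩
  refine ⟨fun i => n + τ i, by simp [h0], fun i hi => ⟨by have := (hlt i hi).1; dsimp only; omega,
    by rw [walk_add, hn, hτ i hi.le], fun j hj hb => ?_, fun j hj hj' => ?_⟩⟩ <;> dsimp only at *
  · by_cases hjn : j < n
    · exact hB j hjn i hi hb
    · obtain ⟨l, rfl⟩ := Nat.exists_eq_add_of_le (not_lt.1 hjn)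
      rw [walk_add, hn] at hb
      obtain ⟨i', hi', hb'⟩ := hloc i hi.le l (by omega)
      have he := hb.unique hb' (by
        rw [(hx i hi).depth_edge, (hx i' (by omega)).depth_edge, next_iterate_fst,
          next_iterate_fst])
      have := next_iterate_inj (by omega) (by omega)
        (edge_eq_of_fst_eq he (by rw [next_iterate_fst, next_iterate_fst]))
      omega
  · obtain ⟨l, rfl⟩ := Nat.exists_eq_add_of_le hj
    rw [walk_add, hn]
    obtain ⟨i', hi', hb'⟩ := hloc i hi.le l (by omega)
    exact ⟨i', by omega, hb'⟩

variable (Γ) in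
/-- The dart `d` is traversed before any other dart of the subtree below its edge. -/
def IsFresh (d₀ d : Γ.graph.Dart) : Prop :=
  Γ.walk d₀ (Γ.firstTime d₀ (Γ.edge d)) = d ∧ ∀ j < Γ.firstTime d₀ (Γ.edge d),
    ¬ Γ.Below (Γ.edge d) (Γ.edge (Γ.walk d₀ j))

theorem firstTime_eq {d₀ d : Γ.graph.Dart} {n : ℕ} (h : Γ.walk d₀ n = d)
    (hB : ∀ j < n, ¬ Γ.Below (Γ.edge d) (Γ.edge (Γ.walk d₀ j))) :
    Γ.firstTime d₀ (Γ.edge d) = n := by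
  apply le_antisymm
  · exact Nat.sInf_le (congrArg Γ.edge h)
  · refine le_csInf ⟨n, congrArg Γ.edge h⟩ fun j hj => ?_
    by_contra hlt
    have hj : Γ.edge (Γ.walk d₀ j) = Γ.edge d := hj
    exact hB j (not_le.1 hlt) (hj ▸ Below.refl _)

theorem isFresh_of {d₀ d : Γ.graph.Dart} {n : ℕ} (h : Γ.walk d₀ n = d)
    (hB : ∀ j < n, ¬ Γ.Below (Γ.edge d) (Γ.edge (Γ.walk d₀ j))) : Γ.IsFresh d₀ d := by
  have := firstTime_eq h hB
  exact ⟨by rw [this, h], by rw [this]; exact hB⟩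

variable {d₀ : Γ.graph.Dart} (hd₀ : d₀.fst = Γ.exc)

include hd₀ in
theorem exists_times_exc : ∃ τ : ℕ → ℕ, ∀ i < Γ.valency Γ.exc, τ i < τ (i + 1) ∧
    Γ.IsFresh d₀ (Γ.next^[i] d₀) ∧ Γ.firstTime d₀ (Γ.edge (Γ.next^[i] d₀)) = τ i := by
  obtain ⟨τ, -, h⟩ := exists_times (d₀ := d₀) (x := d₀) (m := Γ.valency Γ.exc) (n := 0)
    (by rw [hd₀]) (fun i _ => isDown_of_fst_eq_exc (by rw [next_iterate_fst, hd₀])) rfl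
    (by simp)
  refine ⟨τ, fun i hi => ?_⟩
  obtain ⟨h1, h2, h3, -⟩ := h i hi
  exact ⟨h1, isFresh_of h2 h3, firstTime_eq h2 h3⟩

/-- The index `0` stands for the edge of `p` itself and the positive indices for its children. The
last clause says that the walk stays below `p` until the child in question is reached; it yields
`IsDown.below_of_label_between`. -/
theorem exists_times_child {p : Γ.graph.Dart} (hp : Γ.IsDown p) (hf : Γ.IsFresh d₀ p) :
    ∃ τ : ℕ → ℕ, τ 0 = Γ.firstTime d₀ (Γ.edge p) ∧
      ∀ i < Γ.valency p.snd, Γ.firstTime d₀ (Γ.edge (Γ.next^[i] p.symm)) = τ i ∧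
      (0 < i → τ (i - 1) < τ i ∧ Γ.IsFresh d₀ (Γ.next^[i] p.symm)) ∧
      ∀ j, Γ.firstTime d₀ (Γ.edge p) < j → j < τ i →
        Γ.Below (Γ.edge p) (Γ.edge (Γ.walk d₀ j)) := by
  have hfst : ∀ i, (Γ.next^[i] (Γ.next p.symm)).fst = p.snd := fun i => by
    rw [next_iterate_fst, Γ.next_fst]; rfl
  obtain ⟨τ, h0, h⟩ := exists_times (d₀ := d₀) (x := Γ.next p.symm) (m := Γ.valency p.snd - 1)
    (n := Γ.firstTime d₀ (Γ.edge p) + 1) (by rw [Γ.next_fst]; exact Nat.sub_le _ _)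
    (fun i hi => hp.next_iterate_child (by omega)) (by rw [walk_add, hf.1]; rfl) (by
      intro j hj i hi hb
      have hd := hp.next_iterate_child (i := i) (by omega)
      by_cases hj' : j < Γ.firstTime d₀ (Γ.edge p)
      · exact hf.2 j hj' (hb.of_parent (hd.parent_edge hp (hfst i).symm)
          (hp.depth_edge_child hd (hfst i)))
      · have : j = Γ.firstTime d₀ (Γ.edge p) := by omega
        rw [this, hf.1] at hb
        have h1 := hb.1
        rw [hp.depth_edge_child hd (hfst i)] at h1
        omega)
  -- The times of the children were counted from `Γ.next p.symm`; they are shifted by one to make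
  -- room for `p.symm`.
  refine ⟨fun i => if i = 0 then Γ.firstTime d₀ (Γ.edge p) else τ (i - 1), by simp, ?_⟩
  rintro (_ | i) hi
  · refine ⟨by simp [edge_symm], by simp, fun j hj hj' => ?_⟩
    simp only [if_true] at hj'
    omega
  · obtain ⟨h1, h2, h3, h4⟩ := h i (by omega)
    rw [Function.iterate_succ_apply]
    refine ⟨by simpa using firstTime_eq h2 h3, fun _ => ⟨?_, isFresh_of h2 h3⟩, fun j hj hj' => ?_⟩
    · rcases i with _ | i
      · simp [h0]
      · simpa using (h i (by omega)).1
    · simp only [Nat.succ_ne_zero, if_false, Nat.add_sub_cancel] at hj'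
      obtain ⟨i', hi', hb⟩ := h4 j (by omega) hj'
      have hd := hp.next_iterate_child (i := i') (by omega)
      exact hb.of_parent (hd.parent_edge hp (hfst i').symm) (hp.depth_edge_child hd (hfst i'))

-- Induction on the distance from the root: freshness passes from a dart to its children by
-- `exists_times_child`.
include hd₀ in
theorem isFresh {d : Γ.graph.Dart} (hd : Γ.IsDown d) : Γ.IsFresh d₀ d := by
  obtain ⟨k, hk⟩ : ∃ k, Γ.graph.dist Γ.exc d.fst = k := ⟨_, rfl⟩
  induction k generalizing d with
  | zero =>
    rw [dist_exc_eq_zero] at hk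
    obtain ⟨i, hi, rfl⟩ := exists_next_iterate (hd₀.trans hk.symm)
    obtain ⟨τ, h⟩ := exists_times_exc hd₀
    exact (h i (hd₀ ▸ hi)).2.1
  | succ k ih =>
    obtain ⟨p, hp, hpd⟩ := IsDown.exists_parent (d := d) (fun h => by
      rw [dist_exc_eq_zero.2 h] at hk; omega)
    have hps : p.symm.fst = p.snd := rfl
    obtain ⟨i, hi, hi'⟩ := exists_next_iterate (d := p.symm) (d' := d) hpd
    obtain ⟨τ, -, h⟩ := exists_times_child hp (ih hp (by unfold IsDown at hp; rw [hpd] at hp; omega))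
    rw [← hi']
    refine ((h i hi).2.1 (Nat.pos_of_ne_zero fun h0 => ?_)).2
    rw [h0, Function.iterate_zero_apply] at hi'
    exact hp.not_symm (hi' ▸ hd)

include hd₀ in
theorem edge_walk_firstTime (f : Γ.Edge) : Γ.edge (Γ.walk d₀ (Γ.firstTime d₀ f)) = f := by
  obtain ⟨d, hd, rfl⟩ := exists_isDown f
  rw [(isFresh hd₀ hd).1]

include hd₀ in
theorem firstTime_injective : Function.Injective (Γ.firstTime d₀) := fun f g h => by
  rw [← edge_walk_firstTime hd₀ f, h, edge_walk_firstTime hd₀ g]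

theorem label_lt_label_iff {f g : Γ.Edge} :
    Γ.label d₀ f < Γ.label d₀ g ↔ Γ.firstTime d₀ f < Γ.firstTime d₀ g := by
  have mono : ∀ {f g : Γ.Edge}, Γ.firstTime d₀ f ≤ Γ.firstTime d₀ g →
      Γ.label d₀ f ≤ Γ.label d₀ g := by
    intro f g h
    rw [Fin.le_def]
    exact Finset.card_le_card fun x hx => by
      rw [Finset.mem_filter] at hx ⊢
      exact ⟨hx.1, hx.2.trans_le h⟩
  refine ⟨fun h => ?_, fun h => ?_⟩
  · by_contra hle
    exact absurd (mono (not_lt.1 hle)) (not_le.2 h)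
  · rw [Fin.lt_def]
    refine Finset.card_lt_card ⟨fun x hx => ?_, fun hsub => ?_⟩
    · rw [Finset.mem_filter] at hx ⊢
      exact ⟨hx.1, hx.2.trans h⟩
    · have := hsub (Finset.mem_filter.2 ⟨Finset.mem_univ f, h⟩)
      exact lt_irrefl _ (Finset.mem_filter.1 this).2

include hd₀ in
theorem label_injective : Function.Injective (Γ.label d₀) := fun f g h => by
  apply firstTime_injective hd₀
  apply le_antisymm
  · by_contra hlt
    exact h.symm.not_lt (label_lt_label_iff.2 (not_le.1 hlt))
  · by_contra hlt
    exact h.not_lt (label_lt_label_iff.2 (not_le.1 hlt))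

/-! ### The numbering of the edges around a vertex -/

variable (Γ) in
/-- The dart at which the numbering of the edges around its initial vertex starts. -/
def IsStart (d₀ y : Γ.graph.Dart) : Prop := y = d₀ ∨ Γ.IsDown y.symm

include hd₀ in
theorem exists_isStart (d : Γ.graph.Dart) : ∃ y, Γ.IsStart d₀ y ∧ y.fst = d.fst := by
  by_cases h : d.fst = Γ.exc
  · exact ⟨d₀, Or.inl rfl, hd₀.trans h.symm⟩
  · obtain ⟨p, hp, hpd⟩ := IsDown.exists_parent h
    exact ⟨p.symm, Or.inr (by rwa [SimpleGraph.Dart.symm_symm]), hpd⟩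

-- Counted from the start dart, the cyclic order around a vertex is the order of first visits, so
-- the labels drop only on completing a turn.
include hd₀ in
theorem IsStart.label_lt {y : Γ.graph.Dart} (hy : Γ.IsStart d₀ y) {i j : ℕ} (hij : i < j)
    (hj : j < Γ.valency y.fst) :
    Γ.label d₀ (Γ.edge (Γ.next^[i] y)) < Γ.label d₀ (Γ.edge (Γ.next^[j] y)) := by
  rw [label_lt_label_iff]
  have key : ∀ τ : ℕ → ℕ, (∀ i, 0 < i → i < Γ.valency y.fst → τ (i - 1) < τ i) → τ i < τ j := by
    intro τ h
    obtain ⟨l, rfl⟩ := Nat.exists_eq_add_of_lt hij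
    clear hij
    induction l with
    | zero => exact h _ (by omega) hj
    | succ l ih => exact (ih (by omega)).trans (h (i + (l + 1) + 1) (by omega) hj)
  rcases hy with rfl | hy
  · obtain ⟨τ, h⟩ := exists_times_exc hd₀
    rw [← hd₀] at h
    rw [(h i (by omega)).2.2, (h j hj).2.2]
    refine key τ fun l hl hlv => ?_
    have := (h (l - 1) (by omega)).1
    rwa [Nat.sub_add_cancel hl] at this
  · obtain ⟨τ, -, h⟩ := exists_times_child hy (isFresh hd₀ hy)
    rw [SimpleGraph.Dart.symm_symm] at h
    change ∀ i < Γ.valency y.fst, _ at h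
    rw [(h i (by omega)).1, (h j hj).1]
    exact key τ fun l hl hlv => ((h l hlv).2.1 hl).1

theorem IsDown.exists_child {p c : Γ.graph.Dart} (hc : Γ.IsDown c)
    (h : c.fst = p.snd) (hp : Γ.IsDown p) :
    ∃ i, 0 < i ∧ i < Γ.valency p.snd ∧ Γ.next^[i] p.symm = c := by
  obtain ⟨i, hi, hi'⟩ := exists_next_iterate (d := p.symm) (d' := c) h.symm
  refine ⟨i, Nat.pos_of_ne_zero fun h0 => ?_, hi, hi'⟩
  rw [h0, Function.iterate_zero_apply] at hi'
  exact hp.not_symm (hi' ▸ hc)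

include hd₀ in
theorem IsDown.label_lt_child {p c : Γ.graph.Dart} (hp : Γ.IsDown p) (hc : Γ.IsDown c)
    (h : c.fst = p.snd) : Γ.label d₀ (Γ.edge p) < Γ.label d₀ (Γ.edge c) := by
  obtain ⟨i, hi0, hi, rfl⟩ := hc.exists_child h hp
  have hy : Γ.IsStart d₀ p.symm := Or.inr (by rwa [SimpleGraph.Dart.symm_symm])
  have := hy.label_lt hd₀ hi0 hi
  rwa [Function.iterate_zero_apply, edge_symm] at this

-- Between the first visits to `p` and to its child `c` the walk has not left the subtree below `p`.
include hd₀ in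
theorem IsDown.below_of_label_between {p c : Γ.graph.Dart} (hp : Γ.IsDown p) (hc : Γ.IsDown c)
    (h : c.fst = p.snd) {f : Γ.Edge} (h1 : Γ.label d₀ (Γ.edge p) < Γ.label d₀ f)
    (h2 : Γ.label d₀ f < Γ.label d₀ (Γ.edge c)) : Γ.Below (Γ.edge p) f := by
  obtain ⟨i, hi0, hi, rfl⟩ := hc.exists_child h hp
  obtain ⟨τ, -, h⟩ := exists_times_child hp (isFresh hd₀ hp)
  rw [label_lt_label_iff] at h1 h2
  rw [(h i hi).1] at h2
  have := (h i hi).2.2 _ h1 h2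
  rwa [edge_walk_firstTime hd₀] at this

include hd₀ in
theorem label_start {y : Γ.graph.Dart} (hy : Γ.IsStart d₀ y) {d : Γ.graph.Dart}
    (h : d.fst = y.fst) : Γ.label d₀ (Γ.edge y) ≤ Γ.label d₀ (Γ.edge d) := by
  obtain ⟨i, hi, rfl⟩ := exists_next_iterate h.symm
  rcases Nat.eq_zero_or_pos i with rfl | hi0
  · exact le_rfl
  · exact (hy.label_lt hd₀ hi0 hi).le

end BrauerTree

/-! ### Generalities on algebras of quivers with relations -/

theorem map_cyclePath {A B X F : Type*} [Mul A] [Mul B] [FunLike F A B] [MulHomClass F A B]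
    (φ : F) (e a : X → A) (σ : Equiv.Perm X) (n : ℕ) (x : X) :
    φ (cyclePath e a σ n x) = cyclePath (fun x => φ (e x)) (fun x => φ (a x)) σ n x := by
  induction n generalizing x with
  | zero => rfl
  | succ n ih => rw [cyclePath, map_mul, ih]; rfl


namespace QuiverAlgebra

variable {k : Type*} [Field k] {X Y : Type*} [Fintype X] {src tgt : Y → X}
  (R : FreeAlgebra k (QuiverGen X Y) → FreeAlgebra k (QuiverGen X Y) → Prop)

/-- The element of `kQ / I` that belongs to the arrow `y`. -/
def arr (y : Y) : QuiverAlgebra k src tgt R :=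
  RingQuot.mkAlgHom k (QuiverRel k src tgt R) (QuiverGen.a k y)

local notation "𝒜" => QuiverAlgebra k src tgt R

theorem vert_mul_self (i : X) : (vert R i * vert R i : 𝒜) = vert R i := by
  rw [vert, ← map_mul]
  exact RingQuot.mkAlgHom_rel k (QuiverRel.idem i)

theorem vert_mul_of_ne {i j : X} (h : i ≠ j) : (vert R i * vert R j : 𝒜) = 0 := by
  rw [vert, vert, ← map_mul, RingQuot.mkAlgHom_rel k (QuiverRel.orth i j h), map_zero]

theorem sum_vert : (∑ i, vert R i : 𝒜) = 1 := by
  simp only [vert]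
  rw [← map_sum, RingQuot.mkAlgHom_rel k QuiverRel.one, map_one]

theorem vert_src_mul_arr (y : Y) : (vert R (src y) * arr R y : 𝒜) = arr R y := by
  rw [vert, arr, ← map_mul]
  exact RingQuot.mkAlgHom_rel k (QuiverRel.src y)

theorem arr_mul_vert_tgt (y : Y) : (arr R y * vert R (tgt y) : 𝒜) = arr R y := by
  rw [vert, arr, ← map_mul]
  exact RingQuot.mkAlgHom_rel k (QuiverRel.tgt y)

variable {R} in
theorem mk_rel {x x' : FreeAlgebra k (QuiverGen X Y)} (h : R x x') :
    RingQuot.mkAlgHom k (QuiverRel k src tgt R) x =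
      RingQuot.mkAlgHom k (QuiverRel k src tgt R) x' :=
  RingQuot.mkAlgHom_rel k (QuiverRel.rel x x' h)

variable {R} in
/-- The algebra homomorphism on the free algebra given by images of vertices and arrows. -/
def liftFree {B : Type*} [Semiring B] [Algebra k B] (ve : X → B) (va : Y → B) :
    FreeAlgebra k (QuiverGen X Y) →ₐ[k] B :=
  FreeAlgebra.lift k fun g => match g with
    | QuiverGen.vert i => ve i
    | QuiverGen.arr y => va y

@[simp] theorem liftFree_e {B : Type*} [Semiring B] [Algebra k B] (ve : X → B) (va : Y → B)
    (i : X) : liftFree (k := k) ve va (QuiverGen.e k i) = ve i := by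
  simp [liftFree, QuiverGen.e]

@[simp] theorem liftFree_a {B : Type*} [Semiring B] [Algebra k B] (ve : X → B) (va : Y → B)
    (y : Y) : liftFree (k := k) ve va (QuiverGen.a k y) = va y := by
  simp [liftFree, QuiverGen.a]

/-- The algebra homomorphism on `kQ / I` given by images of vertices and arrows. -/
def lift {B : Type*} [Semiring B] [Algebra k B] (ve : X → B) (va : Y → B)
    (idem : ∀ i, ve i * ve i = ve i) (orth : ∀ i j, i ≠ j → ve i * ve j = 0)
    (one : ∑ i, ve i = 1) (hsrc : ∀ y, ve (src y) * va y = va y)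
    (htgt : ∀ y, va y * ve (tgt y) = va y)
    (rel : ∀ x x', R x x' → liftFree (k := k) ve va x = liftFree ve va x') : 𝒜 →ₐ[k] B :=
  RingQuot.liftAlgHom k ⟨liftFree ve va, by
    intro x x' h
    induction h with
    | idem i => simp [idem]
    | orth i j h => simp [orth i j h]
    | one => simp [one]
    | src y => simp [hsrc]
    | tgt y => simp [htgt]
    | rel x x' h => exact rel x x' h⟩

section lift

variable {R} {B : Type*} [Semiring B] [Algebra k B] {ve : X → B} {va : Y → B}
    (idem : ∀ i, ve i * ve i = ve i) (orth : ∀ i j, i ≠ j → ve i * ve j = 0)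
    (one : ∑ i, ve i = 1) (hsrc : ∀ y, ve (src y) * va y = va y)
    (htgt : ∀ y, va y * ve (tgt y) = va y)
    (rel : ∀ x x', R x x' → liftFree (k := k) ve va x = liftFree ve va x')

theorem lift_mk (x : FreeAlgebra k (QuiverGen X Y)) :
    lift R ve va idem orth one hsrc htgt rel (RingQuot.mkAlgHom k _ x) = liftFree ve va x :=
  RingQuot.liftAlgHom_mkAlgHom_apply k _ _ x

theorem lift_vert (i : X) : lift R ve va idem orth one hsrc htgt rel (vert R i) = ve i := by
  rw [vert, lift_mk, liftFree_e]

theorem lift_arr (y : Y) : lift R ve va idem orth one hsrc htgt rel (arr R y) = va y := by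
  rw [arr, lift_mk, liftFree_a]

end lift

theorem eq_top_of_mul_mem (S : Submodule k 𝒜) (h1 : (1 : 𝒜) ∈ S)
    (hv : ∀ i, ∀ x ∈ S, vert R i * x ∈ S) (ha : ∀ y, ∀ x ∈ S, arr R y * x ∈ S) : S = ⊤ := by
  rw [eq_top_iff]
  rintro x -
  obtain ⟨x, rfl⟩ := RingQuot.mkAlgHom_surjective k (QuiverRel k src tgt R) x
  suffices h : ∀ s ∈ S, RingQuot.mkAlgHom k (QuiverRel k src tgt R) x * s ∈ S by
    simpa using h 1 h1
  induction x with
  | grade0 r =>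
    intro s hs
    rw [AlgHom.commutes, ← Algebra.smul_def]
    exact S.smul_mem r hs
  | grade1 g =>
    intro s hs
    cases g with
    | vert i => exact hv i s hs
    | arr y => exact ha y s hs
  | mul a b iha ihb =>
    intro s hs
    rw [map_mul, mul_assoc]
    exact iha _ (ihb s hs)
  | add a b iha ihb =>
    intro s hs
    rw [map_add, add_mul]
    exact S.add_mem (iha s hs) (ihb s hs)

variable (w : Y → ℤ)

/-- An upper bound for the homogeneous pieces needs stability under left multiplication by
generators only, since words are built up from the right end. -/
theorem piece_le (G : ℤ → Submodule k 𝒜) (h1 : (1 : 𝒜) ∈ G 0)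
    (hv : ∀ i d, ∀ x ∈ G d, vert R i * x ∈ G d)
    (ha : ∀ y d, ∀ x ∈ G d, arr R y * x ∈ G (d + w y)) (d : ℤ) : piece R w d ≤ G d := by
  refine Submodule.span_le.2 ?_
  rintro x ⟨L, rfl, rfl⟩
  induction L with
  | nil => simpa using h1
  | cons g L ih =>
    rw [List.map_cons, List.map_cons, List.prod_cons, List.sum_cons, map_mul]
    cases g with
    | vert i =>
      have : genDegree w (QuiverGen.vert i) = 0 := rfl
      rw [this, zero_add]
      exact hv i _ _ ih
    | arr y =>
      rw [add_comm]
      exact ha y _ _ ih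

theorem one_mem_piece : (1 : 𝒜) ∈ piece R w 0 :=
  Submodule.subset_span ⟨[], by simp, by simp⟩

variable {R w} in
theorem mul_mem_piece {d d' : ℤ} {x x' : 𝒜} (h : x ∈ piece R w d) (h' : x' ∈ piece R w d') :
    x * x' ∈ piece R w (d + d') := by
  induction h using Submodule.span_induction with
  | mem x hx =>
    obtain ⟨L, rfl, rfl⟩ := hx
    induction h' using Submodule.span_induction with
    | mem x' hx' =>
      obtain ⟨L', rfl, rfl⟩ := hx'
      exact Submodule.subset_span ⟨L ++ L', by simp, by simp⟩
    | zero => simp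
    | add a b _ _ ha hb => rw [mul_add]; exact Submodule.add_mem _ ha hb
    | smul c a _ ha => rw [mul_smul_comm]; exact Submodule.smul_mem _ c ha
  | zero => simp
  | add a b _ _ ha hb => rw [add_mul]; exact Submodule.add_mem _ ha hb
  | smul c a _ ha => rw [smul_mul_assoc]; exact Submodule.smul_mem _ c ha

theorem vert_mem_piece (i : X) : (vert R i : 𝒜) ∈ piece R w 0 :=
  Submodule.subset_span ⟨[QuiverGen.vert i], by simp [genDegree], by simp [vert, QuiverGen.e]⟩

theorem arr_mem_piece (y : Y) : (arr R y : 𝒜) ∈ piece R w (w y) :=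
  Submodule.subset_span ⟨[QuiverGen.arr y], by simp [genDegree], by simp [arr, QuiverGen.a]⟩

/-! ### Homomorphisms between the indecomposable projective modules -/

/-- The elements of degree `l` of `e_i A e_j`. -/
def corner (i j : X) (l : ℤ) : Submodule k 𝒜 where
  carrier := {x | x ∈ piece R w l ∧ vert R i * x = x ∧ x * vert R j = x}
  add_mem' ha hb := ⟨Submodule.add_mem _ ha.1 hb.1, by rw [mul_add, ha.2.1, hb.2.1],
    by rw [add_mul, ha.2.2, hb.2.2]⟩
  zero_mem' := ⟨Submodule.zero_mem _, by simp, by simp⟩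
  smul_mem' c x hx := ⟨Submodule.smul_mem _ c hx.1, by rw [mul_smul_comm, hx.2.1],
    by rw [smul_mul_assoc, hx.2.2]⟩

variable {R} in
theorem mem_proj {j : X} {x : 𝒜} : x ∈ proj R j ↔ x * vert R j = x := by
  rw [proj, Ideal.mem_span_singleton']
  constructor
  · rintro ⟨a, rfl⟩
    rw [mul_assoc, vert_mul_self]
  · intro h
    exact ⟨x, h⟩

/-- The generator of `P_i`. -/
def projGen (i : X) : proj (src := src) (tgt := tgt) R i := ⟨vert R i, mem_proj.2 (vert_mul_self R i)⟩

variable {R} in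
theorem proj_apply {i j : X}
    (φ : proj (src := src) (tgt := tgt) R i →ₗ[𝒜] proj (src := src) (tgt := tgt) R j)
    (x : proj (src := src) (tgt := tgt) R i) : (φ x : 𝒜) = x * φ (projGen R i) := by
  have h : x = (x : 𝒜) • projGen R i := Subtype.ext (mem_proj.1 x.2).symm
  conv_lhs => rw [h, map_smul]
  rfl

/-- A homomorphism out of `A e_i` is right multiplication by the image of `e_i`, so evaluation there
identifies homomorphisms of degree `l` with the part of degree `l` of `e_i A e_j`. -/
theorem finrank_homgr (i j : X) (l : ℤ) :
    Module.finrank k (homgr (src := src) (tgt := tgt) R w i j l) =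
      Module.finrank k (corner (src := src) (tgt := tgt) R w i j l) := by
  let ev : homgr (src := src) (tgt := tgt) R w i j l →ₗ[k] 𝒜 :=
    { toFun := fun φ => (φ.1 (projGen R i) : 𝒜)
      map_add' := fun _ _ => rfl
      map_smul' := fun _ _ => rfl }
  have hinj : Function.Injective ev := by
    intro φ ψ h
    apply Subtype.ext
    ext x
    rw [proj_apply φ.1, proj_apply ψ.1]
    exact congrArg _ h
  have hrange : LinearMap.range ev = corner R w i j l := by
    ext x
    constructor
    · rintro ⟨φ, rfl⟩
      refine ⟨?_, (proj_apply φ.1 (projGen R i)).symm, mem_proj.1 (φ.1 _).2⟩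
      have := φ.2 0 (projGen R i) (vert_mem_piece R w i)
      rwa [zero_add] at this
    · rintro ⟨h1, h2, h3⟩
      let φ : proj (src := src) (tgt := tgt) R i →ₗ[𝒜] proj (src := src) (tgt := tgt) R j :=
        { toFun := fun z => ⟨z * x, mem_proj.2 (by rw [mul_assoc, h3])⟩
          map_add' := fun a b => Subtype.ext (add_mul _ _ _)
          map_smul' := fun a b => Subtype.ext (mul_assoc _ _ _) }
      exact ⟨⟨φ, fun d z hz => mul_mem_piece hz h1⟩, h2⟩
  rw [← hrange, LinearMap.finrank_range_of_inj hinj]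

end QuiverAlgebra

/-! ### The Brauer star algebra -/

namespace StarAlgebra

variable (k : Type*) [Field k] (m n : ℕ)

/-- The arrow `j + 1 ⟶ j` of `A_S`. -/
def arrow (j : Fin n) : StarAlgebra k m n := QuiverAlgebra.arr (StarRel k m n) j

theorem path_zero (j : Fin n) : path k m n 0 j = vert k m n j := rfl

theorem path_succ (t : ℕ) (j : Fin n) : path k m n (t + 1) (finRotate n j) =
    arrow k m n j * path k m n t j := by
  rw [path, cyclePath, map_mul, Equiv.symm_apply_apply]
  rfl

theorem vert_mul_self (i : Fin n) : vert k m n i * vert k m n i = vert k m n i :=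
  QuiverAlgebra.vert_mul_self _ i

theorem vert_mul_of_ne {i j : Fin n} (h : i ≠ j) : vert k m n i * vert k m n j = 0 :=
  QuiverAlgebra.vert_mul_of_ne _ h

theorem vert_mul_path (t : ℕ) (j : Fin n) : vert k m n j * path k m n t j = path k m n t j := by
  cases t with
  | zero => exact vert_mul_self k m n j
  | succ t =>
    obtain ⟨j, rfl⟩ := (finRotate n).surjective j
    rw [path_succ, ← mul_assoc]
    congr 1
    exact QuiverAlgebra.vert_src_mul_arr _ j

theorem path_mul_path (t s : ℕ) (j : Fin n) :
    path k m n t ((finRotate n)^[t] j) * path k m n s j = path k m n (t + s) ((finRotate n)^[t] j) := by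
  induction t with
  | zero => rw [zero_add, Function.iterate_zero_apply, path_zero, vert_mul_path]
  | succ t ih =>
    rw [Function.iterate_succ_apply', path_succ, mul_assoc, ih, Nat.add_right_comm, path_succ]

theorem path_mul_vert (t : ℕ) (j : Fin n) :
    path k m n t ((finRotate n)^[t] j) * vert k m n j = path k m n t ((finRotate n)^[t] j) :=
  path_mul_path k m n t 0 j

theorem path_eq_zero {t : ℕ} (ht : m * n < t) (j : Fin n) : path k m n t j = 0 := by
  have hsurj : ∀ t : ℕ, Function.Surjective (finRotate n)^[t] :=
    fun t => (finRotate n).surjective.iterate t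
  obtain ⟨s, rfl⟩ := Nat.exists_eq_add_of_le ht
  obtain ⟨j, rfl⟩ := hsurj (m * n).succ j
  rw [← path_mul_path]
  have : path k m n (m * n).succ ((finRotate n)^[(m * n).succ] j) = 0 := by
    rw [path, QuiverAlgebra.mk_rel (StarRel.long _), map_zero]
  rw [this, zero_mul]

theorem piece_le_span_path (d : ℤ) :
    piece k m n d ≤ Submodule.span k {x | ∃ (t : ℕ) (j : Fin n), (t : ℤ) = d ∧ x = path k m n t j} := by
  let G : ℤ → Submodule k (StarAlgebra k m n) := fun d =>
    Submodule.span k {x | ∃ (t : ℕ) (j : Fin n), (t : ℤ) = d ∧ x = path k m n t j}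
  refine QuiverAlgebra.piece_le (StarRel k m n) (fun _ => 1) G ?_ ?_ ?_ d
  · rw [← QuiverAlgebra.sum_vert]
    exact Submodule.sum_mem _ fun i _ => Submodule.subset_span ⟨0, i, rfl, rfl⟩
  · intro i d x hx
    induction hx using Submodule.span_induction with
    | mem x hx =>
      obtain ⟨t, j, ht, rfl⟩ := hx
      change vert k m n i * _ ∈ _
      by_cases hij : i = j
      · rw [hij, vert_mul_path]
        exact Submodule.subset_span ⟨t, j, ht, rfl⟩
      · rw [← vert_mul_path, ← mul_assoc, vert_mul_of_ne k m n hij, zero_mul]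
        exact Submodule.zero_mem _
    | zero => simp
    | add a b _ _ ha hb => rw [mul_add]; exact Submodule.add_mem _ ha hb
    | smul c a _ ha => rw [mul_smul_comm]; exact Submodule.smul_mem _ c ha
  · intro y d x hx
    induction hx using Submodule.span_induction with
    | mem x hx =>
      obtain ⟨t, j, ht, rfl⟩ := hx
      change arrow k m n y * _ ∈ _
      by_cases hij : y = j
      · rw [hij, ← path_succ]
        exact Submodule.subset_span ⟨t + 1, _, by push_cast; rw [ht], rfl⟩
      · have h : arrow k m n y * vert k m n y = arrow k m n y :=
          QuiverAlgebra.arr_mul_vert_tgt _ y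
        rw [← vert_mul_path, ← mul_assoc, ← h, mul_assoc (arrow k m n y),
          vert_mul_of_ne k m n hij, mul_zero, zero_mul]
        exact Submodule.zero_mem _
    | zero => simp
    | add a b _ _ ha hb => rw [mul_add]; exact Submodule.add_mem _ ha hb
    | smul c a _ ha => rw [mul_smul_comm]; exact Submodule.smul_mem _ c ha

theorem path_mem_piece (t : ℕ) (j : Fin n) : path k m n t j ∈ piece k m n t := by
  induction t generalizing j with
  | zero => exact QuiverAlgebra.vert_mem_piece _ _ j
  | succ t ih =>
    obtain ⟨j, rfl⟩ := (finRotate n).surjective j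
    rw [path_succ, Nat.cast_add, add_comm]
    exact QuiverAlgebra.mul_mem_piece (QuiverAlgebra.arr_mem_piece _ (fun _ => 1) j) (ih j)

/-- The homogeneous elements of `e_i A_S e_j` are the multiples of paths. -/
theorem exists_smul_path {d : ℤ} {i j : Fin n} {x : StarAlgebra k m n} (hx : x ∈ piece k m n d)
    (hi : vert k m n i * x = x) (hj : x * vert k m n j = x) (h0 : x ≠ 0) :
    ∃ (t : ℕ) (c : k), (t : ℤ) = d ∧ c ≠ 0 ∧ (finRotate n)^[t] j = i ∧ t ≤ m * n ∧
      x = c • path k m n t i := by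
  -- Compressing by the two idempotents kills every path except the one of length `d` from `i` to
  -- `j`, if it exists.
  have key : ∀ y ∈ piece k m n d, ∃ c : k, vert k m n i * y * vert k m n j = 0 ∨
      (∃ t : ℕ, (t : ℤ) = d ∧ (finRotate n)^[t] j = i ∧
        vert k m n i * y * vert k m n j = c • path k m n t i) := by
    intro y hy
    replace hy := piece_le_span_path k m n d hy
    by_cases hd : ∃ t : ℕ, (t : ℤ) = d ∧ (finRotate n)^[t] j = i
    · obtain ⟨t, ht, hti⟩ := hd
      suffices h : ∃ c : k, vert k m n i * y * vert k m n j = c • path k m n t i by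
        obtain ⟨c, hc⟩ := h
        exact ⟨c, Or.inr ⟨t, ht, hti, hc⟩⟩
      induction hy using Submodule.span_induction with
      | mem y hy =>
        obtain ⟨s, l, hs, rfl⟩ := hy
        obtain rfl : s = t := by exact_mod_cast hs.trans ht.symm
        by_cases hil : i = l
        · rw [← hil, vert_mul_path, ← hti, path_mul_vert]
          exact ⟨1, (one_smul _ _).symm⟩
        · refine ⟨0, ?_⟩
          rw [← vert_mul_path, ← mul_assoc, vert_mul_of_ne k m n hil, zero_mul, zero_mul,
            zero_smul]
      | zero => exact ⟨0, by simp⟩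
      | add a b _ _ ha hb =>
        obtain ⟨c, hc⟩ := ha
        obtain ⟨c', hc'⟩ := hb
        exact ⟨c + c', by rw [mul_add, add_mul, hc, hc', add_smul]⟩
      | smul r a _ ha =>
        obtain ⟨c, hc⟩ := ha
        exact ⟨r * c, by rw [mul_smul_comm, smul_mul_assoc, hc, mul_smul]⟩
    · refine ⟨0, Or.inl ?_⟩
      induction hy using Submodule.span_induction with
      | mem y hy =>
        obtain ⟨s, l, hs, rfl⟩ := hy
        by_cases hil : i = l
        · obtain ⟨j', hj'⟩ := (finRotate n).surjective.iterate s i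
          have hne : j' ≠ j := fun h => hd ⟨s, hs, by rw [← h, hj']⟩
          rw [← hil, vert_mul_path, ← hj', ← path_mul_vert, mul_assoc, vert_mul_of_ne k m n hne,
            mul_zero]
        · rw [← vert_mul_path, ← mul_assoc, vert_mul_of_ne k m n hil, zero_mul, zero_mul]
      | zero => simp
      | add a b _ _ ha hb => rw [mul_add, add_mul, ha, hb, add_zero]
      | smul r a _ ha => rw [mul_smul_comm, smul_mul_assoc, ha, smul_zero]
  obtain ⟨c, h | ⟨t, ht, hti, h⟩⟩ := key x hx
  · rw [hi, hj] at h
    exact absurd h h0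
  · rw [hi, hj] at h
    refine ⟨t, c, ht, ?_, hti, ?_, h⟩
    · rintro rfl
      exact h0 (by rw [h, zero_smul])
    · by_contra hlt
      exact h0 (by rw [h, path_eq_zero k m n (not_le.1 hlt), smul_zero])

/-! ### Simple and uniserial modules of the star algebra -/

open Classical in
/-- The simple module at the vertex `p`, as a character of `A_S`. -/
def character (p : Fin n) : StarAlgebra k m n →ₐ[k] k :=
  QuiverAlgebra.lift (StarRel k m n) (fun i => if i = p then 1 else 0) (fun _ => 0)
    (fun i => by split_ifs <;> simp) (fun i j h => by
      split_ifs with h1 h2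
      · exact absurd (h1.trans h2.symm) h
      all_goals simp)
    (by simp) (by simp) (by simp) (by
      rintro x x' ⟨j⟩
      rw [cyclePath, map_mul, QuiverAlgebra.liftFree_a, zero_mul, map_zero])

theorem character_vert (p : Fin n) : character k m n p (vert k m n p) = 1 := by
  rw [character, vert, QuiverAlgebra.lift_vert, if_pos rfl]

theorem character_path (p : Fin n) {t : ℕ} (ht : 0 < t) (j : Fin n) :
    character k m n p (path k m n t j) = 0 := by
  obtain ⟨t, rfl⟩ := Nat.exists_eq_add_of_lt ht
  obtain ⟨j, rfl⟩ := (finRotate n).surjective j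
  rw [path_succ, map_mul, arrow, character, QuiverAlgebra.lift_arr, zero_mul]

open Classical in
/-- The action of a vertex on the uniserial module `P_j` of `A_S`. -/
def uniserialVert (j i : Fin n) : Module.End k (ℕ →₀ k) :=
  Finsupp.lift _ k _ fun t => if (finRotate n)^[t] j = i then Finsupp.single t 1 else 0

open Classical in
/-- The action of an arrow on the uniserial module `P_j` of `A_S`. -/
def uniserialArr (j i : Fin n) : Module.End k (ℕ →₀ k) :=
  Finsupp.lift _ k _ fun t =>
    if (finRotate n)^[t] j = i ∧ t < m * n then Finsupp.single (t + 1) 1 else 0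

open Classical in
theorem uniserialVert_single (j i : Fin n) (t : ℕ) :
    uniserialVert k n j i (Finsupp.single t 1) =
      if (finRotate n)^[t] j = i then Finsupp.single t 1 else 0 := by
  simp [uniserialVert]

open Classical in
theorem uniserialArr_single (j i : Fin n) (t : ℕ) :
    uniserialArr k m n j i (Finsupp.single t 1) =
      if (finRotate n)^[t] j = i ∧ t < m * n then Finsupp.single (t + 1) 1 else 0 := by
  simp [uniserialArr]

theorem end_ext {k ι : Type*} [Field k] {f g : Module.End k (ι →₀ k)}
    (h : ∀ t, f (Finsupp.single t 1) = g (Finsupp.single t 1)) : f = g :=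
  Finsupp.lhom_ext' fun t => LinearMap.ext_ring (h t)

theorem exists_cyclePath_single (j i : Fin n) (s t : ℕ) : ∃ c : k,
    cyclePath (uniserialVert k n j) (uniserialArr k m n j) (finRotate n) s i (Finsupp.single t 1) =
      c • Finsupp.single (t + s) 1 := by
  induction s generalizing i with
  | zero =>
    rw [cyclePath, uniserialVert_single]
    split_ifs
    · exact ⟨1, by simp⟩
    · exact ⟨0, by simp⟩
  | succ s ih =>
    obtain ⟨c, hc⟩ := ih ((finRotate n).symm i)
    rw [cyclePath, Module.End.mul_apply, hc, map_smul, uniserialArr_single]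
    split_ifs
    · exact ⟨c, rfl⟩
    · exact ⟨0, by simp⟩

/-- The uniserial module `P_j` of `A_S`. -/
def uniserial (j : Fin n) : StarAlgebra k m n →ₐ[k] Module.End k (ℕ →₀ k) :=
  QuiverAlgebra.lift (StarRel k m n) (uniserialVert k n j) (uniserialArr k m n j)
    (fun i => end_ext fun t => by
      rw [Module.End.mul_apply, uniserialVert_single]
      split_ifs with h
      · rw [uniserialVert_single, if_pos h]
      · rw [map_zero])
    (fun i i' h => end_ext fun t => by
      rw [Module.End.mul_apply, uniserialVert_single]
      split_ifs with h1
      · rw [uniserialVert_single, if_neg (fun h2 => h (h2.symm.trans h1))]; rfl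
      · rw [map_zero]; rfl)
    (end_ext fun t => by
      rw [LinearMap.sum_apply]
      simp only [uniserialVert_single]
      simp)
    (fun y => end_ext fun t => by
      rw [Module.End.mul_apply, uniserialArr_single]
      split_ifs with h
      · rw [uniserialVert_single, if_pos (by rw [Function.iterate_succ_apply', h.1])]
      · rw [map_zero])
    (fun y => end_ext fun t => by
      rw [Module.End.mul_apply, uniserialVert_single]
      split_ifs with h
      · rfl
      · rw [map_zero, uniserialArr_single, if_neg (fun h' => h h'.1)])
    (by
      rintro x x' ⟨i⟩
      rw [map_cyclePath, map_zero]
      simp only [QuiverAlgebra.liftFree_e, QuiverAlgebra.liftFree_a]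
      refine end_ext fun t => ?_
      -- After `m * n` arrows the vector has index at least `m * n`, and there every further arrow
      -- acts as zero.
      obtain ⟨c, hc⟩ := exists_cyclePath_single k m n j ((finRotate n).symm i) (m * n) t
      rw [cyclePath, Module.End.mul_apply, hc, map_smul, uniserialArr_single,
        if_neg (by omega), smul_zero]
      rfl)

/-- The vector of index `0` is the generator of `P_j`, and each arrow raises the index by one.
Vectors of index above `m * n` are killed by all arrows and are never reached from it. -/
theorem uniserial_path_single (j : Fin n) {t : ℕ} (ht : t ≤ m * n) :
    uniserial k m n j (path k m n t ((finRotate n)^[t] j)) (Finsupp.single 0 1) =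
      Finsupp.single t 1 := by
  induction t with
  | zero =>
    rw [path_zero, uniserial, vert, QuiverAlgebra.lift_vert, uniserialVert_single, if_pos rfl]
  | succ t ih =>
    rw [Function.iterate_succ_apply', path_succ, map_mul, Module.End.mul_apply, ih (by omega),
      uniserial, arrow, QuiverAlgebra.lift_arr, uniserialArr_single, if_pos ⟨rfl, by omega⟩]

theorem path_ne_zero {t : ℕ} (ht : t ≤ m * n) (i : Fin n) : path k m n t i ≠ 0 := by
  obtain ⟨j, rfl⟩ := (finRotate n).surjective.iterate t i
  intro h
  have := uniserial_path_single k m n j ht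
  rw [h, map_zero, LinearMap.zero_apply, eq_comm, Finsupp.single_eq_zero] at this
  exact one_ne_zero this

variable {n} in
theorem finRotate_iterate_val (t : ℕ) (j : Fin n) :
    (((finRotate n)^[t] j : Fin n) : ℕ) = (j + t) % n := by
  induction t with
  | zero => simp [Nat.mod_eq_of_lt j.2]
  | succ t ih =>
    have := j.neZero
    rw [Function.iterate_succ_apply', finRotate_apply, Fin.val_add, ih, Fin.val_one', ← Nat.add_mod,
      add_assoc]

end StarAlgebra

namespace BrauerTree

variable {V : Type*} [Finite V] {Γ : BrauerTree V} {k : Type*} [Field k] {d₀ : Γ.graph.Dart}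

/-! ### Morphisms between the complexes `T_f` -/

theorem termIdem_mul_self (f : Γ.Edge) (n : ℤ) :
    Γ.termIdem k d₀ f n * Γ.termIdem k d₀ f n = Γ.termIdem k d₀ f n := by
  unfold termIdem
  split_ifs
  · exact StarAlgebra.vert_mul_self _ _ _ _
  · exact StarAlgebra.vert_mul_self _ _ _ _
  · exact mul_zero _

theorem mem_term {f : Γ.Edge} {n : ℤ} {x : Γ.Star k} :
    x ∈ Γ.term k d₀ f n ↔ x * Γ.termIdem k d₀ f n = x := by
  rw [term, Ideal.mem_span_singleton']
  constructor
  · rintro ⟨a, rfl⟩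
    rw [mul_assoc, termIdem_mul_self]
  · intro h
    exact ⟨x, h⟩

variable (k d₀) in
/-- The generator of a term of `T_f`. -/
def termGen (f : Γ.Edge) (n : ℤ) : Γ.term k d₀ f n :=
  ⟨Γ.termIdem k d₀ f n, mem_term.2 (termIdem_mul_self f n)⟩

theorem term_hom_apply {f g : Γ.Edge} {n n' : ℤ}
    (φ : Γ.term k d₀ f n →ₗ[Γ.Star k] Γ.term k d₀ g n') (x : Γ.term k d₀ f n) :
    (φ x : Γ.Star k) = x * φ (termGen k d₀ f n) := by
  have h : x = (x : Γ.Star k) • termGen k d₀ f n := Subtype.ext (mem_term.1 x.2).symm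
  conv_lhs => rw [h, map_smul]
  rfl

/-- A morphism between terms of the complexes `T_f` as a linear map of ideals. -/
def termHom {f g : Γ.Edge} {n n' : ℤ} (ψ : (Γ.T k d₀ f).X n ⟶ (Γ.T k d₀ g).X n') :
    Γ.term k d₀ f n →ₗ[Γ.Star k] Γ.term k d₀ g n' := ψ.hom

/-- The elements of `A_S` such that a morphism of complexes is right multiplication by them. -/
def homElt {f g : Γ.Edge} (φ : Γ.T k d₀ f ⟶ Γ.T k d₀ g) (n : ℤ) : Γ.Star k :=
  termHom (φ.f n) (termGen k d₀ f n)

theorem hom_apply {f g : Γ.Edge} (φ : Γ.T k d₀ f ⟶ Γ.T k d₀ g) (n : ℤ) (x : Γ.term k d₀ f n) :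
    (termHom (φ.f n) x : Γ.Star k) = x * homElt φ n :=
  term_hom_apply _ x

theorem termIdem_mul_homElt {f g : Γ.Edge} (φ : Γ.T k d₀ f ⟶ Γ.T k d₀ g) (n : ℤ) :
    Γ.termIdem k d₀ f n * homElt φ n = homElt φ n :=
  (hom_apply φ n (termGen k d₀ f n)).symm

theorem homElt_mul_termIdem {f g : Γ.Edge} (φ : Γ.T k d₀ f ⟶ Γ.T k d₀ g) (n : ℤ) :
    homElt φ n * Γ.termIdem k d₀ g n = homElt φ n :=
  mem_term.1 (termHom (φ.f n) (termGen k d₀ f n)).2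

theorem hom_ext_homElt {f g : Γ.Edge} {φ ψ : Γ.T k d₀ f ⟶ Γ.T k d₀ g}
    (h : ∀ n, homElt φ n = homElt ψ n) : φ = ψ := by
  apply HomologicalComplex.hom_ext
  intro n
  apply ModuleCat.hom_ext
  apply LinearMap.ext
  intro (x : Γ.term k d₀ f n)
  apply Subtype.ext
  exact (hom_apply φ n x).trans ((congrArg _ (h n)).trans (hom_apply ψ n x).symm)

theorem homElt_id (f : Γ.Edge) (n : ℤ) : homElt (𝟙 (Γ.T k d₀ f)) n = Γ.termIdem k d₀ f n := rfl

theorem homElt_sub {f g : Γ.Edge} (φ ψ : Γ.T k d₀ f ⟶ Γ.T k d₀ g) (n : ℤ) :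
    homElt (φ - ψ) n = homElt φ n - homElt ψ n := rfl

theorem homElt_comp {f g h : Γ.Edge} (φ : Γ.T k d₀ f ⟶ Γ.T k d₀ g) (ψ : Γ.T k d₀ g ⟶ Γ.T k d₀ h)
    (n : ℤ) : homElt (φ ≫ ψ) n = homElt φ n * homElt ψ n :=
  hom_apply ψ n _

theorem homElt_comm {f g : Γ.Edge} (φ : Γ.T k d₀ f ⟶ Γ.T k d₀ g) (n : ℤ) :
    homElt φ n * Γ.diffElt k d₀ g n (n + 1) =
      Γ.termIdem k d₀ f n * Γ.diffElt k d₀ f n (n + 1) * homElt φ (n + 1) := by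
  have h := φ.comm n (n + 1)
  have h' := congrArg (fun ψ : (Γ.T k d₀ f).X n ⟶ (Γ.T k d₀ g).X (n + 1) =>
    (termHom ψ (termGen k d₀ f n) : Γ.Star k)) h
  exact h'.trans (hom_apply φ (n + 1) (Γ.diff k d₀ f n (n + 1) (termGen k d₀ f n)))

/-- The morphism of complexes given by right multiplication by elements of `A_S`. -/
def homMk {f g : Γ.Edge} (r : ℤ → Γ.Star k) (hr : ∀ n, r n * Γ.termIdem k d₀ g n = r n)
    (hc : ∀ n, Γ.termIdem k d₀ f n * (r n * Γ.diffElt k d₀ g n (n + 1)) =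
      Γ.termIdem k d₀ f n * (Γ.diffElt k d₀ f n (n + 1) * r (n + 1))) :
    Γ.T k d₀ f ⟶ Γ.T k d₀ g where
  f n := ModuleCat.ofHom
    { toFun := fun x : Γ.term k d₀ f n =>
        (⟨x * r n, mem_term.2 (by rw [mul_assoc, hr])⟩ : Γ.term k d₀ g n)
      map_add' := fun _ _ => Subtype.ext (add_mul _ _ _)
      map_smul' := fun _ _ => Subtype.ext (mul_assoc _ _ _) }
  comm' i j hij := by
    obtain rfl : i + 1 = j := hij
    apply ModuleCat.hom_ext
    apply LinearMap.ext
    intro (x : Γ.term k d₀ f i)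
    apply Subtype.ext
    change (x : Γ.Star k) * r i * Γ.diffElt k d₀ g i (i + 1) =
      x * Γ.diffElt k d₀ f i (i + 1) * r (i + 1)
    have hx : (x : Γ.Star k) * Γ.termIdem k d₀ f i = x := mem_term.1 (Subtype.prop _)
    rw [← hx, mul_assoc, mul_assoc, hc, mul_assoc _ (Γ.diffElt k d₀ f i (i + 1)), mul_assoc]

theorem homElt_homMk {f g : Γ.Edge} (r : ℤ → Γ.Star k)
    (hr : ∀ n, r n * Γ.termIdem k d₀ g n = r n)
    (hc : ∀ n, Γ.termIdem k d₀ f n * (r n * Γ.diffElt k d₀ g n (n + 1)) =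
      Γ.termIdem k d₀ f n * (Γ.diffElt k d₀ f n (n + 1) * r (n + 1))) (n : ℤ) :
    homElt (homMk r hr hc) n = Γ.termIdem k d₀ f n * r n := rfl

/-- The homotopy formula, evaluated at the generator of the term: each of the two summands contains
a differential as a factor. -/
theorem exists_of_homotopyClass_eq_zero {f g : Γ.Edge} {φ : Γ.T k d₀ f ⟶ Γ.T k d₀ g}
    (h : Γ.homotopyClass k d₀ φ = 0) (n : ℤ) : ∃ a b : Γ.Star k, homElt φ n =
      Γ.termIdem k d₀ f n * Γ.diffElt k d₀ f n (n + 1) * a +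
        b * Γ.diffElt k d₀ g (n - 1) n := by
  have h0 : Γ.homotopyClass k d₀ φ = Γ.homotopyClass k d₀ (0 : Γ.T k d₀ f ⟶ Γ.T k d₀ g) := by
    rw [h]; exact (Functor.map_zero _ _ _).symm
  let H := HomotopyCategory.homotopyOfEq _ _ h0
  have hn := H.comm n
  rw [dNext_eq H.hom (show (ComplexShape.up ℤ).Rel n (n + 1) from rfl),
    prevD_eq H.hom (show (ComplexShape.up ℤ).Rel (n - 1) n from by simp)] at hn
  have h' := congrArg (fun ψ : (Γ.T k d₀ f).X n ⟶ (Γ.T k d₀ g).X n =>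
    (termHom ψ (termGen k d₀ f n) : Γ.Star k)) hn
  let s : Γ.term k d₀ f (n + 1) →ₗ[Γ.Star k] Γ.term k d₀ g n := (H.hom (n + 1) n).hom
  let s' : Γ.term k d₀ f n →ₗ[Γ.Star k] Γ.term k d₀ g (n - 1) := (H.hom n (n - 1)).hom
  refine ⟨s (termGen k d₀ f (n + 1)), s' (termGen k d₀ f n), ?_⟩
  have h1 : homElt φ n = (s (Γ.diff k d₀ f n (n + 1) (termGen k d₀ f n)) : Γ.Star k) +
      (s' (termGen k d₀ f n) : Γ.Star k) * Γ.diffElt k d₀ g (n - 1) n + 0 := h'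
  rw [h1, add_zero, term_hom_apply s]
  rfl

theorem hLength_pos (f : Γ.Edge) : 0 < Γ.hLength d₀ f := by
  have := (Γ.label d₀ f).2
  unfold hLength
  omega

/-- The complexes are minimal: their differentials are multiplications by paths of positive length,
on which characters vanish. So a morphism with a trivial path as a component is not null-homotopic.
-/
theorem character_homElt {f g : Γ.Edge} {φ : Γ.T k d₀ f ⟶ Γ.T k d₀ g}
    (h : Γ.homotopyClass k d₀ φ = 0) (p : Fin Γ.numEdges) (n : ℤ) :
    StarAlgebra.character k _ _ p (homElt φ n) = 0 := by
  have key : ∀ (f : Γ.Edge) (n n' : ℤ),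
      StarAlgebra.character k _ _ p (Γ.diffElt k d₀ f n n') = 0 := by
    intro f n n'
    unfold diffElt
    split_ifs
    · rw [map_mul, StarAlgebra.character_path k _ _ p (hLength_pos f), zero_mul]
    · exact map_zero _
  obtain ⟨a, b, hab⟩ := exists_of_homotopyClass_eq_zero h n
  rw [hab, map_add, map_mul, map_mul, map_mul, key, key]
  simp

theorem diffElt_eq_zero {f : Γ.Edge} {n n' : ℤ} (h : n + 1 ≠ Γ.depth f) :
    Γ.diffElt k d₀ f n n' = 0 :=
  if_neg fun h' => h h'.2.1

theorem homElt_eq_zero_of_homotopyClass {f g : Γ.Edge} {φ : Γ.T k d₀ f ⟶ Γ.T k d₀ g}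
    (h : Γ.homotopyClass k d₀ φ = 0) {n : ℤ} (hf : n + 1 ≠ Γ.depth f) (hg : n ≠ Γ.depth g) :
    homElt φ n = 0 := by
  obtain ⟨a, b, hab⟩ := exists_of_homotopyClass_eq_zero h n
  rw [hab, diffElt_eq_zero hf, diffElt_eq_zero (by omega)]
  simp

/-! ### Homogeneity in terms of the multiplying elements -/

variable (d₀) in
/-- The vertical shift of the term of `T'_f` in degree `n`. -/
def termShift (f : Γ.Edge) (n : ℤ) : ℤ :=
  if n = Γ.depth f then Γ.shift d₀ f else Γ.shift d₀ (Γ.parent f)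

theorem termIdem_mem_piece (f : Γ.Edge) (n : ℤ) :
    Γ.termIdem k d₀ f n ∈ StarAlgebra.piece k Γ.mult Γ.numEdges 0 := by
  unfold termIdem
  split_ifs
  · exact QuiverAlgebra.vert_mem_piece _ _ _
  · exact QuiverAlgebra.vert_mem_piece _ _ _
  · exact Submodule.zero_mem _

theorem IsHomogeneous.homElt_mem {f g : Γ.Edge} {φ : Γ.T k d₀ f ⟶ Γ.T k d₀ g} {l : ℤ}
    (h : Γ.IsHomogeneous k d₀ f g l φ) (n : ℤ) :
    homElt φ n ∈ StarAlgebra.piece k Γ.mult Γ.numEdges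
      (l + termShift d₀ g n - termShift d₀ f n) := by
  have h1 : termGen k d₀ f n ∈ Γ.TPiece k d₀ f n (-termShift d₀ f n) := by
    change Γ.termIdem k d₀ f n ∈ StarAlgebra.piece k Γ.mult Γ.numEdges
      (-termShift d₀ f n + termShift d₀ f n)
    rw [neg_add_cancel]
    exact termIdem_mem_piece f n
  have h2 : homElt φ n ∈ StarAlgebra.piece k Γ.mult Γ.numEdges
    (-termShift d₀ f n + l + termShift d₀ g n) := h n _ _ h1
  rwa [show l + termShift d₀ g n - termShift d₀ f n =
    -termShift d₀ f n + l + termShift d₀ g n by ring]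

theorem isHomogeneous_of_homElt_mem {f g : Γ.Edge} {φ : Γ.T k d₀ f ⟶ Γ.T k d₀ g} {l : ℤ}
    (h : ∀ n, homElt φ n ∈ StarAlgebra.piece k Γ.mult Γ.numEdges
      (l + termShift d₀ g n - termShift d₀ f n)) : Γ.IsHomogeneous k d₀ f g l φ := by
  intro n d x hx
  have hx' : (x : Γ.Star k) ∈ StarAlgebra.piece k Γ.mult Γ.numEdges (d + termShift d₀ f n) := hx
  have := QuiverAlgebra.mul_mem_piece hx' (h n)
  rw [show d + termShift d₀ f n + (l + termShift d₀ g n - termShift d₀ f n) =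
    d + l + termShift d₀ g n by ring, ← hom_apply φ n x] at this
  exact this

theorem exists_homElt_ne_zero {f g : Γ.Edge} {φ : Γ.T k d₀ f ⟶ Γ.T k d₀ g}
    (h : Γ.homotopyClass k d₀ φ ≠ 0) : ∃ n, homElt φ n ≠ 0 := by
  by_contra! hn
  refine h ?_
  have : φ = 0 := hom_ext_homElt hn
  rw [this]
  exact Functor.map_zero _ _ _

theorem termIdem_depth (f : Γ.Edge) :
    Γ.termIdem k d₀ f (Γ.depth f) = StarAlgebra.vert k _ _ (Γ.label d₀ f) := if_pos rfl

theorem termIdem_parent {f : Γ.Edge} {R : ℕ} (h : Γ.depth f = R + 1) :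
    Γ.termIdem k d₀ f R = StarAlgebra.vert k _ _ (Γ.label d₀ (Γ.parent f)) := by
  unfold termIdem
  rw [if_neg (by rw [h]; push_cast; omega), if_pos ⟨by omega, by rw [h]; push_cast; rfl⟩]

theorem termIdem_eq_zero {f : Γ.Edge} {n : ℤ} (h1 : n ≠ Γ.depth f)
    (h2 : Γ.depth f = 0 ∨ n + 1 ≠ Γ.depth f) : Γ.termIdem k d₀ f n = 0 := by
  unfold termIdem
  rw [if_neg h1, if_neg (by omega)]

theorem homElt_eq_zero_left {f g : Γ.Edge} (φ : Γ.T k d₀ f ⟶ Γ.T k d₀ g) {n : ℤ}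
    (h : Γ.termIdem k d₀ f n = 0) : homElt φ n = 0 := by
  rw [← termIdem_mul_homElt, h, zero_mul]

theorem homElt_eq_zero_right {f g : Γ.Edge} (φ : Γ.T k d₀ f ⟶ Γ.T k d₀ g) {n : ℤ}
    (h : Γ.termIdem k d₀ g n = 0) : homElt φ n = 0 := by
  rw [← homElt_mul_termIdem, h, mul_zero]

theorem diffElt_parent {f : Γ.Edge} {R : ℕ} (h : Γ.depth f = R + 1) :
    Γ.diffElt k d₀ f R (R + 1) = StarAlgebra.path k _ _ (Γ.hLength d₀ f)
      (Γ.label d₀ (Γ.parent f)) * StarAlgebra.vert k _ _ (Γ.label d₀ f) := by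
  unfold diffElt
  rw [if_pos ⟨by omega, by rw [h]; push_cast; rfl, by rw [h]; push_cast; rfl⟩]
  congr 1
  rw [← termIdem_depth, h]
  push_cast
  rfl

end BrauerTree

namespace BrauerTree

variable {V : Type*} [Finite V] {Γ : BrauerTree V} {k : Type*} [Field k] {d₀ : Γ.graph.Dart}

/-! ### Degrees of morphisms between the complexes `T'_f` -/

variable (k) in
/-- The degrees of the morphisms `T'_f ⟶ T'_g` that determine the degree of an arrow. -/
def morphismDegrees (d₀ : Γ.graph.Dart) (f g : Γ.Edge) : Set ℤ :=
  {l | ∃ φ : Γ.T k d₀ f ⟶ Γ.T k d₀ g, Γ.IsHomogeneous k d₀ f g l φ ∧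
    Γ.homotopyClass k d₀ φ ≠ 0 ∧ (f = g → ¬ IsIso (Γ.homotopyClass k d₀ φ))}

theorem path_mul_path_eq_zero {m n t s : ℕ} (h : m * n < t + s) (i j : Fin n) :
    StarAlgebra.path k m n t i * StarAlgebra.path k m n s j = 0 := by
  obtain ⟨i, rfl⟩ := (finRotate n).surjective.iterate t i
  by_cases hij : i = j
  · rw [hij, StarAlgebra.path_mul_path, StarAlgebra.path_eq_zero k m n h]
  · rw [← StarAlgebra.path_mul_vert, ← StarAlgebra.vert_mul_path k m n s, mul_assoc,
      ← mul_assoc (StarAlgebra.vert k m n i), StarAlgebra.vert_mul_of_ne k m n hij]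
    simp

theorem path_mul_vert_of {m n t : ℕ} {i j : Fin n} (h : (i : ℕ) = (j + t) % n) :
    StarAlgebra.path k m n t i * StarAlgebra.vert k m n j = StarAlgebra.path k m n t i := by
  obtain rfl : i = (finRotate n)^[t] j :=
    Fin.ext (h.trans (StarAlgebra.finRotate_iterate_val t j).symm)
  exact StarAlgebra.path_mul_vert k m n t j

theorem path_mul_path_of {m n t s : ℕ} {i j : Fin n} (h : (i : ℕ) = (j + t) % n) :
    StarAlgebra.path k m n t i * StarAlgebra.path k m n s j = StarAlgebra.path k m n (t + s) i := by
  obtain rfl : i = (finRotate n)^[t] j :=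
    Fin.ext (h.trans (StarAlgebra.finRotate_iterate_val t j).symm)
  exact StarAlgebra.path_mul_path k m n t s j

theorem val_eq_of_iterate {n t : ℕ} {i j : Fin n} (h : (finRotate n)^[t] j = i) :
    (i : ℕ) = (j + t) % n := by
  rw [← h, StarAlgebra.finRotate_iterate_val]

theorem exists_add_eq_add_mul {n a b t : ℕ} (h : a = (b + t) % n) :
    ∃ q, b + t = a + n * q := ⟨(b + t) / n, by rw [h, Nat.mod_add_div]⟩

theorem numEdges_le_mul : Γ.numEdges ≤ Γ.mult * Γ.numEdges :=
  Nat.le_mul_of_pos_left _ Γ.mult_pos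

/-- Rewrites the truncated subtractions of `hLength` as an additive identity, fit for linear
arithmetic and for congruences modulo `e`. -/
theorem hLength_eq {f : Γ.Edge} (h : Γ.label d₀ (Γ.parent f) < Γ.label d₀ f) :
    Γ.hLength d₀ f + (Γ.label d₀ f : ℕ) = Γ.numEdges + Γ.label d₀ (Γ.parent f) := by
  have h1 := (Γ.label d₀ f).2
  have h2 := Fin.lt_def.1 h
  unfold hLength
  omega

theorem shift_child {f : Γ.Edge} {R : ℕ} (h : Γ.depth f = R + 1) :
    Γ.shift d₀ f = Γ.shift d₀ (Γ.parent f) + Γ.hLength d₀ f := by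
  rw [shift, h, shiftAux, shift, depth_parent, h, Nat.add_sub_cancel]

theorem termShift_depth (f : Γ.Edge) : termShift d₀ f (Γ.depth f) = Γ.shift d₀ f := if_pos rfl

theorem termShift_parent {f : Γ.Edge} {R : ℕ} (h : Γ.depth f = R + 1) :
    termShift d₀ f R = Γ.shift d₀ (Γ.parent f) := by
  rw [termShift, if_neg (by rw [h]; push_cast; omega)]

/-- The two complexes have only the term `P_p` in common, `p` the parent, in cohomological degree
`depth p` and with the same vertical shift. Its identity is a chain map, essential by
`character_homElt`; negative degrees would need paths of negative length. -/
theorem isLeast_morphismDegrees_child_parent {f : Γ.Edge}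
    (hd : Γ.depth f = Γ.depth (Γ.parent f) + 1) :
    IsLeast (Γ.morphismDegrees k d₀ f (Γ.parent f)) 0 := by
  obtain ⟨p, hp⟩ : ∃ p, Γ.parent f = p := ⟨_, rfl⟩
  rw [hp] at hd ⊢
  have hfp : f ≠ p := by rintro rfl; omega
  have hεp : Γ.termIdem k d₀ p (Γ.depth p) = StarAlgebra.vert k _ _ (Γ.label d₀ p) :=
    termIdem_depth p
  have hεf : Γ.termIdem k d₀ f (Γ.depth p) = StarAlgebra.vert k _ _ (Γ.label d₀ p) := by
    rw [termIdem_parent hd, hp]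
  have hsh : termShift d₀ f (Γ.depth p) = termShift d₀ p (Γ.depth p) := by
    rw [termShift_depth, termShift_parent hd, hp]
  constructor
  · let φ : Γ.T k d₀ f ⟶ Γ.T k d₀ p := homMk
      (fun n => if n = Γ.depth p then StarAlgebra.vert k _ _ (Γ.label d₀ p) else 0)
      (fun n => by
        split_ifs with h
        · rw [h, hεp, StarAlgebra.vert_mul_self]
        · exact zero_mul _)
      (fun n => by
        by_cases h : n + 1 = Γ.depth p
        · rw [termIdem_eq_zero (f := f) (by rw [hd]; push_cast; omega)
            (Or.inr (by rw [hd]; push_cast; omega)), zero_mul, zero_mul]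
        · rw [diffElt_eq_zero h, if_neg h, mul_zero, mul_zero, mul_zero, mul_zero])
    have hφ : homElt φ (Γ.depth p) = StarAlgebra.vert k _ _ (Γ.label d₀ p) := by
      rw [homElt_homMk, if_pos rfl, hεf, StarAlgebra.vert_mul_self]
    refine ⟨φ, isHomogeneous_of_homElt_mem fun n => ?_, fun h => ?_, fun h => absurd h hfp⟩
    · by_cases h : n = Γ.depth p
      · rw [h, hφ, hsh, zero_add, sub_self]
        exact QuiverAlgebra.vert_mem_piece _ _ _
      · rw [homElt_homMk, if_neg h, mul_zero]
        exact Submodule.zero_mem _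
    · have := character_homElt h (Γ.label d₀ p) (Γ.depth p)
      rw [hφ, StarAlgebra.character_vert] at this
      exact one_ne_zero this
  · rintro l ⟨φ, hφ, h0, -⟩
    obtain ⟨n, hn⟩ := exists_homElt_ne_zero h0
    have hnp : n = Γ.depth p := by
      by_contra hne
      by_cases h1 : n = Γ.depth f
      · exact hn (homElt_eq_zero_right φ (termIdem_eq_zero hne
          (Or.inr (by rw [h1, hd]; push_cast; omega))))
      · exact hn (homElt_eq_zero_left φ (termIdem_eq_zero h1
          (Or.inr (by rw [hd]; push_cast; omega))))
    have hm := hφ.homElt_mem n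
    subst hnp
    obtain ⟨t, c, ht, -⟩ := StarAlgebra.exists_smul_path k _ _ hm
      (i := Γ.label d₀ p) (j := Γ.label d₀ p) (by rw [← hεf, termIdem_mul_homElt])
      (by rw [← hεp, homElt_mul_termIdem]) hn
    rw [hsh] at ht
    omega

/-- Again only the term `P_p` matters, but now a chain map must be killed by composing with `h : P_p
⟶ P_f`. As `h` has degree less than `e` and endomorphisms of `P_p` have degrees divisible by `e`,
only the socle map, of degree `m * e`, is left. It is not null-homotopic because no homotopy can
reach this term. -/
theorem isLeast_morphismDegrees_parent_child {f : Γ.Edge}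
    (hd : Γ.depth f = Γ.depth (Γ.parent f) + 1)
    (hl : Γ.label d₀ (Γ.parent f) < Γ.label d₀ f) :
    IsLeast (Γ.morphismDegrees k d₀ (Γ.parent f) f) ((Γ.mult * Γ.numEdges : ℕ) : ℤ) := by
  have hlen := hLength_eq hl
  obtain ⟨p, hp⟩ : ∃ p, Γ.parent f = p := ⟨_, rfl⟩
  rw [hp] at hd hl hlen ⊢
  have hfp : p ≠ f := by rintro rfl; omega
  have hεp : Γ.termIdem k d₀ p (Γ.depth p) = StarAlgebra.vert k _ _ (Γ.label d₀ p) :=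
    termIdem_depth p
  have hεf : Γ.termIdem k d₀ f (Γ.depth p) = StarAlgebra.vert k _ _ (Γ.label d₀ p) := by
    rw [termIdem_parent hd, hp]
  have hsh : termShift d₀ f (Γ.depth p) = termShift d₀ p (Γ.depth p) := by
    rw [termShift_depth, termShift_parent hd, hp]
  have hround : (Γ.label d₀ p : ℕ) = (Γ.label d₀ p + Γ.mult * Γ.numEdges) % Γ.numEdges := by
    rw [Nat.add_mul_mod_self_right, Nat.mod_eq_of_lt (Γ.label d₀ p).2]
  constructor
  · let φ : Γ.T k d₀ p ⟶ Γ.T k d₀ f := homMk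
      (fun n => if n = Γ.depth p then
        StarAlgebra.path k _ _ (Γ.mult * Γ.numEdges) (Γ.label d₀ p) else 0)
      (fun n => by
        split_ifs with h
        · rw [h, hεf, path_mul_vert_of hround]
        · exact zero_mul _)
      (fun n => by
        have key : ∀ g : Γ.Edge, ∀ n n' : ℤ, Γ.diffElt k d₀ g n n' * StarAlgebra.path k _ _
            (Γ.mult * Γ.numEdges) (Γ.label d₀ p) = 0 := by
          intro g n n'
          unfold diffElt
          split_ifs with hg
          · have hpos := hLength_pos (d₀ := d₀) g
            rw [hg.2.2, termIdem_depth, mul_assoc, ← StarAlgebra.path_zero, ← mul_assoc]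
            by_cases he : Γ.label d₀ g = Γ.label d₀ p
            · rw [he, mul_assoc, StarAlgebra.path_zero, StarAlgebra.vert_mul_path,
                path_mul_path_eq_zero (by omega)]
            · rw [← StarAlgebra.vert_mul_path k _ _ _ (Γ.label d₀ p), StarAlgebra.path_zero,
                mul_assoc, ← mul_assoc (StarAlgebra.vert k _ _ (Γ.label d₀ g)),
                StarAlgebra.vert_mul_of_ne k _ _ he, zero_mul, mul_zero]
          · exact zero_mul _
        have h2 : (if n = Γ.depth p then
            StarAlgebra.path k _ _ (Γ.mult * Γ.numEdges) (Γ.label d₀ p) else 0) *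
              Γ.diffElt k d₀ f n (n + 1) = 0 := by
          split_ifs with h
          · rw [h, diffElt_parent hd, ← mul_assoc, path_mul_path_eq_zero, zero_mul]
            have hpos := hLength_pos (d₀ := d₀) f
            omega
          · exact zero_mul _
        rw [h2, mul_zero]
        split_ifs
        · rw [key, mul_zero]
        · rw [mul_zero, mul_zero])
    have hφ : homElt φ (Γ.depth p) =
        StarAlgebra.path k _ _ (Γ.mult * Γ.numEdges) (Γ.label d₀ p) := by
      rw [homElt_homMk, if_pos rfl, hεp, StarAlgebra.vert_mul_path]
    refine ⟨φ, isHomogeneous_of_homElt_mem fun n => ?_, fun h => ?_, fun h => absurd h hfp⟩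
    · by_cases h : n = Γ.depth p
      · rw [h, hφ, hsh, add_sub_cancel_right]
        exact StarAlgebra.path_mem_piece _ _ _ _ _
      · rw [homElt_homMk, if_neg h, mul_zero]
        exact Submodule.zero_mem _
    · have := homElt_eq_zero_of_homotopyClass h (n := Γ.depth p) (by omega) (by omega)
      rw [hφ] at this
      exact StarAlgebra.path_ne_zero k _ _ le_rfl _ this
  · rintro l ⟨φ, hφ, h0, -⟩
    obtain ⟨n, hn⟩ := exists_homElt_ne_zero h0
    have hnp : n = Γ.depth p := by
      by_contra hne
      by_cases h1 : n = Γ.depth f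
      · exact hn (homElt_eq_zero_left φ (termIdem_eq_zero hne
          (Or.inr (by rw [h1, hd]; push_cast; omega))))
      · exact hn (homElt_eq_zero_right φ (termIdem_eq_zero h1
          (Or.inr (by rw [hd]; push_cast; omega))))
    have hm := hφ.homElt_mem n
    subst hnp
    obtain ⟨t, c, ht, hc, hrot, htm, hx⟩ := StarAlgebra.exists_smul_path k _ _ hm
      (i := Γ.label d₀ p) (j := Γ.label d₀ p) (by rw [← hεp, termIdem_mul_homElt])
      (by rw [← hεf, homElt_mul_termIdem]) hn
    rw [hsh, add_sub_cancel_right] at ht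
    rw [← ht, Nat.cast_le]
    obtain ⟨q, hq⟩ := exists_add_eq_add_mul (val_eq_of_iterate hrot)
    have hcomm := homElt_comm φ (Γ.depth p)
    have hlt := Fin.lt_def.1 hl
    have hlab := (Γ.label d₀ f).2
    have hend : (Γ.label d₀ p : ℕ) = (Γ.label d₀ f + Γ.hLength d₀ f) % Γ.numEdges := by
      rw [add_comm, hlen, add_comm, Nat.add_mod_right, Nat.mod_eq_of_lt (Γ.label d₀ p).2]
    rw [hx, diffElt_parent hd, hp, path_mul_vert_of hend, smul_mul_assoc,
      path_mul_path_of (val_eq_of_iterate hrot), diffElt_eq_zero (f := p) (by omega), mul_zero,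
      zero_mul, smul_eq_zero, or_iff_right hc] at hcomm
    -- The composite with `h` vanishes, so it is too long a path; together with `t = e * q` and
    -- `hLength < e` this forces `q ≥ mult`.
    have hbig : Γ.mult * Γ.numEdges < t + Γ.hLength d₀ f := by
      by_contra hle
      exact StarAlgebra.path_ne_zero k _ _ (not_lt.1 hle) _ hcomm
    have hq' : t = Γ.numEdges * q := by omega
    rw [hq', mul_comm]
    refine Nat.mul_le_mul_left _ ?_
    by_contra hqm
    have : Γ.numEdges * (q + 1) ≤ Γ.numEdges * Γ.mult := Nat.mul_le_mul_left _ (by omega)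
    rw [Nat.mul_add, mul_comm _ Γ.mult] at this
    omega

/-- The identity of the common term `P_p` extends to a chain map because the shortest path from `p`
to `g` runs through `f` when `g` has the smaller label. A component `P_f ⟶ P_g` gives no lower
degree: the shortest path from `f` to `g` already has degree `0` after the vertical shifts. -/
theorem isLeast_morphismDegrees_siblings {f g : Γ.Edge} (hpar : Γ.parent f = Γ.parent g)
    (hd : Γ.depth f = Γ.depth (Γ.parent f) + 1) (hd' : Γ.depth g = Γ.depth (Γ.parent f) + 1)
    (hl : Γ.label d₀ (Γ.parent f) < Γ.label d₀ g) (hl' : Γ.label d₀ g < Γ.label d₀ f) :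
    IsLeast (Γ.morphismDegrees k d₀ f g) 0 := by
  have hlen := hLength_eq (hl.trans hl')
  have hlen' := hLength_eq (hpar ▸ hl)
  rw [← hpar] at hlen'
  obtain ⟨p, hp⟩ : ∃ p, Γ.parent f = p := ⟨_, rfl⟩
  rw [hp] at hd hd' hpar hl hlen hlen'
  have hfg : f ≠ g := by rintro rfl; exact lt_irrefl _ hl'
  have hεg : Γ.termIdem k d₀ g (Γ.depth p) = StarAlgebra.vert k _ _ (Γ.label d₀ p) := by
    rw [termIdem_parent hd', ← hpar]
  have hεf : Γ.termIdem k d₀ f (Γ.depth p) = StarAlgebra.vert k _ _ (Γ.label d₀ p) := by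
    rw [termIdem_parent hd, hp]
  have hdf : (Γ.depth p : ℤ) + 1 = Γ.depth f := by rw [hd]; push_cast; rfl
  have hdg : (Γ.depth p : ℤ) + 1 = Γ.depth g := by rw [hd']; push_cast; rfl
  have hεg' : Γ.termIdem k d₀ g (Γ.depth p + 1) = StarAlgebra.vert k _ _ (Γ.label d₀ g) := by
    rw [hdg, termIdem_depth]
  have hεf' : Γ.termIdem k d₀ f (Γ.depth p + 1) = StarAlgebra.vert k _ _ (Γ.label d₀ f) := by
    rw [hdf, termIdem_depth]
  have hsh : termShift d₀ f (Γ.depth p) = termShift d₀ g (Γ.depth p) := by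
    rw [termShift_parent hd', termShift_parent hd, hp, ← hpar]
  have hlt := Fin.lt_def.1 hl
  have hlt' := Fin.lt_def.1 hl'
  have hlab := (Γ.label d₀ f).2
  have hsh' : termShift d₀ g (Γ.depth p + 1) - termShift d₀ f (Γ.depth p + 1) =
      (Γ.label d₀ f : ℤ) - Γ.label d₀ g := by
    conv_lhs => rw [hdg, termShift_depth, ← hdg, hdf, termShift_depth, shift_child hd,
      shift_child hd', hp, ← hpar]
    omega
  have hend : (Γ.label d₀ p : ℕ) = (Γ.label d₀ f + Γ.hLength d₀ f) % Γ.numEdges := by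
    rw [add_comm, hlen, add_comm, Nat.add_mod_right, Nat.mod_eq_of_lt (Γ.label d₀ p).2]
  have hend' : (Γ.label d₀ p : ℕ) = (Γ.label d₀ g + Γ.hLength d₀ g) % Γ.numEdges := by
    rw [add_comm, hlen', add_comm, Nat.add_mod_right, Nat.mod_eq_of_lt (Γ.label d₀ p).2]
  have hend'' : (Γ.label d₀ f : ℕ) =
      (Γ.label d₀ g + ((Γ.label d₀ f : ℕ) - Γ.label d₀ g)) % Γ.numEdges := by
    rw [Nat.add_sub_cancel' hlt'.le, Nat.mod_eq_of_lt hlab]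
  constructor
  · let φ : Γ.T k d₀ f ⟶ Γ.T k d₀ g := homMk
      (fun n => if n = Γ.depth p then StarAlgebra.vert k _ _ (Γ.label d₀ p) else
        if n = Γ.depth p + 1 then
          StarAlgebra.path k _ _ ((Γ.label d₀ f : ℕ) - Γ.label d₀ g) (Γ.label d₀ f) else 0)
      (fun n => by
        split_ifs with h h'
        · rw [h, hεg, StarAlgebra.vert_mul_self]
        · rw [h', hεg', path_mul_vert_of hend'']
        · exact zero_mul _)
      (fun n => by
        by_cases h : n = Γ.depth p
        · rw [if_pos h, if_neg (by omega), if_pos (by omega), h, diffElt_parent hd,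
            diffElt_parent hd', hp, ← hpar, path_mul_vert_of hend, path_mul_vert_of hend',
            path_mul_path_of hend, StarAlgebra.vert_mul_path]
          congr 2
          omega
        · rw [diffElt_eq_zero (f := f) (by omega), diffElt_eq_zero (f := g) (by omega), mul_zero,
            zero_mul])
    have hφ : homElt φ (Γ.depth p) = StarAlgebra.vert k _ _ (Γ.label d₀ p) := by
      rw [homElt_homMk, if_pos rfl, hεf, StarAlgebra.vert_mul_self]
    refine ⟨φ, isHomogeneous_of_homElt_mem fun n => ?_, fun h => ?_, fun h => absurd h hfg⟩
    · by_cases h : n = Γ.depth p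
      · rw [h, hφ, hsh, zero_add, sub_self]
        exact QuiverAlgebra.vert_mem_piece _ _ _
      · by_cases h' : n = Γ.depth p + 1
        · rw [homElt_homMk, if_neg h, if_pos h', h', hεf', StarAlgebra.vert_mul_path, zero_add,
            hsh', ← Nat.cast_sub hlt'.le]
          exact StarAlgebra.path_mem_piece _ _ _ _ _
        · rw [homElt_homMk, if_neg h, if_neg h', mul_zero]
          exact Submodule.zero_mem _
    · have := character_homElt h (Γ.label d₀ p) (Γ.depth p)
      rw [hφ, StarAlgebra.character_vert] at this
      exact one_ne_zero this
  · rintro l ⟨φ, hφ, h0, -⟩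
    obtain ⟨n, hn⟩ := exists_homElt_ne_zero h0
    have hm := hφ.homElt_mem n
    by_cases hnp : n = Γ.depth p
    · subst hnp
      obtain ⟨t, c, ht, -⟩ := StarAlgebra.exists_smul_path k _ _ hm
        (i := Γ.label d₀ p) (j := Γ.label d₀ p) (by rw [← hεf, termIdem_mul_homElt])
        (by rw [← hεg, homElt_mul_termIdem]) hn
      rw [hsh] at ht
      omega
    · have hnp' : n = Γ.depth p + 1 := by
        by_contra hne
        exact hn (homElt_eq_zero_left φ (termIdem_eq_zero (by omega) (Or.inr (by omega))))
      subst hnp'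
      obtain ⟨t, c, ht, -, hrot, -⟩ := StarAlgebra.exists_smul_path k _ _ hm
        (i := Γ.label d₀ f) (j := Γ.label d₀ g) (by rw [← hεf', termIdem_mul_homElt])
        (by rw [← hεg', homElt_mul_termIdem]) hn
      rw [add_sub_assoc, hsh'] at ht
      obtain ⟨q, hq⟩ := exists_add_eq_add_mul (val_eq_of_iterate hrot)
      have : 0 ≤ Γ.numEdges * q := Nat.zero_le _
      have hle : (Γ.label d₀ f : ℕ) ≤ Γ.label d₀ g + t := by rw [hq]; exact Nat.le_add_right _ _
      omega

/-- Between stalk complexes there are no homotopies, and the morphisms are multiples of paths of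
length congruent to the difference of the labels modulo `e`. The value is the least positive such
length; length `0` occurs only for `f = g` and gives an isomorphism. -/
theorem isLeast_morphismDegrees_depth_zero (hinj : Function.Injective (Γ.label d₀)) {f g : Γ.Edge}
    (hf : Γ.depth f = 0) (hg : Γ.depth g = 0) :
    IsLeast (Γ.morphismDegrees k d₀ f g) ((Γ.label d₀ f : ℤ) - Γ.label d₀ g +
      if Γ.label d₀ f ≤ Γ.label d₀ g then (Γ.numEdges : ℤ) else 0) := by
  have hεf : Γ.termIdem k d₀ f 0 = StarAlgebra.vert k _ _ (Γ.label d₀ f) := by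
    rw [← termIdem_depth, hf]; rfl
  have hεg : Γ.termIdem k d₀ g 0 = StarAlgebra.vert k _ _ (Γ.label d₀ g) := by
    rw [← termIdem_depth, hg]; rfl
  have hsh : ∀ f : Γ.Edge, Γ.depth f = 0 → termShift d₀ f 0 = 0 := by
    intro f hf
    rw [termShift, if_pos (by rw [hf]; rfl), shift, hf, shiftAux]
  have hlabf := (Γ.label d₀ f).2
  have hlabg := (Γ.label d₀ g).2
  obtain ⟨L, hL⟩ : ∃ L : ℕ, (L : ℤ) = (Γ.label d₀ f : ℤ) - Γ.label d₀ g +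
      if Γ.label d₀ f ≤ Γ.label d₀ g then (Γ.numEdges : ℤ) else 0 := by
    refine ⟨_, Int.toNat_of_nonneg ?_⟩
    split_ifs with h
    · omega
    · have := Fin.le_def.not.1 h; omega
  have hLpos : 0 < L ∧ L ≤ Γ.numEdges := by
    split_ifs at hL with h
    · have := Fin.le_def.1 h; omega
    · have := Fin.le_def.not.1 h; omega
  have hLle := hLpos.2.trans numEdges_le_mul
  have hend : (Γ.label d₀ f : ℕ) = (Γ.label d₀ g + L) % Γ.numEdges := by
    split_ifs at hL with h
    · rw [show (Γ.label d₀ g : ℕ) + L = Γ.label d₀ f + Γ.numEdges by omega, Nat.add_mod_right,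
        Nat.mod_eq_of_lt hlabf]
    · rw [show (Γ.label d₀ g : ℕ) + L = Γ.label d₀ f by omega, Nat.mod_eq_of_lt hlabf]
  rw [← hL]
  have hdf : ∀ n n', Γ.diffElt k d₀ f n n' = 0 := fun n n' => if_neg (by omega)
  have hdg : ∀ n n', Γ.diffElt k d₀ g n n' = 0 := fun n n' => if_neg (by omega)
  have hz : ∀ (φ : Γ.T k d₀ f ⟶ Γ.T k d₀ g) (n : ℤ), n ≠ 0 → homElt φ n = 0 := fun φ n hn =>
    homElt_eq_zero_left φ (termIdem_eq_zero (by omega) (Or.inl hf))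
  constructor
  · let φ : Γ.T k d₀ f ⟶ Γ.T k d₀ g := homMk
      (fun n => if n = 0 then StarAlgebra.path k _ _ L (Γ.label d₀ f) else 0)
      (fun n => by
        split_ifs with h
        · rw [h, hεg, path_mul_vert_of hend]
        · exact zero_mul _)
      (fun n => by rw [hdf, hdg, mul_zero, zero_mul])
    have hφ : homElt φ 0 = StarAlgebra.path k _ _ L (Γ.label d₀ f) := by
      rw [homElt_homMk, if_pos rfl, hεf, StarAlgebra.vert_mul_path]
    refine ⟨φ, isHomogeneous_of_homElt_mem fun n => ?_, fun h => ?_, fun hfg hiso => ?_⟩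
    · by_cases h : n = 0
      · rw [h, hφ, hsh f hf, hsh g hg, add_zero, sub_zero]
        exact StarAlgebra.path_mem_piece _ _ _ _ _
      · rw [hz φ n h]
        exact Submodule.zero_mem _
    · obtain ⟨a, b, hab⟩ := exists_of_homotopyClass_eq_zero h 0
      rw [hφ, hdf, hdg, mul_zero, zero_mul, mul_zero, add_zero] at hab
      exact StarAlgebra.path_ne_zero k _ _ hLle _ hab
    -- If `φ` were invertible up to homotopy, `φ ≫ ψ - 𝟙` would be null-homotopic; the character at
    -- `f` takes the value `-1` on it, as `φ` is a path of positive length.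
    · obtain ⟨ψ, hψ⟩ := (HomotopyCategory.quotient (ModuleCat (Γ.Star k))
        (ComplexShape.up ℤ)).map_surjective (inv (Γ.homotopyClass k d₀ φ))
      have hzero : Γ.homotopyClass k d₀ (φ ≫ ψ - 𝟙 (Γ.T k d₀ f)) = 0 := by
        change (HomotopyCategory.quotient _ _).map _ = 0
        rw [Functor.map_sub, Functor.map_comp, hψ, CategoryTheory.Functor.map_id, IsIso.hom_inv_id, sub_self]
      have := character_homElt hzero (Γ.label d₀ f) 0
      rw [homElt_sub, homElt_comp, homElt_id, hεf, hφ, map_sub, map_mul,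
        StarAlgebra.character_path k _ _ _ hLpos.1, StarAlgebra.character_vert, zero_mul,
        zero_sub, neg_eq_zero] at this
      exact one_ne_zero this
  · rintro l ⟨φ, hφ, h0, hni⟩
    obtain ⟨n, hn⟩ := exists_homElt_ne_zero h0
    obtain rfl : n = 0 := by
      by_contra h
      exact hn (hz φ n h)
    have hm := hφ.homElt_mem 0
    rw [hsh f hf, hsh g hg, add_zero, sub_zero] at hm
    obtain ⟨t, c, ht, hc, hrot, htm, hx⟩ := StarAlgebra.exists_smul_path k _ _ hm
      (i := Γ.label d₀ f) (j := Γ.label d₀ g) (by rw [← hεf, termIdem_mul_homElt])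
      (by rw [← hεg, homElt_mul_termIdem]) hn
    rw [← ht, Nat.cast_le]
    obtain ⟨q, hq⟩ := exists_add_eq_add_mul (val_eq_of_iterate hrot)
    rcases Nat.eq_zero_or_pos q with rfl | hq0
    · rw [mul_zero, add_zero] at hq
      rcases Nat.eq_zero_or_pos t with rfl | ht0
      · obtain rfl : f = g := hinj (Fin.ext hq.symm)
        refine absurd ?_ (hni rfl)
        let ψ : Γ.T k d₀ f ⟶ Γ.T k d₀ f := homMk (fun n => c⁻¹ • Γ.termIdem k d₀ f n)
          (fun n => by rw [smul_mul_assoc, termIdem_mul_self])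
          (fun n => by rw [hdf, mul_zero, zero_mul])
        have hψ : ∀ n, homElt ψ n = c⁻¹ • Γ.termIdem k d₀ f n := fun n => by
          rw [homElt_homMk, mul_smul_comm, termIdem_mul_self]
        have hφ' : ∀ n, homElt φ n = c • Γ.termIdem k d₀ f n := fun n => by
          by_cases hn0 : n = 0
          · rw [hn0, hx, hεf, StarAlgebra.path_zero]
          · rw [hz φ n hn0, termIdem_eq_zero (by omega) (Or.inl hf), smul_zero]
        have hiso : IsIso φ := by
          refine ⟨ψ, hom_ext_homElt fun n => ?_, hom_ext_homElt fun n => ?_⟩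
          · rw [homElt_comp, hφ', hψ, smul_mul_smul_comm, mul_inv_cancel₀ hc, one_smul,
              termIdem_mul_self, homElt_id]
          · rw [homElt_comp, hφ', hψ, smul_mul_smul_comm, inv_mul_cancel₀ hc, one_smul,
              termIdem_mul_self, homElt_id]
        infer_instance
      · split_ifs at hL with h
        · have := Fin.le_def.1 h; omega
        · omega
    · have : Γ.numEdges ≤ Γ.numEdges * q := Nat.le_mul_of_pos_right _ hq0
      split_ifs at hL with h
      · omega
      · have := Fin.le_def.not.1 h; omega

end BrauerTree

namespace BrauerTree

variable {V : Type*} [Finite V] {Γ : BrauerTree V} {k : Type*} [Field k] {d₀ : Γ.graph.Dart}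

/-! ### The degrees of the arrows -/

open Classical in
variable (Γ) in
/-- The total degree of the cycle around a vertex. -/
def circumference (x : V) : ℕ := if x = Γ.exc then Γ.numEdges else Γ.mult * Γ.numEdges

theorem multAt_mul_circumference (x : V) :
    Γ.multAt x * Γ.circumference x = Γ.mult * Γ.numEdges := by
  unfold multAt circumference
  split_ifs
  · rfl
  · exact one_mul _

open Classical in
variable (Γ) in
/-- The potential whose differences are, up to passages through the start of the numbering, the
degrees of the arrows around a vertex. -/
def potential (d₀ : Γ.graph.Dart) (x : V) (f : Γ.Edge) : ℤ :=
  if x = Γ.exc then (Γ.label d₀ f : ℤ) else 0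

variable (Γ) in
/-- The degree of the arrow that belongs to a dart. -/
def dartDegree (d₀ d : Γ.graph.Dart) : ℤ :=
  Γ.potential d₀ d.fst (Γ.edge (Γ.next d)) - Γ.potential d₀ d.fst (Γ.edge d) +
    if Γ.label d₀ (Γ.edge (Γ.next d)) ≤ Γ.label d₀ (Γ.edge d) then (Γ.circumference d.fst : ℤ) else 0

/-- Away from the exceptional vertex, counting darts from the one towards the root, an arrow goes
from the parent edge to the last child, from the first child to the parent edge, or from a child to
the preceding one. Each case is one of the computations above. -/
theorem arrowDegree_eq (hd₀ : d₀.fst = Γ.exc) (y : Γ.Arrow) :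
    Γ.arrowDegree k d₀ y = Γ.dartDegree d₀ y.1 := by
  obtain ⟨d, hc⟩ := y
  change sInf (Γ.morphismDegrees k d₀ (Γ.edge (Γ.next d)) (Γ.edge d)) = Γ.dartDegree d₀ d
  refine IsLeast.csInf_eq ?_
  unfold dartDegree potential circumference
  by_cases hx : d.fst = Γ.exc
  · have h1 := isDown_of_fst_eq_exc hx
    have h2 : Γ.IsDown (Γ.next d) := isDown_of_fst_eq_exc ((Γ.next_fst d).trans hx)
    simp only [if_pos hx]
    refine isLeast_morphismDegrees_depth_zero (label_injective hd₀) ?_ ?_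
    · rw [h2.depth_edge, dist_exc_eq_zero, Γ.next_fst, hx]
    · rw [h1.depth_edge, dist_exc_eq_zero, hx]
  · simp only [if_neg hx, sub_self, zero_add]
    obtain ⟨p, hp, hpd⟩ := IsDown.exists_parent hx
    have hstart : Γ.IsStart d₀ p.symm := Or.inr (by rwa [SimpleGraph.Dart.symm_symm])
    have hfst : p.symm.fst = d.fst := hpd
    have hk : 2 ≤ Γ.valency d.fst := hc.resolve_right fun h => hx h.2.1
    obtain ⟨i, hi, rfl⟩ := exists_next_iterate hfst
    rw [← hfst] at hk
    have hdown : ∀ i, 0 < i → i < Γ.valency p.symm.fst → Γ.IsDown (Γ.next^[i] p.symm) := by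
      intro i h0 hi
      obtain ⟨i, rfl⟩ := Nat.exists_eq_add_of_lt h0
      rw [zero_add] at hi ⊢
      exact hp.next_iterate_child hi
    have hchild : ∀ i, 0 < i → i < Γ.valency p.symm.fst →
        Γ.parent (Γ.edge (Γ.next^[i] p.symm)) = Γ.edge p ∧
        Γ.depth (Γ.edge (Γ.next^[i] p.symm)) = Γ.depth (Γ.edge p) + 1 ∧
        Γ.label d₀ (Γ.edge p) < Γ.label d₀ (Γ.edge (Γ.next^[i] p.symm)) := by
      intro i h0 hi
      have hf : (Γ.next^[i] p.symm).fst = p.snd := next_iterate_fst _ _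
      exact ⟨(hdown i h0 hi).parent_edge hp hf.symm, hp.depth_edge_child (hdown i h0 hi) hf,
        hp.label_lt_child hd₀ (hdown i h0 hi) hf⟩
    rw [← Function.iterate_succ_apply' (⇑Γ.next)]
    by_cases hik : i + 1 = Γ.valency p.symm.fst
    · rw [Nat.succ_eq_add_one, hik, next_iterate_valency, edge_symm]
      obtain ⟨h1, h2, h3⟩ := hchild i (by omega) hi
      rw [if_pos h3.le]
      have := isLeast_morphismDegrees_parent_child (k := k) (d₀ := d₀) (by rw [h1, h2])
        (h1.symm ▸ h3)
      rwa [h1] at this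
    · have hlt := hstart.label_lt hd₀ (Nat.lt_succ_self i) (by omega)
      rw [if_neg (not_le.2 hlt)]
      obtain ⟨h1, h2, h3⟩ := hchild (i + 1) (by omega) (by omega)
      rcases Nat.eq_zero_or_pos i with rfl | hi0
      · have := isLeast_morphismDegrees_child_parent (k := k) (d₀ := d₀) (by rw [h1, h2])
        rw [h1] at this
        rwa [Function.iterate_zero_apply, edge_symm]
      · obtain ⟨h1', h2', h3'⟩ := hchild i hi0 hi
        exact isLeast_morphismDegrees_siblings (h1.trans h1'.symm) (by rw [h1, h2])
          (by rw [h1, h2']) (by rwa [h1]) hlt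

/-! ### The degrees of paths around a vertex -/

variable (Γ) in
/-- The degree of the path of length `n` around a vertex that starts at the edge of `d`. -/
def pathDegree (d₀ : Γ.graph.Dart) : ℕ → Γ.graph.Dart → ℤ
  | 0, _ => 0
  | n + 1, d => Γ.dartDegree d₀ (Γ.next.symm d) + pathDegree d₀ n (Γ.next.symm d)

theorem pathDegree_next (n : ℕ) (d : Γ.graph.Dart) :
    Γ.pathDegree d₀ (n + 1) (Γ.next d) = Γ.dartDegree d₀ d + Γ.pathDegree d₀ n d := by
  rw [pathDegree, Equiv.symm_apply_apply]

/-- The non-strict inequality marks the passage through the start dart. It also holds at a vertex of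
valency one, where each step is a full turn. -/
theorem label_next_le_iff (hd₀ : d₀.fst = Γ.exc) {y : Γ.graph.Dart} (hy : Γ.IsStart d₀ y) (i : ℕ) :
    Γ.label d₀ (Γ.edge (Γ.next^[i + 1] y)) ≤ Γ.label d₀ (Γ.edge (Γ.next^[i] y)) ↔
      Γ.valency y.fst ∣ i + 1 := by
  have hv := valency_pos y
  by_cases h : Γ.valency y.fst ∣ i + 1
  · rw [next_iterate_eq_self_iff.2 h]
    exact iff_of_true (label_start hd₀ hy (next_iterate_fst _ _)) h
  · refine iff_of_false (not_le.2 ?_) h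
    have hne : i % Γ.valency y.fst + 1 ≠ Γ.valency y.fst := by
      intro he
      apply h
      refine ⟨i / Γ.valency y.fst + 1, ?_⟩
      have := Nat.mod_add_div i (Γ.valency y.fst)
      rw [Nat.mul_add, mul_one]
      omega
    have hlt := Nat.mod_lt i hv
    have h1 := hy.label_lt hd₀ (Nat.lt_succ_self (i % Γ.valency y.fst)) (by omega)
    rw [Function.iterate_succ_apply', next_iterate_mod, ← Function.iterate_succ_apply' (⇑Γ.next)] at h1
    exact h1

/-- Potential differences telescope, and each passage through the start dart adds one circumference;
the passages are counted by a difference of quotients. -/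
theorem pathDegree_start (hd₀ : d₀.fst = Γ.exc) {y : Γ.graph.Dart} (hy : Γ.IsStart d₀ y) (i n : ℕ) :
    Γ.pathDegree d₀ n (Γ.next^[n + i] y) =
      Γ.potential d₀ y.fst (Γ.edge (Γ.next^[n + i] y)) -
        Γ.potential d₀ y.fst (Γ.edge (Γ.next^[i] y)) +
        (((n + i) / Γ.valency y.fst - i / Γ.valency y.fst : ℤ)) * Γ.circumference y.fst := by
  induction n with
  | zero => simp [pathDegree]
  | succ n ih =>
    rw [Nat.add_right_comm, Function.iterate_succ_apply', pathDegree_next, ih, dartDegree,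
      next_iterate_fst, ← Function.iterate_succ_apply' (⇑Γ.next), Nat.succ_eq_add_one]
    simp only [label_next_le_iff hd₀ hy]
    have h := Nat.succ_div (a := n + i) (b := Γ.valency y.fst)
    have h' : (((n + 1 : ℕ) : ℤ) + (i : ℤ)) / (Γ.valency y.fst : ℤ) =
        ((n : ℤ) + i) / (Γ.valency y.fst : ℤ) + if Γ.valency y.fst ∣ n + i + 1 then 1 else 0 := by
      have := congrArg (Nat.cast : ℕ → ℤ) h
      push_cast at this
      rw [← this]
      push_cast
      ring_nf
    rw [h']
    split_ifs <;> ring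

/-- The degree of a path around a vertex in terms of its end points and the number of complete
turns. -/
theorem pathDegree_eq (hd₀ : d₀.fst = Γ.exc) {d d' : Γ.graph.Dart} {n : ℕ}
    (hn : n < Γ.valency d.fst) (h : Γ.next^[n] d' = d) (t : ℕ) :
    Γ.pathDegree d₀ (n + t * Γ.valency d.fst) d =
      Γ.potential d₀ d.fst (Γ.edge d) - Γ.potential d₀ d.fst (Γ.edge d') +
        ((if Γ.label d₀ (Γ.edge d) < Γ.label d₀ (Γ.edge d') then 1 else 0) + t : ℕ) *
          Γ.circumference d.fst := by
  have hfst : d'.fst = d.fst := by rw [← h, next_iterate_fst]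
  obtain ⟨y, hy, hyd⟩ := exists_isStart hd₀ d'
  obtain ⟨i, hi, rfl⟩ := exists_next_iterate hyd
  rw [next_iterate_fst] at hfst
  rw [← hfst] at hn ⊢
  have hd : d = Γ.next^[n + t * Γ.valency y.fst + i] y := by
    rw [← h, ← Function.iterate_add_apply, Nat.add_right_comm, Function.iterate_add_apply _ (n + i),
      next_iterate_eq_self_iff.2 (Dvd.intro_left _ rfl)]
  have hv := valency_pos y
  have h1 := pathDegree_start hd₀ hy i (n + t * Γ.valency y.fst)
  rw [← hd] at h1
  rw [h1]
  congr 2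
  have hi0 : (i : ℤ) / (Γ.valency y.fst : ℤ) = 0 := by
    exact_mod_cast Nat.div_eq_of_lt hi
  have hdiv : (((n + t * Γ.valency y.fst : ℕ) : ℤ) + (i : ℤ)) / (Γ.valency y.fst : ℤ) =
      (((n + i) / Γ.valency y.fst + t : ℕ) : ℤ) := by
    rw [← Nat.add_mul_div_right _ _ hv]
    push_cast
    ring_nf
  rw [hi0, hdiv, sub_zero, Nat.cast_inj]
  congr 1
  rw [← Function.iterate_add_apply] at h
  rw [← h]
  -- Less than a full turn passes the start at most once, and it does so exactly if the path begins
  -- at a smaller label than it ends.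
  by_cases hlt : n + i < Γ.valency y.fst
  · rw [Nat.div_eq_of_lt hlt, if_neg]
    rw [not_lt]
    rcases Nat.eq_zero_or_pos n with rfl | hn0
    · rw [zero_add]
    · exact (hy.label_lt hd₀ (by omega) hlt).le
  · rw [Nat.div_eq_of_lt_le (m := n + i) (n := Γ.valency y.fst) (k := 1) (by omega) (by omega),
      if_pos]
    have hmod : Γ.next^[n + i] y = Γ.next^[n + i - Γ.valency y.fst] y := by
      conv_lhs => rw [← Nat.sub_add_cancel (not_lt.1 hlt), Function.iterate_add_apply,
        next_iterate_valency]
    rw [hmod]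
    exact hy.label_lt hd₀ (by omega) hi

end BrauerTree

namespace QuiverAlgebra

/-! ### Homogeneous bases of algebras of quivers with relations -/

variable {k : Type*} [Field k] {X Y : Type*} [Fintype X] {src tgt : Y → X}
  {R : FreeAlgebra k (QuiverGen X Y) → FreeAlgebra k (QuiverGen X Y) → Prop} {w : Y → ℤ}
  {I : Type*} {B : I → QuiverAlgebra k src tgt R} {deg : I → ℤ} {s t : I → X}

theorem nonempty_gradedAlgebra (hB : LinearIndependent k B)
    (htop : Submodule.span k (Set.range B) = ⊤)
    (hpiece : ∀ d, piece R w d = Submodule.span k (B '' {b | deg b = d})) :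
    Nonempty (GradedAlgebra (piece (src := src) (tgt := tgt) R w)) := by
  have hint : DirectSum.IsInternal (piece (src := src) (tgt := tgt) R w) := by
    rw [DirectSum.isInternal_submodule_iff_iSupIndep_and_iSup_eq_top]
    constructor
    · intro d
      have hle : (⨆ (d') (_ : d' ≠ d), piece (src := src) (tgt := tgt) R w d') ≤
          Submodule.span k (B '' {b | deg b ≠ d}) := by
        refine iSup₂_le fun d' hd' => ?_
        rw [hpiece]
        refine Submodule.span_mono (Set.image_mono fun b hb => ?_)
        exact fun h => hd' (hb.symm.trans h)
      refine Disjoint.mono_right hle ?_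
      rw [hpiece]
      refine hB.disjoint_span_image ?_
      exact Set.disjoint_left.2 fun b hb hb' => hb' hb
    · rw [eq_top_iff, ← htop]
      refine Submodule.span_le.2 ?_
      rintro _ ⟨b, rfl⟩
      refine Submodule.mem_iSup_of_mem (deg b) ?_
      rw [hpiece]
      exact Submodule.subset_span ⟨b, rfl, rfl⟩
  exact ⟨{ hint.chooseDecomposition with
    one_mem := one_mem_piece R w
    mul_mem := fun _ _ _ _ h h' => mul_mem_piece h h' }⟩

theorem corner_eq_span (hpiece : ∀ d, piece R w d = Submodule.span k (B '' {b | deg b = d}))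
    (hs : ∀ b, vert R (s b) * B b = B b) (ht : ∀ b, B b * vert R (t b) = B b) (i j : X) (l : ℤ) :
    corner R w i j l = Submodule.span k
      (Set.range fun b : {b // (s b = i ∧ t b = j) ∧ deg b = l} => B b) := by
  apply le_antisymm
  · rintro x ⟨hx, hi, hj⟩
    have key : ∀ y ∈ piece R w l, vert R i * y * vert R j ∈ Submodule.span k
        (Set.range fun b : {b // (s b = i ∧ t b = j) ∧ deg b = l} => B b) := by
      intro y hy
      rw [hpiece] at hy
      induction hy using Submodule.span_induction with
      | mem y hy =>
        obtain ⟨b, hb, rfl⟩ := hy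
        by_cases hsi : s b = i
        · by_cases htj : t b = j
          · rw [← hsi, hs, ← htj, ht]
            exact Submodule.subset_span ⟨⟨b, ⟨rfl, rfl⟩, hb⟩, rfl⟩
          · rw [← ht, mul_assoc, mul_assoc, vert_mul_of_ne R htj, mul_zero, mul_zero]
            exact Submodule.zero_mem _
        · rw [← hs, ← mul_assoc, vert_mul_of_ne R (Ne.symm hsi), zero_mul, zero_mul]
          exact Submodule.zero_mem _
      | zero => simp
      | add a b _ _ ha hb => rw [mul_add, add_mul]; exact Submodule.add_mem _ ha hb
      | smul c a _ ha => rw [mul_smul_comm, smul_mul_assoc]; exact Submodule.smul_mem _ c ha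
    have := key x hx
    rwa [hi, hj] at this
  · refine Submodule.span_le.2 ?_
    rintro _ ⟨⟨b, ⟨rfl, rfl⟩, rfl⟩, rfl⟩
    refine ⟨?_, hs b, ht b⟩
    rw [hpiece]
    exact Submodule.subset_span ⟨b, rfl, rfl⟩

-- The basis elements from `i` to `j` of degree `l` form a basis of the corresponding piece of `e_i
-- A e_j`, so the entry is their generating function.
open Classical in
theorem cartan_apply [Fintype I] (hB : LinearIndependent k B)
    (hpiece : ∀ d, piece R w d = Submodule.span k (B '' {b | deg b = d}))
    (hs : ∀ b, vert R (s b) * B b = B b) (ht : ∀ b, B b * vert R (t b) = B b) (i j : X) :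
    cartan src tgt R w i j =
      ∑ b with s b = i ∧ t b = j, (LaurentPolynomial.T (deg b) : LaurentPolynomial ℤ) := by
  have hrank : ∀ l, Module.finrank k (homgr (src := src) (tgt := tgt) R w i j l) =
      (Finset.filter (fun b => deg b = l) {b | s b = i ∧ t b = j}).card := by
    intro l
    rw [finrank_homgr, corner_eq_span hpiece hs ht]
    refine (finrank_span_eq_card (hB.comp _ Subtype.val_injective)).trans ?_
    rw [Fintype.card_subtype, Finset.filter_filter]
  change ∑ᶠ l : ℤ, (Module.finrank k (homgr (src := src) (tgt := tgt) R w i j l) :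
    LaurentPolynomial ℤ) * LaurentPolynomial.T l = _
  simp only [hrank]
  rw [Finset.sum_comp (fun l => (LaurentPolynomial.T l : LaurentPolynomial ℤ)) deg]
  simp only [nsmul_eq_mul]
  refine finsum_eq_sum_of_support_subset _ fun l hl => ?_
  rw [Function.mem_support] at hl
  rw [Finset.mem_coe, Finset.mem_image]
  by_contra hne
  push Not at hne
  apply hl
  rw [Finset.filter_eq_empty_iff.2 fun b hb => hne b hb]
  simp

end QuiverAlgebra

namespace BrauerTree

variable {V : Type*} [Finite V] {Γ : BrauerTree V} {k : Type*} [Field k]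

/-! ### The regular representation of `A_Γ` -/

variable (Γ) in
/-- The length of the longest non-zero paths around the initial vertex of a dart. -/
def maxLen (d : Γ.graph.Dart) : ℕ := Γ.multAt d.fst * Γ.valency d.fst

theorem multAt_pos (x : V) : 0 < Γ.multAt x := by
  unfold multAt
  split_ifs
  · exact Γ.mult_pos
  · exact one_pos

theorem maxLen_pos (d : Γ.graph.Dart) : 0 < Γ.maxLen d :=
  Nat.mul_pos (multAt_pos _) (valency_pos d)

theorem maxLen_next (d : Γ.graph.Dart) : Γ.maxLen (Γ.next d) = Γ.maxLen d := by
  rw [maxLen, maxLen, Γ.next_fst]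

theorem next_iterate_maxLen (d : Γ.graph.Dart) : Γ.next^[Γ.maxLen d] d = d :=
  next_iterate_eq_self_iff.2 (Dvd.intro_left _ rfl)

theorem maxLen_eq_one {d : Γ.graph.Dart} (h : ¬ Γ.HasCycle d.fst) : Γ.maxLen d = 1 := by
  unfold HasCycle at h
  have hv := valency_pos d
  have hm := multAt_pos (Γ := Γ) d.fst
  have h1 : Γ.valency d.fst = 1 := by
    by_contra hne
    exact h (Or.inl (by omega))
  have h2 : Γ.multAt d.fst = 1 := by
    unfold multAt at hm ⊢
    split_ifs at hm ⊢ with hx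
    · by_contra hne
      exact h (Or.inr ⟨h1, hx, Or.inl (by omega)⟩)
    · rfl
  rw [maxLen, h1, h2]

/-- If neither end carried a cycle, both would have valency one and `f` would be the only edge; but
then the exceptional end carries a loop by definition. So every socle element is a path in some
cycle. -/
theorem exists_hasCycle (f : Γ.Edge) : ∃ d, Γ.edge d = f ∧ Γ.HasCycle d.fst := by
  obtain ⟨d, hd, rfl⟩ := exists_isDown f
  by_contra! hno
  have h1 := hno d rfl
  have h2 := hno d.symm (edge_symm d)
  have v1 : Γ.valency d.fst = 1 := by
    have := valency_pos d
    by_contra hne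
    exact h1 (Or.inl (by omega))
  have v2 : Γ.valency d.snd = 1 := by
    have : 0 < Γ.valency d.snd := valency_pos d.symm
    by_contra hne
    exact h2 (Or.inl (by change 2 ≤ Γ.valency d.snd; omega))
  have uniq : ∀ {d d' : Γ.graph.Dart}, Γ.valency d.fst = 1 → d'.fst = d.fst → d' = d := by
    intro d d' hv h
    obtain ⟨i, hi, rfl⟩ := exists_next_iterate h.symm
    obtain rfl : i = 0 := by omega
    rfl
  have hexc : d.fst = Γ.exc := by
    by_contra hx
    obtain ⟨p, hp, hpd⟩ := IsDown.exists_parent hx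
    have := uniq (d := d) (d' := p.symm) v1 hpd
    exact hp.not_symm (this ▸ hd)
  refine h1 (Or.inr ⟨v1, hexc, Or.inr ?_⟩)
  have hall : ∀ (n : ℕ) (d' : Γ.graph.Dart), Γ.IsDown d' → Γ.graph.dist Γ.exc d'.fst = n →
      d' = d := by
    intro n
    induction n with
    | zero =>
      intro d' hd' h0
      exact uniq v1 ((dist_exc_eq_zero.1 h0).trans hexc.symm)
    | succ n ih =>
      intro d' hd' hn
      obtain ⟨p, hp, hpd⟩ := IsDown.exists_parent (d := d') (fun h => by
        rw [dist_exc_eq_zero.2 h] at hn; omega)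
      have hpe : p = d := ih p hp (by unfold IsDown at hp; rw [hpd] at hp; omega)
      have := uniq (d := d.symm) (d' := d') v2 (by rw [← hpd, hpe]; rfl)
      exact absurd (this ▸ hd') hd.not_symm
  rw [numEdges, Fintype.card_eq_one_iff]
  refine ⟨Γ.edge d, fun g => ?_⟩
  obtain ⟨d', hd', rfl⟩ := exists_isDown g
  rw [hall _ d' hd' rfl]

variable (Γ) in
/-- Labels for trivial paths, for the socle elements and for the other paths of `A_Γ`. -/
abbrev PathLabel := Γ.Edge ⊕ Γ.Edge ⊕ Γ.graph.Dart × ℕ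

variable (Γ) in
/-- The edge at which a path starts. -/
def PathLabel.source : Γ.PathLabel → Γ.Edge
  | Sum.inl f => f
  | Sum.inr (Sum.inl f) => f
  | Sum.inr (Sum.inr (d, _)) => Γ.edge d

variable (Γ k) in
open Classical in
/-- The vector of the regular representation that stands for a path around a vertex. -/
def pathVec (d : Γ.graph.Dart) (n : ℕ) : Γ.PathLabel →₀ k :=
  if n = 0 then Finsupp.single (Sum.inl (Γ.edge d)) 1
  else if n < Γ.maxLen d then Finsupp.single (Sum.inr (Sum.inr (d, n - 1))) 1
  else if n = Γ.maxLen d then Finsupp.single (Sum.inr (Sum.inl (Γ.edge d))) 1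
  else 0

variable (Γ k) in
open Classical in
/-- The action of a vertex of the quiver on the regular representation. -/
def regVert (f : Γ.Edge) : Module.End k (Γ.PathLabel →₀ k) :=
  Finsupp.lift _ k _ fun b => if PathLabel.source Γ b = f then Finsupp.single b 1 else 0

variable (Γ k) in
open Classical in
/-- The action of an arrow on a basis vector of the regular representation. -/
def regArrVec (d : Γ.graph.Dart) : Γ.PathLabel → (Γ.PathLabel →₀ k)
  | Sum.inl f => if Γ.edge d = f then Γ.pathVec k (Γ.next d) 1 else 0
  | Sum.inr (Sum.inl _) => 0
  | Sum.inr (Sum.inr (d', n)) => if d = d' then Γ.pathVec k (Γ.next d) (n + 2) else 0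

variable (Γ k) in
/-- The action of an arrow on the regular representation. -/
def regArr (d : Γ.graph.Dart) : Module.End k (Γ.PathLabel →₀ k) :=
  Finsupp.lift _ k _ (Γ.regArrVec k d)

open Classical in
theorem regVert_single (f : Γ.Edge) (b : Γ.PathLabel) :
    Γ.regVert k f (Finsupp.single b 1) =
      if PathLabel.source Γ b = f then Finsupp.single b 1 else 0 := by
  simp [regVert]

theorem regArr_single (d : Γ.graph.Dart) (b : Γ.PathLabel) :
    Γ.regArr k d (Finsupp.single b 1) = Γ.regArrVec k d b := by
  simp [regArr]

theorem pathVec_eq_zero {d : Γ.graph.Dart} {n : ℕ} (h : Γ.maxLen d < n) : Γ.pathVec k d n = 0 := by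
  rw [pathVec, if_neg (by omega), if_neg (by omega), if_neg (by omega)]

theorem pathVec_maxLen (d : Γ.graph.Dart) :
    Γ.pathVec k d (Γ.maxLen d) = Finsupp.single (Sum.inr (Sum.inl (Γ.edge d))) 1 := by
  rw [pathVec, if_neg (maxLen_pos d).ne', if_neg (lt_irrefl _), if_pos rfl]

theorem pathVec_zero (d : Γ.graph.Dart) :
    Γ.pathVec k d 0 = Finsupp.single (Sum.inl (Γ.edge d)) 1 := if_pos rfl

open Classical in
theorem regVert_pathVec (f : Γ.Edge) (d : Γ.graph.Dart) (n : ℕ) :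
    Γ.regVert k f (Γ.pathVec k d n) = if Γ.edge d = f then Γ.pathVec k d n else 0 := by
  unfold pathVec
  split_ifs <;> simp_all [regVert_single, PathLabel.source]

-- A path of positive length determines the vertex it turns around and hence its only continuation.
-- For length `0` this fails, since both darts of an edge share the trivial path.
open Classical in
theorem regArr_pathVec (d d' : Γ.graph.Dart) {n : ℕ} (hn : 0 < n) :
    Γ.regArr k d (Γ.pathVec k d' n) = if d = d' then Γ.pathVec k (Γ.next d) (n + 1) else 0 := by
  by_cases h1 : n < Γ.maxLen d'
  · rw [pathVec, if_neg (by omega), if_pos h1, regArr_single, regArrVec,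
      show n - 1 + 2 = n + 1 by omega]
  · have h2 : Γ.regArr k d (Γ.pathVec k d' n) = 0 := by
      by_cases h3 : n = Γ.maxLen d'
      · rw [h3, pathVec_maxLen, regArr_single]; rfl
      · rw [pathVec_eq_zero (by omega), map_zero]
    rw [h2]
    split_ifs with h
    · rw [pathVec_eq_zero]
      rw [h, maxLen_next]
      omega
    · rfl

theorem regVert_mul_regArr (d : Γ.graph.Dart) :
    Γ.regVert k (Γ.edge (Γ.next d)) * Γ.regArr k d = Γ.regArr k d := by
  refine StarAlgebra.end_ext fun b => ?_
  rw [Module.End.mul_apply, regArr_single]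
  rcases b with f | f | ⟨d', n⟩ <;> simp only [regArrVec]
  · split_ifs
    · rw [regVert_pathVec, if_pos rfl]
    · exact map_zero _
  · exact map_zero _
  · split_ifs
    · rw [regVert_pathVec, if_pos rfl]
    · exact map_zero _

theorem regArr_mul_regVert (d : Γ.graph.Dart) :
    Γ.regArr k d * Γ.regVert k (Γ.edge d) = Γ.regArr k d := by
  refine StarAlgebra.end_ext fun b => ?_
  rw [Module.End.mul_apply, regVert_single]
  split_ifs with h
  · rfl
  · rw [map_zero, regArr_single]
    rcases b with f | f | ⟨d', n⟩ <;> simp only [regArrVec]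
    · exact (if_neg fun h' => h h'.symm).symm
    · exact (if_neg fun h' => h (congrArg Γ.edge h'.symm)).symm

theorem regArr_mul_regArr {d d' : Γ.graph.Dart} (h : d.fst ≠ d'.fst) :
    Γ.regArr k d * Γ.regArr k d' = 0 := by
  have hne : d ≠ Γ.next d' := fun he => h (by rw [he, Γ.next_fst])
  refine StarAlgebra.end_ext fun b => ?_
  rw [Module.End.mul_apply, regArr_single]
  rcases b with f | f | ⟨d'', n⟩ <;> simp only [regArrVec]
  · split_ifs
    · rw [regArr_pathVec _ _ one_pos, if_neg hne]; rfl
    · exact map_zero _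
  · exact map_zero _
  · split_ifs
    · rw [regArr_pathVec _ _ (Nat.succ_pos _), if_neg hne]; rfl
    · exact map_zero _

variable (Γ k) in
/-- The action of a path around a vertex on the regular representation. -/
def regPath (n : ℕ) (d : Γ.graph.Dart) : Module.End k (Γ.PathLabel →₀ k) :=
  cyclePath (fun d => Γ.regVert k (Γ.edge d)) (Γ.regArr k) Γ.next n d

theorem regPath_next (n : ℕ) (d : Γ.graph.Dart) :
    Γ.regPath k (n + 1) (Γ.next d) = Γ.regArr k d * Γ.regPath k n d := by
  rw [regPath, cyclePath, Equiv.symm_apply_apply]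
  rfl

open Classical in
theorem regPath_single_inl (n : ℕ) (d : Γ.graph.Dart) (f : Γ.Edge) :
    Γ.regPath k n (Γ.next^[n] d) (Finsupp.single (Sum.inl f) 1) =
      if Γ.edge d = f then Γ.pathVec k (Γ.next^[n] d) n else 0 := by
  induction n with
  | zero =>
    change Γ.regVert k (Γ.edge d) _ = _
    rw [regVert_single, PathLabel.source]
    split_ifs with h1 h2 h3
    · rw [Function.iterate_zero_apply, pathVec_zero, h1]
    · exact absurd h1.symm h2
    · exact absurd h3.symm h1
    · rfl
  | succ n ih =>
    rw [Function.iterate_succ_apply', regPath_next, Module.End.mul_apply, ih]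
    split_ifs with h
    · rcases Nat.eq_zero_or_pos n with rfl | hn
      · rw [pathVec_zero, regArr_single, regArrVec, if_pos rfl]
      · rw [regArr_pathVec _ _ hn, if_pos rfl]
    · exact map_zero _

theorem regPath_single_soc (n : ℕ) (d : Γ.graph.Dart) (f : Γ.Edge) :
    Γ.regPath k (n + 1) (Γ.next^[n + 1] d) (Finsupp.single (Sum.inr (Sum.inl f)) 1) = 0 := by
  induction n with
  | zero =>
    rw [Function.iterate_succ_apply', regPath_next, Module.End.mul_apply]
    change Γ.regArr k d (Γ.regVert k (Γ.edge d) _) = 0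
    rw [regVert_single]
    split_ifs
    · rw [regArr_single]; rfl
    · exact map_zero _
  | succ n ih =>
    rw [Function.iterate_succ_apply', regPath_next, Module.End.mul_apply, ih, map_zero]

/-- The label `(d', j)` stands for a path of length `j + 1`, hence the length `j + n + 2`. -/
theorem regPath_single_inr (n : ℕ) (d d' : Γ.graph.Dart) (j : ℕ) :
    ∃ c : k, Γ.regPath k (n + 1) (Γ.next^[n + 1] d) (Finsupp.single (Sum.inr (Sum.inr (d', j))) 1) =
      c • Γ.pathVec k (Γ.next^[n + 1] d) (j + n + 2) := by
  induction n with
  | zero =>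
    rw [Function.iterate_succ_apply', regPath_next, Module.End.mul_apply]
    change ∃ c : k, Γ.regArr k d (Γ.regVert k (Γ.edge d) _) = _
    rw [regVert_single]
    split_ifs
    · rw [regArr_single, regArrVec]
      split_ifs with h
      · exact ⟨1, by rw [one_smul]; rfl⟩
      · exact ⟨0, by rw [zero_smul]⟩
    · exact ⟨0, by rw [map_zero, zero_smul]⟩
  | succ n ih =>
    obtain ⟨c, hc⟩ := ih
    refine ⟨c, ?_⟩
    rw [Function.iterate_succ_apply', regPath_next, Module.End.mul_apply, hc, map_smul,
      regArr_pathVec _ _ (by omega), if_pos rfl]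
    rfl

-- A path of maximal length sends the trivial path to the socle vector and everything else to zero.
-- The result depends on the edge only, not on the chosen end; this is the commutation relation.
open Classical in
theorem regPath_maxLen_single (d : Γ.graph.Dart) (b : Γ.PathLabel) :
    Γ.regPath k (Γ.maxLen d) d (Finsupp.single b 1) =
      if b = Sum.inl (Γ.edge d) then Finsupp.single (Sum.inr (Sum.inl (Γ.edge d))) 1 else 0 := by
  have hpos := maxLen_pos d
  have hround := next_iterate_maxLen d
  rcases b with f | f | ⟨d', j⟩
  · have := regPath_single_inl (k := k) (Γ.maxLen d) d f
    rw [hround, pathVec_maxLen] at this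
    rw [this]
    simp only [Sum.inl.injEq, eq_comm]
  · obtain ⟨n, hn⟩ := Nat.exists_eq_add_of_lt hpos
    have := regPath_single_soc (k := k) n d f
    rw [show n + 1 = Γ.maxLen d by omega, hround] at this
    rw [this, if_neg (by simp)]
  · obtain ⟨n, hn⟩ := Nat.exists_eq_add_of_lt hpos
    obtain ⟨c, hc⟩ := regPath_single_inr (k := k) n d d' j
    rw [show n + 1 = Γ.maxLen d by omega, hround, pathVec_eq_zero (by omega), smul_zero] at hc
    rw [hc, if_neg (by simp)]

theorem regPath_maxLen_symm (d : Γ.graph.Dart) :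
    Γ.regPath k (Γ.maxLen d) d = Γ.regPath k (Γ.maxLen d.symm) d.symm := by
  classical
  refine StarAlgebra.end_ext fun b => ?_
  rw [regPath_maxLen_single, regPath_maxLen_single, edge_symm]

theorem regPath_maxLen_succ (d : Γ.graph.Dart) : Γ.regPath k (Γ.maxLen d + 1) d = 0 := by
  obtain ⟨d, rfl⟩ := Γ.next.surjective d
  rw [maxLen_next, regPath_next]
  refine StarAlgebra.end_ext fun b => ?_
  classical
  rw [Module.End.mul_apply, regPath_maxLen_single]
  split_ifs
  · rw [regArr_single]; rfl
  · exact map_zero _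

theorem liftFree_vertexPath (n : ℕ) {d : Γ.graph.Dart} (h : Γ.HasCycle d.fst) :
    QuiverAlgebra.liftFree (k := k) (Γ.regVert k) (fun y : Γ.Arrow => Γ.regArr k y.1)
      (Γ.vertexPath k n d) = Γ.regPath k n d := by
  induction n generalizing d with
  | zero =>
    exact QuiverAlgebra.liftFree_e _ _ _
  | succ n ih =>
    obtain ⟨d, rfl⟩ := Γ.next.surjective d
    rw [Γ.next_fst] at h
    rw [regPath_next, vertexPath, cyclePath, Equiv.symm_apply_apply, map_mul, dif_pos h]
    exact congrArg₂ (· * ·) (QuiverAlgebra.liftFree_a _ _ _) (ih h)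

variable (Γ k) in
/-- The regular representation of `A_Γ`. -/
def regular : Γ.BasicAlgebra k →ₐ[k] Module.End k (Γ.PathLabel →₀ k) :=
  QuiverAlgebra.lift (Γ.Rel k) (Γ.regVert k) (fun y : Γ.Arrow => Γ.regArr k y.1)
    (fun f => StarAlgebra.end_ext fun b => by
      rw [Module.End.mul_apply, regVert_single]
      split_ifs with h
      · rw [regVert_single, if_pos h]
      · exact map_zero _)
    (fun f g hfg => StarAlgebra.end_ext fun b => by
      rw [Module.End.mul_apply, regVert_single]
      split_ifs with h
      · rw [regVert_single, if_neg fun h' => hfg (h'.symm.trans h)]; rfl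
      · exact map_zero _)
    (StarAlgebra.end_ext fun b => by
      rw [LinearMap.sum_apply]
      simp only [regVert_single]
      simp)
    (fun y => regVert_mul_regArr y.1)
    (fun y => regArr_mul_regVert y.1)
    (by
      intro x x' h
      induction h with
      | zero y y' h =>
        rw [map_mul, QuiverAlgebra.liftFree_a, QuiverAlgebra.liftFree_a, map_zero,
          regArr_mul_regArr h]
      | comm d h h' =>
        rw [liftFree_vertexPath _ h, liftFree_vertexPath _ (d := d.symm) h']
        exact regPath_maxLen_symm d
      | long d h =>
        rw [liftFree_vertexPath _ h, map_zero]
        exact regPath_maxLen_succ d)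

end BrauerTree

namespace BrauerTree

variable {V : Type*} [Finite V] {Γ : BrauerTree V} {k : Type*} [Field k]

/-! ### A homogeneous basis of `A_Γ` -/

variable (Γ k) in
/-- The path of length `n` in `A_Γ` around a vertex that starts at the edge of `d`. -/
def dartPath (n : ℕ) (d : Γ.graph.Dart) : Γ.BasicAlgebra k :=
  RingQuot.mkAlgHom k _ (Γ.vertexPath k n d)

variable (Γ k) in
/-- The primitive idempotent of `A_Γ` at an edge. -/
def edgeIdem (f : Γ.Edge) : Γ.BasicAlgebra k := QuiverAlgebra.vert (Γ.Rel k) f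

variable (Γ k) in
open Classical in
/-- The arrow of `A_Γ` that belongs to a dart, or zero if there is none. -/
def dartArrow (d : Γ.graph.Dart) : Γ.BasicAlgebra k :=
  if h : Γ.HasCycle d.fst then QuiverAlgebra.arr (Γ.Rel k) (⟨d, h⟩ : Γ.Arrow) else 0

theorem dartPath_zero (d : Γ.graph.Dart) : Γ.dartPath k 0 d = Γ.edgeIdem k (Γ.edge d) := rfl

theorem dartPath_next (n : ℕ) (d : Γ.graph.Dart) :
    Γ.dartPath k (n + 1) (Γ.next d) = Γ.dartArrow k d * Γ.dartPath k n d := by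
  rw [dartPath, vertexPath, cyclePath, Equiv.symm_apply_apply, map_mul]
  congr 1
  unfold dartArrow
  split_ifs
  · rfl
  · exact map_zero _

theorem edgeIdem_mul_self (f : Γ.Edge) : Γ.edgeIdem k f * Γ.edgeIdem k f = Γ.edgeIdem k f :=
  QuiverAlgebra.vert_mul_self _ f

theorem edgeIdem_mul_of_ne {f g : Γ.Edge} (h : f ≠ g) : Γ.edgeIdem k f * Γ.edgeIdem k g = 0 :=
  QuiverAlgebra.vert_mul_of_ne _ h

theorem edgeIdem_mul_dartArrow (d : Γ.graph.Dart) :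
    Γ.edgeIdem k (Γ.edge (Γ.next d)) * Γ.dartArrow k d = Γ.dartArrow k d := by
  unfold dartArrow
  split_ifs with h
  · exact QuiverAlgebra.vert_src_mul_arr (Γ.Rel k) (⟨d, h⟩ : Γ.Arrow)
  · exact mul_zero _

theorem dartArrow_mul_edgeIdem (d : Γ.graph.Dart) :
    Γ.dartArrow k d * Γ.edgeIdem k (Γ.edge d) = Γ.dartArrow k d := by
  unfold dartArrow
  split_ifs with h
  · exact QuiverAlgebra.arr_mul_vert_tgt (Γ.Rel k) (⟨d, h⟩ : Γ.Arrow)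
  · exact zero_mul _

theorem dartArrow_mul_dartArrow {d d' : Γ.graph.Dart} (h : d.fst ≠ d'.fst) :
    Γ.dartArrow k d * Γ.dartArrow k d' = 0 := by
  unfold dartArrow
  split_ifs with h1 h2
  · exact (map_mul _ _ _).symm.trans ((QuiverAlgebra.mk_rel
      (Rel.zero (⟨d, h1⟩ : Γ.Arrow) (⟨d', h2⟩ : Γ.Arrow) h)).trans (map_zero _))
  · exact mul_zero _
  · exact zero_mul _
  · exact zero_mul _

theorem edgeIdem_mul_dartPath (n : ℕ) (d : Γ.graph.Dart) :
    Γ.edgeIdem k (Γ.edge d) * Γ.dartPath k n d = Γ.dartPath k n d := by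
  cases n with
  | zero => exact edgeIdem_mul_self _
  | succ n =>
    obtain ⟨d, rfl⟩ := Γ.next.surjective d
    rw [dartPath_next, ← mul_assoc, edgeIdem_mul_dartArrow]

theorem dartPath_mul_edgeIdem (n : ℕ) (d : Γ.graph.Dart) :
    Γ.dartPath k n (Γ.next^[n] d) * Γ.edgeIdem k (Γ.edge d) = Γ.dartPath k n (Γ.next^[n] d) := by
  induction n with
  | zero => exact edgeIdem_mul_self _
  | succ n ih => rw [Function.iterate_succ_apply', dartPath_next, mul_assoc, ih]

theorem dartPath_succ_of_not_hasCycle {n : ℕ} {d : Γ.graph.Dart} (h : ¬ Γ.HasCycle d.fst) :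
    Γ.dartPath k (n + 1) d = 0 := by
  obtain ⟨d, rfl⟩ := Γ.next.surjective d
  rw [Γ.next_fst] at h
  rw [dartPath_next, dartArrow, dif_neg h, zero_mul]

theorem dartPath_eq_zero {n : ℕ} {d : Γ.graph.Dart} (hn : Γ.maxLen d < n) :
    Γ.dartPath k n d = 0 := by
  obtain ⟨s, rfl⟩ := Nat.exists_eq_add_of_lt hn
  clear hn
  induction s generalizing d with
  | zero =>
    by_cases h : Γ.HasCycle d.fst
    · exact (QuiverAlgebra.mk_rel (Rel.long d h)).trans (map_zero _)
    · exact dartPath_succ_of_not_hasCycle h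
  | succ s ih =>
    obtain ⟨d, rfl⟩ := Γ.next.surjective d
    rw [maxLen_next, dartPath_next]
    rw [show Γ.maxLen d + (s + 1) = Γ.maxLen d + s + 1 by omega, ih, mul_zero]

theorem dartPath_maxLen_symm {d : Γ.graph.Dart} (h : Γ.HasCycle d.fst) (h' : Γ.HasCycle d.snd) :
    Γ.dartPath k (Γ.maxLen d) d = Γ.dartPath k (Γ.maxLen d.symm) d.symm :=
  QuiverAlgebra.mk_rel (Rel.comm d h h')

theorem dartArrow_mul_dartPath_of_ne {d d' : Γ.graph.Dart} {n : ℕ} (hn : 0 < n) (h : d ≠ d') :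
    Γ.dartArrow k d * Γ.dartPath k n d' = 0 := by
  by_cases hf : d.fst = d'.fst
  · have he : Γ.edge d ≠ Γ.edge d' := fun he => h (edge_eq_of_fst_eq he hf)
    rw [← dartArrow_mul_edgeIdem, ← edgeIdem_mul_dartPath, mul_assoc, ← mul_assoc (Γ.edgeIdem k _),
      edgeIdem_mul_of_ne he, zero_mul, mul_zero]
  · obtain ⟨n, rfl⟩ := Nat.exists_eq_add_of_lt hn
    obtain ⟨d', rfl⟩ := Γ.next.surjective d'
    rw [Γ.next_fst] at hf
    rw [dartPath_next, ← mul_assoc, dartArrow_mul_dartArrow hf, zero_mul]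

/-! ### Socle elements and the index set of the basis -/

/-- A dart of a given edge around whose initial vertex there is a cycle of the quiver. -/
def cycleDart (f : Γ.Edge) : Γ.graph.Dart := (exists_hasCycle f).choose

theorem edge_cycleDart (f : Γ.Edge) : Γ.edge (cycleDart f) = f := (exists_hasCycle f).choose_spec.1

theorem hasCycle_cycleDart (f : Γ.Edge) : Γ.HasCycle (cycleDart f).fst :=
  (exists_hasCycle f).choose_spec.2

theorem dartPath_maxLen_eq {d : Γ.graph.Dart} (h : Γ.HasCycle d.fst) :
    Γ.dartPath k (Γ.maxLen d) d =
      Γ.dartPath k (Γ.maxLen (cycleDart (Γ.edge d))) (cycleDart (Γ.edge d)) := by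
  have hc := hasCycle_cycleDart (Γ.edge d)
  rcases edge_eq_edge_iff.1 (edge_cycleDart (Γ.edge d)) with he | he
  · rw [he]
  · rw [he] at hc ⊢
    exact dartPath_maxLen_symm h hc

variable (Γ) in
/-- The index set of the basis of `A_Γ` that consists of the trivial paths, the socle elements and
the other non-zero paths. -/
abbrev PathIndex := Γ.Edge ⊕ Γ.Edge ⊕ (Σ d : Γ.graph.Dart, Fin (Γ.maxLen d - 1))

variable (Γ k) in
/-- The basis of `A_Γ` that consists of paths. -/
def pathBasis : Γ.PathIndex → Γ.BasicAlgebra k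
  | Sum.inl f => Γ.edgeIdem k f
  | Sum.inr (Sum.inl f) => Γ.dartPath k (Γ.maxLen (cycleDart f)) (cycleDart f)
  | Sum.inr (Sum.inr ⟨d, n⟩) => Γ.dartPath k (n + 1) d

variable (Γ) in
/-- The degree of a basis element of `A_Γ`. -/
def indexDegree (d₀ : Γ.graph.Dart) : Γ.PathIndex → ℤ
  | Sum.inl _ => 0
  | Sum.inr (Sum.inl _) => (Γ.mult * Γ.numEdges : ℕ)
  | Sum.inr (Sum.inr ⟨d, n⟩) => Γ.pathDegree d₀ (n + 1) d

variable (Γ) in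
/-- The edge at which a basis element of `A_Γ` starts. -/
def indexSource : Γ.PathIndex → Γ.Edge
  | Sum.inl f => f
  | Sum.inr (Sum.inl f) => f
  | Sum.inr (Sum.inr ⟨d, _⟩) => Γ.edge d

variable (Γ) in
/-- The edge at which a basis element of `A_Γ` ends. -/
def indexTarget : Γ.PathIndex → Γ.Edge
  | Sum.inl f => f
  | Sum.inr (Sum.inl f) => f
  | Sum.inr (Sum.inr ⟨d, n⟩) => Γ.edge (Γ.next.symm^[(n : ℕ) + 1] d)

theorem dartPath_mul_edgeIdem_symm (n : ℕ) (d : Γ.graph.Dart) :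
    Γ.dartPath k n d * Γ.edgeIdem k (Γ.edge (Γ.next.symm^[n] d)) = Γ.dartPath k n d := by
  have := dartPath_mul_edgeIdem (k := k) n (Γ.next.symm^[n] d)
  have h : Γ.next^[n] (Γ.next.symm^[n] d) = d :=
    Function.LeftInverse.iterate Γ.next.apply_symm_apply n d
  rwa [h] at this

theorem edgeIdem_mul_pathBasis (b : Γ.PathIndex) :
    Γ.edgeIdem k (Γ.indexSource b) * Γ.pathBasis k b = Γ.pathBasis k b := by
  rcases b with f | f | ⟨d, n⟩
  · exact edgeIdem_mul_self f
  · have := edgeIdem_mul_dartPath (k := k) (Γ.maxLen (cycleDart f)) (cycleDart f)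
    rwa [edge_cycleDart] at this
  · exact edgeIdem_mul_dartPath _ d

theorem pathBasis_mul_edgeIdem (b : Γ.PathIndex) :
    Γ.pathBasis k b * Γ.edgeIdem k (Γ.indexTarget b) = Γ.pathBasis k b := by
  rcases b with f | f | ⟨d, n⟩
  · exact edgeIdem_mul_self f
  · have := dartPath_mul_edgeIdem (k := k) (Γ.maxLen (cycleDart f)) (cycleDart f)
    rwa [next_iterate_maxLen, edge_cycleDart] at this
  · exact dartPath_mul_edgeIdem_symm _ d

/-- Every path is zero or an element of the basis. -/
theorem dartPath_cases {d₀ : Γ.graph.Dart} (hd₀ : d₀.fst = Γ.exc) (n : ℕ) (d : Γ.graph.Dart) :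
    Γ.dartPath k n d = 0 ∨
      ∃ b, Γ.pathBasis k b = Γ.dartPath k n d ∧ Γ.indexDegree d₀ b = Γ.pathDegree d₀ n d := by
  rcases Nat.eq_zero_or_pos n with rfl | hn
  · exact Or.inr ⟨Sum.inl (Γ.edge d), rfl, rfl⟩
  · by_cases h1 : n < Γ.maxLen d
    · obtain ⟨n, rfl⟩ := Nat.exists_eq_add_of_lt hn
      rw [zero_add] at h1 ⊢
      exact Or.inr ⟨Sum.inr (Sum.inr ⟨d, ⟨n, by omega⟩⟩), rfl, rfl⟩
    · by_cases h2 : n = Γ.maxLen d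
      · by_cases hc : Γ.HasCycle d.fst
        · refine Or.inr ⟨Sum.inr (Sum.inl (Γ.edge d)), ?_, ?_⟩
          · rw [h2]
            exact (dartPath_maxLen_eq hc).symm
          -- A longest path makes `multAt` full turns, of total degree `m * e` at every vertex.
          · have := pathDegree_eq hd₀ (valency_pos d) (d' := d) rfl (Γ.multAt d.fst)
            rw [zero_add, sub_self, if_neg (lt_irrefl _), zero_add, zero_add] at this
            rw [h2]
            refine Eq.trans ?_ this.symm
            rw [← Nat.cast_mul, multAt_mul_circumference]
            rfl
        · left
          obtain ⟨n, rfl⟩ := Nat.exists_eq_add_of_lt hn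
          rw [zero_add]
          exact dartPath_succ_of_not_hasCycle hc
      · exact Or.inl (dartPath_eq_zero (by omega))

theorem exists_dartPath_eq (b : Γ.PathIndex) {d₀ : Γ.graph.Dart} (hd₀ : d₀.fst = Γ.exc) :
    ∃ n d, Γ.pathBasis k b = Γ.dartPath k n d ∧ Γ.indexDegree d₀ b = Γ.pathDegree d₀ n d := by
  rcases b with f | f | ⟨d, n⟩
  · exact ⟨0, cycleDart f, by rw [dartPath_zero, edge_cycleDart]; rfl, rfl⟩
  · refine ⟨_, cycleDart f, rfl, ?_⟩
    have := pathDegree_eq hd₀ (valency_pos (cycleDart f)) (d' := cycleDart f) rfl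
      (Γ.multAt (cycleDart f).fst)
    rw [zero_add, sub_self, if_neg (lt_irrefl _), zero_add, zero_add] at this
    refine Eq.trans ?_ this.symm
    rw [← Nat.cast_mul, multAt_mul_circumference]
    rfl
  · exact ⟨_, d, rfl, rfl⟩

theorem dartPath_mem_span {d₀ : Γ.graph.Dart} (hd₀ : d₀.fst = Γ.exc) (n : ℕ) (d : Γ.graph.Dart)
    {l : ℤ} (hl : Γ.pathDegree d₀ n d = l) :
    Γ.dartPath k n d ∈ Submodule.span k (Γ.pathBasis k '' {b | Γ.indexDegree d₀ b = l}) := by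
  rcases dartPath_cases (k := k) hd₀ n d with h | ⟨b, hb, hdeg⟩
  · rw [h]
    exact Submodule.zero_mem _
  · rw [← hb]
    exact Submodule.subset_span ⟨b, hdeg.trans hl, rfl⟩

theorem edgeIdem_mul_mem_span {d₀ : Γ.graph.Dart} (f : Γ.Edge) (l : ℤ)
    {x : Γ.BasicAlgebra k}
    (hx : x ∈ Submodule.span k (Γ.pathBasis k '' {b | Γ.indexDegree d₀ b = l})) :
    Γ.edgeIdem k f * x ∈ Submodule.span k (Γ.pathBasis k '' {b | Γ.indexDegree d₀ b = l}) := by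
  induction hx using Submodule.span_induction with
  | mem x hx =>
    obtain ⟨b, hb, rfl⟩ := hx
    rw [← edgeIdem_mul_pathBasis, ← mul_assoc]
    by_cases h : f = Γ.indexSource b
    · rw [h, edgeIdem_mul_self, edgeIdem_mul_pathBasis]
      exact Submodule.subset_span ⟨b, hb, rfl⟩
    · rw [edgeIdem_mul_of_ne h, zero_mul]
      exact Submodule.zero_mem _
  | zero => simp
  | add a b _ _ ha hb => rw [mul_add]; exact Submodule.add_mem _ ha hb
  | smul c a _ ha => rw [mul_smul_comm]; exact Submodule.smul_mem _ c ha

/-- An arrow times a path is zero or the extended path around the same vertex, and degrees add up. A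
trivial path may first have to be read as one at the other dart of its edge. -/
theorem dartArrow_mul_mem_span {d₀ : Γ.graph.Dart} (hd₀ : d₀.fst = Γ.exc) (d : Γ.graph.Dart) (l : ℤ)
    {x : Γ.BasicAlgebra k}
    (hx : x ∈ Submodule.span k (Γ.pathBasis k '' {b | Γ.indexDegree d₀ b = l})) :
    Γ.dartArrow k d * x ∈ Submodule.span k
      (Γ.pathBasis k '' {b | Γ.indexDegree d₀ b = l + Γ.dartDegree d₀ d}) := by
  induction hx using Submodule.span_induction with
  | mem x hx =>
    obtain ⟨b, hb, rfl⟩ := hx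
    obtain ⟨n, d', hbd, hdeg⟩ := exists_dartPath_eq (k := k) b hd₀
    have hb : Γ.indexDegree d₀ b = l := hb
    rw [hbd]
    by_cases h : d = d'
    · rw [h, ← dartPath_next]
      refine dartPath_mem_span hd₀ _ _ ?_
      rw [pathDegree_next, ← hdeg, hb, add_comm]
    · rcases Nat.eq_zero_or_pos n with rfl | hn
      · rw [dartPath_zero]
        by_cases he : Γ.edge d = Γ.edge d'
        · rw [← he, ← dartPath_zero, ← dartPath_next]
          refine dartPath_mem_span hd₀ _ _ ?_
          rw [pathDegree_next, ← hb, hdeg, add_comm]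
          rfl
        · rw [← dartArrow_mul_edgeIdem, mul_assoc, edgeIdem_mul_of_ne he, mul_zero]
          exact Submodule.zero_mem _
      · rw [dartArrow_mul_dartPath_of_ne hn h]
        exact Submodule.zero_mem _
  | zero => simp
  | add a b _ _ ha hb => rw [mul_add]; exact Submodule.add_mem _ ha hb
  | smul c a _ ha => rw [mul_smul_comm]; exact Submodule.smul_mem _ c ha

theorem arr_eq_dartArrow (y : Γ.Arrow) : QuiverAlgebra.arr (Γ.Rel k) y = Γ.dartArrow k y.1 := by
  obtain ⟨d, h⟩ := y
  change _ = Γ.dartArrow k d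
  simp only [dartArrow, dif_pos h]

theorem span_pathBasis {d₀ : Γ.graph.Dart} (hd₀ : d₀.fst = Γ.exc) :
    Submodule.span k (Set.range (Γ.pathBasis k)) = ⊤ := by
  have hsub : ∀ b, Γ.pathBasis k b ∈ Submodule.span k (Γ.pathBasis k '' {b' | Γ.indexDegree d₀ b' =
      Γ.indexDegree d₀ b}) := fun b => Submodule.subset_span ⟨b, rfl, rfl⟩
  have hle : ∀ l, Submodule.span k (Γ.pathBasis k '' {b | Γ.indexDegree d₀ b = l}) ≤
      Submodule.span k (Set.range (Γ.pathBasis k)) :=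
    fun l => Submodule.span_mono (Set.image_subset_range _ _)
  have ext : ∀ a : Γ.BasicAlgebra k,
      (∀ b, a * Γ.pathBasis k b ∈ Submodule.span k (Set.range (Γ.pathBasis k))) →
      ∀ x ∈ Submodule.span k (Set.range (Γ.pathBasis k)),
        a * x ∈ Submodule.span k (Set.range (Γ.pathBasis k)) := by
    intro a ha x hx
    induction hx using Submodule.span_induction with
    | mem x hx => obtain ⟨b, rfl⟩ := hx; exact ha b
    | zero => simp
    | add x y _ _ hx hy => rw [mul_add]; exact Submodule.add_mem _ hx hy
    | smul c x _ hx => rw [mul_smul_comm]; exact Submodule.smul_mem _ c hx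
  refine QuiverAlgebra.eq_top_of_mul_mem _ _ ?_ (fun f => ext _ fun b => ?_)
    (fun y => ext _ fun b => ?_)
  · rw [← QuiverAlgebra.sum_vert]
    exact Submodule.sum_mem _ fun f _ => Submodule.subset_span ⟨Sum.inl f, rfl⟩
  · exact hle _ (edgeIdem_mul_mem_span f _ (hsub b))
  · rw [arr_eq_dartArrow]
    exact hle _ (dartArrow_mul_mem_span hd₀ y.1 _ (hsub b))

/-- The spans contain the unit and are compatible with multiplication by generators; conversely each
path is a product of arrows of the right total degree. -/
theorem greenGrading_eq_span {d₀ : Γ.graph.Dart} (hd₀ : d₀.fst = Γ.exc) (l : ℤ) :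
    Γ.greenGrading k d₀ l =
      Submodule.span k (Γ.pathBasis k '' {b | Γ.indexDegree d₀ b = l}) := by
  apply le_antisymm
  · refine QuiverAlgebra.piece_le (Γ.Rel k) (Γ.arrowDegree k d₀)
      (fun l => Submodule.span k (Γ.pathBasis k '' {b | Γ.indexDegree d₀ b = l})) ?_ ?_ ?_ l
    · rw [← QuiverAlgebra.sum_vert]
      exact Submodule.sum_mem _ fun f _ => Submodule.subset_span ⟨Sum.inl f, rfl, rfl⟩
    · exact fun f l x hx => edgeIdem_mul_mem_span f l hx
    · intro y l x hx
      rw [arrowDegree_eq hd₀, arr_eq_dartArrow]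
      exact dartArrow_mul_mem_span hd₀ y.1 l hx
  · refine Submodule.span_le.2 ?_
    have hmem : ∀ n d, Γ.dartPath k n d ∈ Γ.greenGrading k d₀ (Γ.pathDegree d₀ n d) := by
      intro n
      induction n with
      | zero => exact fun d => QuiverAlgebra.vert_mem_piece _ _ _
      | succ n ih =>
        intro d
        obtain ⟨d, rfl⟩ := Γ.next.surjective d
        rw [dartPath_next, pathDegree_next]
        refine QuiverAlgebra.mul_mem_piece ?_ (ih d)
        unfold dartArrow
        split_ifs with h
        · have key : ∀ l, Γ.arrowDegree k d₀ (⟨d, h⟩ : Γ.Arrow) = l →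
              QuiverAlgebra.arr (Γ.Rel k) (⟨d, h⟩ : Γ.Arrow) ∈ Γ.greenGrading k d₀ l := by
            rintro _ rfl
            exact QuiverAlgebra.arr_mem_piece _ _ _
          exact key _ (arrowDegree_eq hd₀ _)
        · exact Submodule.zero_mem _
    rintro _ ⟨b, hb, rfl⟩
    obtain ⟨n, d, hbd, hdeg⟩ := exists_dartPath_eq (k := k) b hd₀
    have hb : Γ.indexDegree d₀ b = l := hb
    rw [hbd, ← hb, hdeg]
    exact hmem n d

/-! ### Linear independence of the paths -/

theorem regular_edgeIdem (f : Γ.Edge) : Γ.regular k (Γ.edgeIdem k f) = Γ.regVert k f :=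
  QuiverAlgebra.lift_vert _ _ _ _ _ _ f

theorem regular_dartPath (n : ℕ) {d : Γ.graph.Dart} (h : Γ.HasCycle d.fst) :
    Γ.regular k (Γ.dartPath k n d) = Γ.regPath k n d :=
  (QuiverAlgebra.lift_mk _ _ _ _ _ _ _).trans (liftFree_vertexPath n h)

theorem regPath_sum (n : ℕ) (d : Γ.graph.Dart) :
    Γ.regPath k n d (∑ f, Finsupp.single (Sum.inl f) 1) = Γ.pathVec k d n := by
  obtain ⟨d, rfl⟩ := Γ.next.surjective.iterate n d
  simp only [map_sum, regPath_single_inl]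
  simp

/-- Acting on the sum of the trivial paths, the unit of the regular representation, the basis
elements give distinct standard basis vectors. -/
theorem linearIndependent_pathBasis : LinearIndependent k (Γ.pathBasis k) := by
  let ev : Γ.BasicAlgebra k →ₗ[k] (Γ.PathLabel →₀ k) :=
    LinearMap.applyₗ (∑ f, Finsupp.single (Sum.inl f) 1) ∘ₗ (Γ.regular k).toLinearMap
  let ι : Γ.PathIndex → Γ.PathLabel
    | Sum.inl f => Sum.inl f
    | Sum.inr (Sum.inl f) => Sum.inr (Sum.inl f)
    | Sum.inr (Sum.inr ⟨d, n⟩) => Sum.inr (Sum.inr (d, n))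
  have hι : Function.Injective ι := by
    rintro (f | f | ⟨d, n⟩) (g | g | ⟨d', n'⟩) h <;> simp only [ι, Sum.inl.injEq, Sum.inr.injEq,
      Prod.mk.injEq, reduceCtorEq] at h
    · rw [h]
    · rw [h]
    · obtain ⟨rfl, h⟩ := h
      rw [Fin.ext h]
  have hev : ev ∘ Γ.pathBasis k = (fun b => Finsupp.single b 1) ∘ ι := by
    funext b
    rcases b with f | f | ⟨d, n⟩
    · change Γ.regular k (Γ.edgeIdem k f) (∑ f, Finsupp.single (Sum.inl f) 1) = _
      rw [regular_edgeIdem]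
      simp only [map_sum, regVert_single, PathLabel.source]
      refine (Finset.sum_eq_single f (fun g _ hg => if_neg hg)
        (fun h => absurd (Finset.mem_univ _) h)).trans (if_pos rfl)
    · change Γ.regular k (Γ.dartPath k _ _) (∑ f, Finsupp.single (Sum.inl f) 1) = _
      rw [regular_dartPath _ (hasCycle_cycleDart f), regPath_sum, pathVec_maxLen, edge_cycleDart]
      rfl
    · have hn := n.2
      have hc : Γ.HasCycle d.fst := by
        by_contra hno
        have := maxLen_eq_one hno
        omega
      change Γ.regular k (Γ.dartPath k _ _) (∑ f, Finsupp.single (Sum.inl f) 1) = _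
      rw [regular_dartPath _ hc, regPath_sum, pathVec, if_neg (Nat.succ_ne_zero _),
        if_pos (by omega)]
      rfl
  have := (Finsupp.basisSingleOne (R := k) (ι := Γ.PathLabel)).linearIndependent.comp ι hι
  rw [Finsupp.coe_basisSingleOne, ← hev] at this
  exact LinearIndependent.of_comp ev this

end BrauerTree

/-! ### A determinant -/

/-- The matrix with constant entries `1 + b` on, `a` below and `b` above the diagonal. -/
def stairMatrix {R : Type*} [CommRing R] (n : ℕ) (a b : R) : Matrix (Fin n) (Fin n) R :=
  Matrix.of fun i j => if i = j then 1 + b else if j < i then a else b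

/-- A constant matrix has rank at most one, so by the matrix determinant lemma the determinant is
affine in `t`. -/
theorem det_add_const {R : Type*} [CommRing R] {n : ℕ} (A : Matrix (Fin n) (Fin n) R)
    (hA : A.det = 1) : ∃ s : R, ∀ t : R, (A + Matrix.of fun _ _ => t).det = 1 + t * s := by
  let M : Matrix Unit Unit R := Matrix.replicateRow Unit (fun _ : Fin n => (1 : R)) * A⁻¹ *
    Matrix.replicateCol Unit (fun _ : Fin n => (1 : R))
  refine ⟨M () (), fun t => ?_⟩
  have h1 : (Matrix.of fun _ _ => t : Matrix (Fin n) (Fin n) R) =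
      Matrix.replicateCol Unit (fun _ => t) * Matrix.replicateRow Unit (fun _ => (1 : R)) := by
    ext i j
    simp [Matrix.mul_apply]
  have h2 : Matrix.replicateCol Unit (fun _ : Fin n => t) =
      t • Matrix.replicateCol Unit (fun _ => (1 : R)) := by
    ext i j
    simp
  rw [h1, Matrix.det_add_replicateCol_mul_replicateRow (by rw [hA]; exact isUnit_one), hA, one_mul,
    h2, Matrix.mul_smul, Matrix.det_unique]
  rfl

/-- Subtracting the constant `b` leaves a lower unitriangular matrix, subtracting `a` an upper
triangular one with diagonal `1 + b - a`. The determinant is affine in the subtracted constant, and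
these two values determine it after multiplication by `b - a`. -/
theorem det_stairMatrix_mul {R : Type*} [CommRing R] (n : ℕ) (a b : R) :
    (stairMatrix n a b).det * (b - a) = b * (1 + b - a) ^ n - a := by
  have hlow : (stairMatrix n a b - Matrix.of fun _ _ => b).det = 1 := by
    rw [Matrix.det_of_isLowerTriangular]
    · simp [stairMatrix]
    · intro i j hij
      have hij : i < j := hij
      simp [stairMatrix, hij.ne, hij.not_gt]
  have hup : (stairMatrix n a b - Matrix.of fun _ _ => a).det = (1 + b - a) ^ n := by
    rw [Matrix.det_of_isUpperTriangular]
    · simp [stairMatrix]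
    · intro i j hij
      have hij : j < i := hij
      simp [stairMatrix, hij.ne', hij]
  obtain ⟨s, hs⟩ := det_add_const _ hlow
  have h1 : (stairMatrix n a b).det = 1 + b * s := by
    rw [← hs b, sub_add_cancel]
  have h2 : (1 + b - a) ^ n = 1 + (b - a) * s := by
    rw [← hs (b - a), ← hup]
    congr 1
    ext i j
    simp
  rw [h1, h2]
  ring

theorem det_stairMatrix {R : Type*} [CommRing R] [IsDomain R] (n m : ℕ) {Q : R} (hQ : Q ^ m ≠ 1) :
    (stairMatrix n (∑ t ∈ Finset.range m, Q ^ t) (Q * ∑ t ∈ Finset.range m, Q ^ t)).det =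
      ∑ t ∈ Finset.range (m * n + 1), Q ^ t := by
  have h := det_stairMatrix_mul n (∑ t ∈ Finset.range m, Q ^ t) (Q * ∑ t ∈ Finset.range m, Q ^ t)
  have hg := mul_geom_sum Q m
  have hg' := mul_geom_sum Q (m * n + 1)
  set a := ∑ t ∈ Finset.range m, Q ^ t
  have h1 : Q * a - a = Q ^ m - 1 := by rw [← hg]; ring
  have h2 : 1 + Q * a - a = Q ^ m := by rw [add_sub_assoc, h1]; ring
  rw [h2, h1, ← pow_mul] at h
  -- Here `b - a = Q ^ m - 1`, which is cancelled as a non-zero element of a domain.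
  apply mul_right_cancel₀ (sub_ne_zero.2 hQ)
  rw [h, ← hg]
  have : (∑ t ∈ Finset.range (m * n + 1), Q ^ t) * ((Q - 1) * a) = (Q ^ (m * n + 1) - 1) * a := by
    rw [← hg']; ring
  rw [this, pow_succ]
  ring

theorem sum_range_mul_eq {M : Type*} [AddCommMonoid M] (F : ℕ → M) (m n : ℕ) :
    ∑ i ∈ Finset.range (m * n), F i =
      ∑ t ∈ Finset.range m, ∑ r ∈ Finset.range n, F (r + t * n) := by
  induction m with
  | zero => simp
  | succ m ih =>
    rw [Nat.succ_mul, Finset.sum_range_add, ih, Finset.sum_range_succ]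
    simp only [add_comm]

namespace BrauerTree

variable {V : Type*} [Finite V] {Γ : BrauerTree V} {k : Type*} [Field k] {d₀ : Γ.graph.Dart}

/-! ### The entries of the graded Cartan matrix -/

local notation "𝐪" => LaurentPolynomial.T (R := ℤ)

instance : Fintype Γ.graph.Dart := Fintype.ofFinite _

open LaurentPolynomial in
open Classical in
variable (Γ) in
/-- The contribution of the paths around a vertex, starting at the edge of `d` and ending at `g`,
to the graded Cartan matrix. -/
def pathSum (d₀ d : Γ.graph.Dart) (g : Γ.Edge) : LaurentPolynomial ℤ :=
  ∑ n ∈ Finset.range (Γ.maxLen d),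
    if Γ.edge (Γ.next.symm^[n] d) = g then 𝐪 (Γ.pathDegree d₀ n d) else 0

theorem next_symm_iterate_fst (n : ℕ) (d : Γ.graph.Dart) : (Γ.next.symm^[n] d).fst = d.fst := by
  have h : Γ.next^[n] (Γ.next.symm^[n] d) = d :=
    Function.LeftInverse.iterate Γ.next.apply_symm_apply n d
  conv_rhs => rw [← h, next_iterate_fst]

theorem pathSum_eq_zero {d : Γ.graph.Dart} {g : Γ.Edge}
    (h : ∀ d' : Γ.graph.Dart, d'.fst = d.fst → Γ.edge d' ≠ g) : Γ.pathSum d₀ d g = 0 :=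
  Finset.sum_eq_zero fun n _ => if_neg (h _ (next_symm_iterate_fst n d))

-- The paths from `d` to `d'` around the vertex have lengths `r + t * valency` with `r` fixed and `t
-- < multAt`: a geometric series in the degree of a full turn.
open LaurentPolynomial in
theorem pathSum_eq (hd₀ : d₀.fst = Γ.exc) {d d' : Γ.graph.Dart} (h : d'.fst = d.fst) :
    Γ.pathSum d₀ d (Γ.edge d') =
      𝐪 (Γ.potential d₀ d.fst (Γ.edge d) - Γ.potential d₀ d.fst (Γ.edge d')) *
        (if Γ.label d₀ (Γ.edge d) < Γ.label d₀ (Γ.edge d') then 𝐪 (Γ.circumference d.fst) else 1) *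
        ∑ t ∈ Finset.range (Γ.multAt d.fst), 𝐪 (Γ.circumference d.fst) ^ t := by
  obtain ⟨r, hr, hrd⟩ := exists_next_iterate h
  rw [h] at hr
  have hiff : ∀ n, Γ.edge (Γ.next.symm^[n] d) = Γ.edge d' ↔ Γ.next^[n] d' = d := by
    intro n
    have h1 : Γ.next^[n] (Γ.next.symm^[n] d) = d :=
      Function.LeftInverse.iterate Γ.next.apply_symm_apply n d
    constructor
    · intro he
      rw [← edge_eq_of_fst_eq he ((next_symm_iterate_fst n d).trans h.symm), h1]
    · intro he
      rw [Γ.next.injective.iterate n (h1.trans he.symm)]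
  have hper : ∀ n t, Γ.next^[n + t * Γ.valency d.fst] d' = Γ.next^[n] d' := by
    intro n t
    have h1 : Γ.next^[t * Γ.valency d.fst] d' = d' :=
      next_iterate_eq_self_iff.2 (by rw [h]; exact Dvd.intro_left _ rfl)
    rw [Function.iterate_add_apply, h1]
  rw [pathSum, maxLen, sum_range_mul_eq, Finset.mul_sum]
  refine Finset.sum_congr rfl fun t _ => ?_
  rw [Finset.sum_eq_single_of_mem r (Finset.mem_range.2 hr)]
  · rw [if_pos ((hiff _).2 ?_), pathDegree_eq hd₀ hr hrd, T_add, mul_assoc, T_pow]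
    · congr 1
      split_ifs
      · rw [← T_add]
        congr 1
        push_cast
        ring
      · rw [one_mul]
        congr 1
        push_cast
        ring
    · rw [hper, hrd]
  · intro n hn hne
    refine if_neg fun he => hne ?_
    rw [hiff, hper] at he
    rw [← h] at hr
    exact next_iterate_inj (by rw [h]; exact Finset.mem_range.1 hn) hr (he.trans hrd.symm)

-- The sums over the two ends both contain the trivial path, and neither contains the socle element;
-- the diagonal term corrects this.
open LaurentPolynomial in
theorem gradedCartan_apply (hd₀ : d₀.fst = Γ.exc) (d : Γ.graph.Dart) (g : Γ.Edge) :
    Γ.gradedCartan k d₀ (Γ.edge d) g =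
      (if Γ.edge d = g then 𝐪 ((Γ.mult * Γ.numEdges : ℕ) : ℤ) - 1 else 0) +
        (Γ.pathSum d₀ d g + Γ.pathSum d₀ d.symm g) := by
  classical
  have h := QuiverAlgebra.cartan_apply (w := Γ.arrowDegree k d₀) linearIndependent_pathBasis
    (greenGrading_eq_span hd₀) edgeIdem_mul_pathBasis pathBasis_mul_edgeIdem (Γ.edge d) g
  refine h.trans ?_
  rw [Finset.sum_filter, Fintype.sum_sum_type, Fintype.sum_sum_type, Fintype.sum_sigma]
  have hmid : ∀ d' : Γ.graph.Dart, (∑ n : Fin (Γ.maxLen d' - 1),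
      if Γ.indexSource (Sum.inr (Sum.inr ⟨d', n⟩)) = Γ.edge d ∧
        Γ.indexTarget (Sum.inr (Sum.inr ⟨d', n⟩)) = g then
        𝐪 (Γ.indexDegree d₀ (Sum.inr (Sum.inr ⟨d', n⟩))) else 0) =
      if Γ.edge d' = Γ.edge d then
        Γ.pathSum d₀ d' g - (if Γ.edge d' = g then 1 else 0) else 0 := by
    intro d'
    by_cases he : Γ.edge d' = Γ.edge d
    · rw [if_pos he, pathSum]
      conv_rhs => rw [← Nat.sub_add_cancel (maxLen_pos d'), Finset.sum_range_succ']
      rw [← Fin.sum_univ_eq_sum_range (fun n => if Γ.edge (Γ.next.symm^[n + 1] d') = g then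
        𝐪 (Γ.pathDegree d₀ (n + 1) d') else 0)]
      have h0 : 𝐪 (Γ.pathDegree d₀ 0 d') = 1 := T_zero
      rw [h0, Function.iterate_zero_apply, add_sub_cancel_right]
      refine Finset.sum_congr rfl fun n _ => ?_
      simp only [indexSource, indexTarget, indexDegree, he, true_and]
    · rw [if_neg he]
      exact Finset.sum_eq_zero fun n _ => if_neg fun h => he h.1
  have hdarts : ∀ X : Γ.graph.Dart → LaurentPolynomial ℤ,
      (∑ d' : Γ.graph.Dart, if Γ.edge d' = Γ.edge d then X d' else 0) = X d + X d.symm := by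
    intro X
    rw [← Finset.sum_filter, show (Finset.univ.filter fun d' => Γ.edge d' = Γ.edge d) = {d, d.symm} by
      ext d'
      simp [edge_eq_edge_iff], Finset.sum_pair d.symm_ne.symm]
  have hdiag : ∀ (s : Γ.Edge → Γ.PathIndex) (c : ℤ), (∀ f, Γ.indexSource (s f) = f) →
      (∀ f, Γ.indexTarget (s f) = f) → (∀ f, Γ.indexDegree d₀ (s f) = c) →
      (∑ f : Γ.Edge, if Γ.indexSource (s f) = Γ.edge d ∧ Γ.indexTarget (s f) = g then
        𝐪 (Γ.indexDegree d₀ (s f)) else 0) = if Γ.edge d = g then 𝐪 c else 0 := by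
    intro s c h1 h2 h3
    rw [Finset.sum_eq_single (Γ.edge d) (fun f _ hf => if_neg fun h => hf ((h1 f).symm.trans h.1))
      (fun h => absurd (Finset.mem_univ _) h), h1, h2, h3]
    simp only [true_and]
  rw [hdiag Sum.inl 0 (fun _ => rfl) (fun _ => rfl) (fun _ => rfl),
    hdiag (fun f => Sum.inr (Sum.inl f)) ((Γ.mult * Γ.numEdges : ℕ) : ℤ) (fun _ => rfl)
      (fun _ => rfl) (fun _ => rfl), T_zero]
  simp only [hmid, hdarts, edge_symm]
  split_ifs <;> ring

end BrauerTree

namespace BrauerTree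

variable {V : Type*} [Finite V] {Γ : BrauerTree V} {k : Type*} [Field k] {d₀ : Γ.graph.Dart}

local notation "𝐪" => LaurentPolynomial.T (R := ℤ)

open LaurentPolynomial

/-! ### Parents and labels -/

theorem IsDown.snd_ne_exc {d : Γ.graph.Dart} (h : Γ.IsDown d) : d.snd ≠ Γ.exc := by
  intro he
  rw [IsDown, he, SimpleGraph.dist_self] at h
  omega

theorem IsDown.depth_pos_iff {d : Γ.graph.Dart} (h : Γ.IsDown d) :
    0 < Γ.depth (Γ.edge d) ↔ d.fst ≠ Γ.exc := by
  rw [h.depth_edge, Nat.pos_iff_ne_zero, Ne, dist_exc_eq_zero]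

theorem IsDown.snd_eq_of_parent_eq {d p : Γ.graph.Dart} (h : Γ.IsDown d) (hp : Γ.IsDown p)
    (hpos : 0 < Γ.depth (Γ.edge d)) (he : Γ.parent (Γ.edge d) = Γ.edge p) : p.snd = d.fst := by
  obtain ⟨p', hp', hs⟩ := IsDown.exists_parent (h.depth_pos_iff.1 hpos)
  rw [h.parent_edge hp' hs] at he
  rw [← hs, IsDown.eq_of_edge_eq hp hp' he.symm]

theorem IsDown.fst_eq_of_parent_eq {d d' : Γ.graph.Dart} (h : Γ.IsDown d) (h' : Γ.IsDown d')
    (hpos : 0 < Γ.depth (Γ.edge d)) (hpos' : 0 < Γ.depth (Γ.edge d'))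
    (he : Γ.parent (Γ.edge d) = Γ.parent (Γ.edge d')) : d.fst = d'.fst := by
  obtain ⟨p, hp, hs⟩ := IsDown.exists_parent (h'.depth_pos_iff.1 hpos')
  rw [h'.parent_edge hp hs] at he
  rw [← hs, h.snd_eq_of_parent_eq hp hpos he]

theorem label_parent_lt (hd₀ : d₀.fst = Γ.exc) {f : Γ.Edge} (h : 0 < Γ.depth f) :
    Γ.label d₀ (Γ.parent f) < Γ.label d₀ f := by
  obtain ⟨d, hd, rfl⟩ := exists_isDown f
  obtain ⟨p, hp, hs⟩ := IsDown.exists_parent (hd.depth_pos_iff.1 h)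
  rw [hd.parent_edge hp hs]
  exact IsDown.label_lt_child hd₀ hp hd hs.symm

theorem below_parent_of_label_between (hd₀ : d₀.fst = Γ.exc) {f g : Γ.Edge} (h : 0 < Γ.depth g)
    (h1 : Γ.label d₀ (Γ.parent g) < Γ.label d₀ f) (h2 : Γ.label d₀ f < Γ.label d₀ g) :
    Γ.Below (Γ.parent g) f := by
  obtain ⟨d, hd, rfl⟩ := exists_isDown g
  obtain ⟨p, hp, hs⟩ := IsDown.exists_parent (hd.depth_pos_iff.1 h)
  rw [hd.parent_edge hp hs] at h1 ⊢
  exact IsDown.below_of_label_between hd₀ hp hd hs.symm h1 h2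

theorem Below.of_below_parent {p f : Γ.Edge} (hpos : 0 < Γ.depth f)
    (h : Γ.Below p (Γ.parent f)) : Γ.Below p f := by
  have h1 := h.1
  have h2 := h.2
  rw [depth_parent] at h1 h2
  refine ⟨by omega, ?_⟩
  rw [show Γ.depth f - Γ.depth p = (Γ.depth f - 1 - Γ.depth p) + 1 by omega,
    Function.iterate_succ_apply, h2]

theorem below_parent {f : Γ.Edge} (hpos : 0 < Γ.depth f) : Γ.Below (Γ.parent f) f :=
  (Below.refl _).of_below_parent hpos

/-- The parent of the deeper edge is an ancestor of the other edge or equal to it, which leaves one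
or zero levels between them: the edges are siblings, or parent and child. -/
theorem exists_adj_of_below {d d' : Γ.graph.Dart} (h : Γ.IsDown d) (h' : Γ.IsDown d')
    (hle : Γ.depth (Γ.edge d) ≤ Γ.depth (Γ.edge d'))
    (hb : 0 < Γ.depth (Γ.edge d') → Γ.Below (Γ.parent (Γ.edge d')) (Γ.edge d)) :
    d.fst = d'.fst ∨ d.snd = d'.fst := by
  rcases Nat.eq_zero_or_pos (Γ.depth (Γ.edge d')) with h0' | hpos'
  · left
    have h0 : Γ.depth (Γ.edge d) = 0 := by omega
    rw [h.depth_edge, dist_exc_eq_zero] at h0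
    rw [h'.depth_edge, dist_exc_eq_zero] at h0'
    rw [h0, h0']
  · have hb1 := (hb hpos').1
    have hb2 := (hb hpos').2
    rw [depth_parent] at hb1 hb2
    rcases hle.eq_or_lt with heq | hlt
    · left
      refine h.fst_eq_of_parent_eq h' (heq ▸ hpos') hpos' ?_
      rw [show Γ.depth (Γ.edge d) - (Γ.depth (Γ.edge d') - 1) = 1 by omega] at hb2
      exact hb2
    · right
      refine h'.snd_eq_of_parent_eq h hpos' ?_
      rw [show Γ.depth (Γ.edge d) - (Γ.depth (Γ.edge d') - 1) = 0 by omega] at hb2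
      exact hb2.symm

/-! ### Values of the contributions of the vertices -/

variable (Γ) in
/-- The sum of the powers of `q ^ e` with exponents less than the multiplicity. -/
def multSum : LaurentPolynomial ℤ := ∑ t ∈ Finset.range Γ.mult, 𝐪 (Γ.numEdges : ℤ) ^ t

theorem one_add_mul_multSum :
    1 + 𝐪 (Γ.numEdges : ℤ) * Γ.multSum =
      Γ.multSum + 𝐪 ((Γ.mult * Γ.numEdges : ℕ) : ℤ) := by
  have h := mul_geom_sum (𝐪 (Γ.numEdges : ℤ)) Γ.mult
  rw [T_pow] at h
  have h' : 𝐪 ((Γ.mult * Γ.numEdges : ℕ) : ℤ) = (𝐪 (Γ.numEdges : ℤ) - 1) * Γ.multSum + 1 := by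
    rw [multSum, h, sub_add_cancel]
    push_cast
    rfl
  rw [h']
  ring

theorem pathSum_eq_of_eq_exc (hd₀ : d₀.fst = Γ.exc) {d d' : Γ.graph.Dart} (h : d'.fst = d.fst)
    (hx : d.fst = Γ.exc) :
    Γ.pathSum d₀ d (Γ.edge d') =
      𝐪 ((Γ.label d₀ (Γ.edge d) : ℤ) - (Γ.label d₀ (Γ.edge d') : ℤ)) *
        (if Γ.label d₀ (Γ.edge d) < Γ.label d₀ (Γ.edge d') then 𝐪 (Γ.numEdges : ℤ) else 1) *
        Γ.multSum := by
  rw [pathSum_eq hd₀ h]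
  simp only [potential, circumference, multAt, if_pos hx, multSum]

theorem pathSum_eq_of_ne_exc (hd₀ : d₀.fst = Γ.exc) {d d' : Γ.graph.Dart} (h : d'.fst = d.fst)
    (hx : d.fst ≠ Γ.exc) :
    Γ.pathSum d₀ d (Γ.edge d') =
      if Γ.label d₀ (Γ.edge d) < Γ.label d₀ (Γ.edge d') then
        𝐪 ((Γ.mult * Γ.numEdges : ℕ) : ℤ) else 1 := by
  rw [pathSum_eq hd₀ h]
  simp only [potential, circumference, multAt, if_neg hx, sub_self, T_zero, one_mul,
    Finset.sum_range_one, pow_zero, mul_one]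

/-! ### The reduced matrix -/

variable (Γ) in
/-- The stair matrix with rows and columns numbered by Green's walk. -/
def stair (d₀ : Γ.graph.Dart) : Matrix Γ.Edge Γ.Edge (LaurentPolynomial ℤ) :=
  (stairMatrix Γ.numEdges Γ.multSum (𝐪 (Γ.numEdges : ℤ) * Γ.multSum)).submatrix
    (Γ.label d₀) (Γ.label d₀)

theorem stair_self (f : Γ.Edge) :
    Γ.stair d₀ f f = Γ.multSum + 𝐪 ((Γ.mult * Γ.numEdges : ℕ) : ℤ) := by
  rw [← one_add_mul_multSum]
  simp [stair, stairMatrix]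

theorem stair_of_lt {f g : Γ.Edge} (h : Γ.label d₀ g < Γ.label d₀ f) :
    Γ.stair d₀ f g = Γ.multSum := by
  simp [stair, stairMatrix, h.ne', h]

theorem stair_of_gt {f g : Γ.Edge} (h : Γ.label d₀ f < Γ.label d₀ g) :
    Γ.stair d₀ f g = 𝐪 (Γ.numEdges : ℤ) * Γ.multSum := by
  simp [stair, stairMatrix, h.ne, h.not_gt]

/-- An edge with label between those of `parent g` and `g` lies below `parent g`; any other edge
outside that subtree cannot separate the two labels. -/
theorem label_lt_parent_or (hd₀ : d₀.fst = Γ.exc) {f g : Γ.Edge} (hpos : 0 < Γ.depth g)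
    (h : ¬ Γ.Below (Γ.parent g) f) :
    (Γ.label d₀ f < Γ.label d₀ (Γ.parent g) ∧ Γ.label d₀ f < Γ.label d₀ g) ∨
      (Γ.label d₀ (Γ.parent g) < Γ.label d₀ f ∧ Γ.label d₀ g < Γ.label d₀ f) := by
  have hlt := label_parent_lt hd₀ hpos
  have h1 : Γ.label d₀ f ≠ Γ.label d₀ g := fun he =>
    h ((label_injective hd₀ he).symm ▸ below_parent hpos)
  have h2 : Γ.label d₀ f ≠ Γ.label d₀ (Γ.parent g) := fun he =>
    h ((label_injective hd₀ he).symm ▸ Below.refl _)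
  rcases lt_or_gt_of_ne h2 with h2 | h2
  · exact Or.inl ⟨h2, h2.trans hlt⟩
  · rcases lt_or_gt_of_ne h1 with h1 | h1
    · exact absurd (below_parent_of_label_between hd₀ hpos h2 h1) h
    · exact Or.inr ⟨h2, h1⟩

theorem stair_parent_right (hd₀ : d₀.fst = Γ.exc) {f g : Γ.Edge} (hpos : 0 < Γ.depth g)
    (h : ¬ Γ.Below (Γ.parent g) f) : Γ.stair d₀ f (Γ.parent g) = Γ.stair d₀ f g := by
  rcases label_lt_parent_or hd₀ hpos h with ⟨h1, h2⟩ | ⟨h1, h2⟩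
  · rw [stair_of_gt h1, stair_of_gt h2]
  · rw [stair_of_lt h1, stair_of_lt h2]

theorem stair_parent_left (hd₀ : d₀.fst = Γ.exc) {f g : Γ.Edge} (hpos : 0 < Γ.depth g)
    (h : ¬ Γ.Below (Γ.parent g) f) : Γ.stair d₀ (Γ.parent g) f = Γ.stair d₀ g f := by
  rcases label_lt_parent_or hd₀ hpos h with ⟨h1, h2⟩ | ⟨h1, h2⟩
  · rw [stair_of_lt h1, stair_of_lt h2]
  · rw [stair_of_gt h1, stair_of_gt h2]

variable (Γ) in
/-- Subtracting the row of the parent from each row (that has a parent). -/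
def subParent : Matrix Γ.Edge Γ.Edge (LaurentPolynomial ℤ) :=
  Matrix.of fun f g => (if f = g then 1 else 0) - if 0 < Γ.depth f ∧ Γ.parent f = g then 1 else 0

theorem subParent_mul_apply (M : Matrix Γ.Edge Γ.Edge (LaurentPolynomial ℤ)) (f g : Γ.Edge) :
    (Γ.subParent * M) f g = M f g - if 0 < Γ.depth f then M (Γ.parent f) g else 0 := by
  simp only [Matrix.mul_apply, subParent, Matrix.of_apply, sub_mul, Finset.sum_sub_distrib, ite_mul,
    one_mul, zero_mul, Finset.sum_ite_eq, Finset.mem_univ, if_true, ite_and]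
  split_ifs <;> simp

variable (Γ) in
/-- The stair matrix after subtracting the rows and columns of the parents. -/
def reduced (d₀ : Γ.graph.Dart) : Matrix Γ.Edge Γ.Edge (LaurentPolynomial ℤ) :=
  Γ.subParent * (Γ.subParent * (Γ.stair d₀).transpose).transpose

theorem reduced_apply (f g : Γ.Edge) :
    Γ.reduced d₀ f g = (Γ.stair d₀ f g - if 0 < Γ.depth g then Γ.stair d₀ f (Γ.parent g) else 0) -
      if 0 < Γ.depth f then Γ.stair d₀ (Γ.parent f) g -
        if 0 < Γ.depth g then Γ.stair d₀ (Γ.parent f) (Γ.parent g) else 0 else 0 := by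
  simp only [reduced, subParent_mul_apply, Matrix.transpose_apply]

/-- Outside the subtree below `parent g`, the columns of `g` and `parent g` in the stair matrix
agree, and with `f` its parent is outside as well. -/
theorem reduced_eq_zero_right (hd₀ : d₀.fst = Γ.exc) {f g : Γ.Edge} (hpos : 0 < Γ.depth g)
    (h : ¬ Γ.Below (Γ.parent g) f) : Γ.reduced d₀ f g = 0 := by
  rw [reduced_apply, if_pos hpos, stair_parent_right hd₀ hpos h, if_pos hpos, sub_self, zero_sub,
    neg_eq_zero, ite_eq_right_iff]
  intro hf
  rw [stair_parent_right hd₀ hpos fun hb => h (hb.of_below_parent hf), sub_self]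

theorem reduced_eq_zero_left (hd₀ : d₀.fst = Γ.exc) {f g : Γ.Edge} (hpos : 0 < Γ.depth f)
    (h : ¬ Γ.Below (Γ.parent f) g) : Γ.reduced d₀ f g = 0 := by
  rw [reduced_apply, if_pos hpos, stair_parent_left hd₀ hpos h]
  split_ifs with hg
  · rw [stair_parent_left hd₀ hpos fun hb => h (hb.of_below_parent hg), sub_self]
  · simp

/-! ### Signs and shifts -/

variable (Γ) in
/-- The exponent by which the row of an edge is rescaled. -/
def rowShift (d₀ : Γ.graph.Dart) (f : Γ.Edge) : ℤ :=
  (Γ.label d₀ (Γ.parent^[Γ.depth f] f) : ℤ) - (Γ.mult * Γ.numEdges : ℕ) * Γ.depth f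

/-- Siblings away from the root thus get the same shift, while a parent and its child differ by `m *
e`, as needed to turn `-q^(me)` and `-1` in the reduced matrix into `1` and `q^(me)`. -/
theorem rowShift_eq_parent {f : Γ.Edge} (hpos : 0 < Γ.depth f) :
    Γ.rowShift d₀ f = Γ.rowShift d₀ (Γ.parent f) - (Γ.mult * Γ.numEdges : ℕ) := by
  obtain ⟨n, hn⟩ := Nat.exists_eq_succ_of_ne_zero hpos.ne'
  have h : Γ.depth (Γ.parent f) = n := by rw [depth_parent, hn]; rfl
  rw [rowShift, rowShift, h, hn, Function.iterate_succ_apply]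
  push_cast
  ring

variable (Γ) in
/-- The factor by which the row of an edge is rescaled. -/
def rowFactor (d₀ : Γ.graph.Dart) (f : Γ.Edge) : LaurentPolynomial ℤ :=
  (-1) ^ Γ.depth f * 𝐪 (Γ.rowShift d₀ f)

variable (Γ) in
/-- The factor by which the column of an edge is rescaled. -/
def colFactor (d₀ : Γ.graph.Dart) (f : Γ.Edge) : LaurentPolynomial ℤ :=
  (-1) ^ Γ.depth f * 𝐪 (-Γ.rowShift d₀ f)

theorem rowFactor_mul_colFactor (f g : Γ.Edge) :
    Γ.rowFactor d₀ f * Γ.colFactor d₀ g =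
      (-1) ^ (Γ.depth f + Γ.depth g) * 𝐪 (Γ.rowShift d₀ f - Γ.rowShift d₀ g) := by
  rw [rowFactor, colFactor, pow_add, sub_eq_add_neg, T_add]
  ring

theorem rowFactor_mul_colFactor_self (f : Γ.Edge) :
    Γ.rowFactor d₀ f * Γ.colFactor d₀ f = 1 := by
  rw [rowFactor_mul_colFactor, sub_self, T_zero, mul_one, Even.neg_one_pow ⟨_, rfl⟩]

/-! ### The graded Cartan matrix -/

theorem gradedCartan_self (hd₀ : d₀.fst = Γ.exc) {d : Γ.graph.Dart} (h : Γ.IsDown d) :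
    Γ.gradedCartan k d₀ (Γ.edge d) (Γ.edge d) = Γ.reduced d₀ (Γ.edge d) (Γ.edge d) := by
  have h2 := pathSum_eq_of_ne_exc hd₀ (d := d.symm) rfl h.snd_ne_exc
  rw [edge_symm, if_neg (lt_irrefl _)] at h2
  rw [gradedCartan_apply hd₀, if_pos rfl, h2, reduced_apply]
  by_cases hx : d.fst = Γ.exc
  · have hpos : ¬ 0 < Γ.depth (Γ.edge d) := fun hp => h.depth_pos_iff.1 hp hx
    rw [pathSum_eq_of_eq_exc hd₀ rfl hx, if_neg (lt_irrefl _), sub_self, T_zero, if_neg hpos,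
      if_neg hpos, stair_self]
    ring
  · have hpos := h.depth_pos_iff.2 hx
    rw [pathSum_eq_of_ne_exc hd₀ rfl hx, if_neg (lt_irrefl _), if_pos hpos, if_pos hpos,
      if_pos hpos, stair_self, stair_self, stair_of_lt (label_parent_lt hd₀ hpos),
      stair_of_gt (label_parent_lt hd₀ hpos), eq_sub_of_add_eq' one_add_mul_multSum]
    ring

theorem gradedCartan_sibling (hd₀ : d₀.fst = Γ.exc) {d d' : Γ.graph.Dart} (h : Γ.IsDown d)
    (h' : Γ.IsDown d') (hne : d ≠ d') (hs : d.fst = d'.fst) :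
    Γ.gradedCartan k d₀ (Γ.edge d) (Γ.edge d') =
      Γ.rowFactor d₀ (Γ.edge d) * Γ.colFactor d₀ (Γ.edge d') *
        Γ.reduced d₀ (Γ.edge d) (Γ.edge d') := by
  have hne' : Γ.edge d ≠ Γ.edge d' := fun he => hne (h.eq_of_edge_eq h' he)
  have h2 : Γ.pathSum d₀ d.symm (Γ.edge d') = 0 := by
    refine pathSum_eq_zero fun x hx he => ?_
    rcases edge_eq_edge_iff.1 he with rfl | rfl
    · exact d.snd_ne_fst (hx.symm.trans hs.symm)
    · exact hne (h.eq_of_snd_eq h' hx.symm)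
  have hdep : Γ.depth (Γ.edge d) = Γ.depth (Γ.edge d') := by
    rw [h.depth_edge, h'.depth_edge, hs]
  have hlab : Γ.label d₀ (Γ.edge d) ≠ Γ.label d₀ (Γ.edge d') :=
    fun he => hne' (label_injective hd₀ he)
  rw [gradedCartan_apply hd₀, if_neg hne', h2, reduced_apply, rowFactor_mul_colFactor, hdep,
    Even.neg_one_pow ⟨_, rfl⟩, zero_add, add_zero, one_mul]
  by_cases hx : d.fst = Γ.exc
  · have hpos : ¬ 0 < Γ.depth (Γ.edge d') := fun hp => h'.depth_pos_iff.1 hp (hs ▸ hx)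
    have h0 : Γ.depth (Γ.edge d') = 0 := by omega
    rw [pathSum_eq_of_eq_exc hd₀ hs.symm hx, if_neg hpos, if_neg hpos, sub_zero, sub_zero]
    simp only [rowShift, hdep, h0, Function.iterate_zero_apply, Nat.cast_zero, mul_zero, sub_zero]
    rcases lt_or_gt_of_ne hlab with hl | hl
    · rw [if_pos hl, stair_of_gt hl, mul_assoc]
    · rw [if_neg hl.not_gt, stair_of_lt hl, mul_one]
  · have hpos := h.depth_pos_iff.2 hx
    have hpos' := hdep ▸ hpos
    obtain ⟨p, hp, hps⟩ := IsDown.exists_parent hx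
    have hpar : Γ.parent (Γ.edge d) = Γ.parent (Γ.edge d') := by
      rw [h.parent_edge hp hps, h'.parent_edge hp (hps.trans hs)]
    have hl1 := label_parent_lt hd₀ hpos
    have hl2 := label_parent_lt hd₀ hpos'
    rw [rowShift_eq_parent hpos, rowShift_eq_parent hpos', pathSum_eq_of_ne_exc hd₀ hs.symm hx]
    rw [hpar] at hl1 ⊢
    rw [sub_self, T_zero, one_mul, if_pos hpos', if_pos hpos', if_pos hpos', stair_of_lt hl1,
      stair_of_gt hl2, stair_self]
    rcases lt_or_gt_of_ne hlab with hl | hl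
    · rw [if_pos hl, stair_of_gt hl]
      ring
    · rw [if_neg hl.not_gt, stair_of_lt hl, eq_sub_of_add_eq' one_add_mul_multSum]
      ring

theorem gradedCartan_parent_right (hd₀ : d₀.fst = Γ.exc) {d d' : Γ.graph.Dart} (h : Γ.IsDown d)
    (h' : Γ.IsDown d') (hs : d'.snd = d.fst) :
    Γ.gradedCartan k d₀ (Γ.edge d) (Γ.edge d') =
      Γ.rowFactor d₀ (Γ.edge d) * Γ.colFactor d₀ (Γ.edge d') *
        Γ.reduced d₀ (Γ.edge d) (Γ.edge d') := by
  have hx : d.fst ≠ Γ.exc := hs ▸ h'.snd_ne_exc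
  have hpos := h.depth_pos_iff.2 hx
  have hpar := h.parent_edge h' hs
  have hl : Γ.label d₀ (Γ.edge d') < Γ.label d₀ (Γ.edge d) := hpar ▸ label_parent_lt hd₀ hpos
  have hne : Γ.edge d ≠ Γ.edge d' := fun he => hl.ne (congrArg _ he.symm)
  have hdep := h'.depth_edge_child h hs.symm
  have h1 := pathSum_eq_of_ne_exc hd₀ (d := d) (d' := d'.symm) hs hx
  rw [edge_symm, if_neg hl.not_gt] at h1
  have h2 : Γ.pathSum d₀ d.symm (Γ.edge d') = 0 := by
    refine pathSum_eq_zero fun x hx he => ?_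
    rcases edge_eq_edge_iff.1 he with rfl | rfl
    · have hx : x.fst = d.snd := hx
      unfold IsDown at h h'
      rw [← hs, ← hx] at h
      omega
    · exact hne (congrArg _ (h.eq_of_snd_eq h' hx.symm))
  have hred : Γ.reduced d₀ (Γ.edge d) (Γ.edge d') = - 𝐪 ((Γ.mult * Γ.numEdges : ℕ) : ℤ) := by
    rw [reduced_apply, if_pos hpos, hpar, stair_self, stair_of_lt hl]
    split_ifs with hpos'
    · have hl' := label_parent_lt hd₀ hpos'
      rw [stair_of_lt hl', stair_of_lt (hl'.trans hl)]
      ring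
    · ring
  rw [gradedCartan_apply hd₀, if_neg hne, h1, h2, rowFactor_mul_colFactor, hdep,
    rowShift_eq_parent hpos, hpar, hred, Odd.neg_one_pow ⟨Γ.depth (Γ.edge d'), by ring⟩,
    neg_one_mul, neg_mul_neg, ← T_add, sub_right_comm, sub_self, zero_sub, neg_add_cancel, T_zero]
  ring

theorem gradedCartan_parent_left (hd₀ : d₀.fst = Γ.exc) {d d' : Γ.graph.Dart} (h : Γ.IsDown d)
    (h' : Γ.IsDown d') (hs : d.snd = d'.fst) :
    Γ.gradedCartan k d₀ (Γ.edge d) (Γ.edge d') =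
      Γ.rowFactor d₀ (Γ.edge d) * Γ.colFactor d₀ (Γ.edge d') *
        Γ.reduced d₀ (Γ.edge d) (Γ.edge d') := by
  have hx : d'.fst ≠ Γ.exc := hs ▸ h.snd_ne_exc
  have hpos := h'.depth_pos_iff.2 hx
  have hpar := h'.parent_edge h hs
  have hl : Γ.label d₀ (Γ.edge d) < Γ.label d₀ (Γ.edge d') := hpar ▸ label_parent_lt hd₀ hpos
  have hne : Γ.edge d ≠ Γ.edge d' := fun he => hl.ne (congrArg _ he)
  have hdep := h.depth_edge_child h' hs.symm
  have h1 := pathSum_eq_of_ne_exc hd₀ (d := d.symm) (d' := d') hs.symm h.snd_ne_exc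
  rw [edge_symm, if_pos hl] at h1
  have h2 : Γ.pathSum d₀ d (Γ.edge d') = 0 := by
    refine pathSum_eq_zero fun x hx he => ?_
    rcases edge_eq_edge_iff.1 he with rfl | rfl
    · exact d.snd_ne_fst (hs.trans ‹x.fst = d.fst›)
    · have hx : d'.snd = d.fst := hx
      unfold IsDown at h h'
      rw [← hs, hx] at h'
      omega
  have hred : Γ.reduced d₀ (Γ.edge d) (Γ.edge d') = - 1 := by
    rw [reduced_apply, if_pos hpos, hpar, stair_self, stair_of_gt hl]
    split_ifs with hpos'
    · have hl' := label_parent_lt hd₀ hpos'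
      rw [stair_of_gt hl', stair_of_gt (hl'.trans hl), eq_sub_of_add_eq' one_add_mul_multSum]
      ring
    · rw [eq_sub_of_add_eq' one_add_mul_multSum]
      ring
  rw [gradedCartan_apply hd₀, if_neg hne, h1, h2, rowFactor_mul_colFactor, hdep,
    rowShift_eq_parent hpos, hpar, hred, Odd.neg_one_pow ⟨Γ.depth (Γ.edge d), by ring⟩,
    neg_one_mul, neg_mul_neg, sub_sub_cancel]
  ring

/-- Edges with a common vertex are equal, siblings, or parent and child, and are treated above. For
all others no path connects them, and one of the two vanishing criteria for the reduced matrix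
applies. -/
theorem gradedCartan_eq_factor (hd₀ : d₀.fst = Γ.exc) (f g : Γ.Edge) :
    Γ.gradedCartan k d₀ f g =
      Γ.rowFactor d₀ f * Γ.colFactor d₀ g * Γ.reduced d₀ f g := by
  obtain ⟨d, h, rfl⟩ := exists_isDown f
  obtain ⟨d', h', rfl⟩ := exists_isDown g
  by_cases c1 : d = d'
  · subst c1
    rw [gradedCartan_self hd₀ h, rowFactor_mul_colFactor_self, one_mul]
  by_cases c2 : d.fst = d'.fst
  · exact gradedCartan_sibling hd₀ h h' c1 c2
  by_cases c3 : d'.snd = d.fst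
  · exact gradedCartan_parent_right hd₀ h h' c3
  by_cases c4 : d.snd = d'.fst
  · exact gradedCartan_parent_left hd₀ h h' c4
  have hne : Γ.edge d ≠ Γ.edge d' := fun he => c1 (h.eq_of_edge_eq h' he)
  have h1 : Γ.pathSum d₀ d (Γ.edge d') = 0 := by
    refine pathSum_eq_zero fun x hx he => ?_
    rcases edge_eq_edge_iff.1 he with rfl | rfl
    · exact c2 hx.symm
    · exact c3 hx
  have h2 : Γ.pathSum d₀ d.symm (Γ.edge d') = 0 := by
    refine pathSum_eq_zero fun x hx he => ?_
    rcases edge_eq_edge_iff.1 he with rfl | rfl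
    · exact c4 hx.symm
    · exact c1 (h.eq_of_snd_eq h' hx.symm)
  have hred : Γ.reduced d₀ (Γ.edge d) (Γ.edge d') = 0 := by
    by_contra hr
    have hb : 0 < Γ.depth (Γ.edge d') → Γ.Below (Γ.parent (Γ.edge d')) (Γ.edge d) :=
      fun hpos => by_contra fun hb => hr (reduced_eq_zero_right hd₀ hpos hb)
    have hb' : 0 < Γ.depth (Γ.edge d) → Γ.Below (Γ.parent (Γ.edge d)) (Γ.edge d') :=
      fun hpos => by_contra fun hb => hr (reduced_eq_zero_left hd₀ hpos hb)
    rcases le_total (Γ.depth (Γ.edge d)) (Γ.depth (Γ.edge d')) with hle | hle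
    · exact (exists_adj_of_below h h' hle hb).elim c2 c4
    · exact (exists_adj_of_below h' h hle hb').elim (fun h => c2 h.symm) c3
  rw [gradedCartan_apply hd₀, if_neg hne, h1, h2, hred, mul_zero, add_zero, add_zero]

theorem label_bijective (hd₀ : d₀.fst = Γ.exc) : Function.Bijective (Γ.label d₀) :=
  (Fintype.bijective_iff_injective_and_card _).2 ⟨label_injective hd₀, (Fintype.card_fin _).symm⟩

/-- In the order of the labels the matrix is lower unitriangular, as parents precede their children.
-/
theorem det_subParent (hd₀ : d₀.fst = Γ.exc) : Γ.subParent.det = 1 := by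
  let σ := Equiv.ofBijective _ (label_bijective hd₀)
  have hσ : ∀ i, Γ.label d₀ (σ.symm i) = i := σ.apply_symm_apply
  have hne : ∀ {f : Γ.Edge}, ¬ (0 < Γ.depth f ∧ Γ.parent f = f) := fun {f} h =>
    (label_parent_lt hd₀ h.1).ne (by rw [h.2])
  rw [← Matrix.det_submatrix_equiv_self σ.symm, Matrix.det_of_isLowerTriangular]
  · simp [subParent, hne]
  · intro i j hij
    have hij : i < j := hij
    rw [Matrix.submatrix_apply, subParent, Matrix.of_apply, if_neg fun h => hij.ne
      (σ.symm.injective h), if_neg, sub_zero]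
    rintro ⟨hpos, hp⟩
    have := label_parent_lt hd₀ hpos
    rw [hp, hσ, hσ] at this
    exact hij.not_gt this

theorem det_stair (hd₀ : d₀.fst = Γ.exc) :
    (Γ.stair d₀).det = ∑ t ∈ Finset.range (Γ.mult * Γ.numEdges + 1),
      𝐪 ((t * Γ.numEdges : ℕ) : ℤ) := by
  have hpos : 0 < Γ.mult * Γ.numEdges :=
    Nat.mul_pos Γ.mult_pos (Fintype.card_pos_iff.2 ⟨Γ.edge d₀⟩)
  -- The exponents `m * e` and `0` differ because `Γ` has an edge, namely that of `d₀`.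
  have hQ : 𝐪 (Γ.numEdges : ℤ) ^ Γ.mult ≠ 1 := by
    rw [T_pow, ← T_zero]
    intro h
    have := congrArg degree h
    rw [degree_T, degree_T] at this
    exact hpos.ne' (by exact_mod_cast this)
  refine (Matrix.det_submatrix_equiv_self (Equiv.ofBijective _ (label_bijective hd₀)) _).trans ?_
  rw [multSum, det_stairMatrix _ _ hQ]
  refine Finset.sum_congr rfl fun t _ => ?_
  rw [T_pow]
  push_cast
  rfl

theorem det_gradedCartan (k : Type*) [Field k] (hd₀ : d₀.fst = Γ.exc) :
    (Γ.gradedCartan k d₀).det = ∑ t ∈ Finset.range (Γ.mult * Γ.numEdges + 1),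
      𝐪 ((t * Γ.numEdges : ℕ) : ℤ) := by
  have h : Γ.gradedCartan k d₀ =
      Matrix.diagonal (Γ.rowFactor d₀) * Γ.reduced d₀ * Matrix.diagonal (Γ.colFactor d₀) := by
    ext1 f g
    rw [gradedCartan_eq_factor hd₀, Matrix.mul_diagonal, Matrix.diagonal_mul]
    ring
  rw [h, Matrix.det_mul, Matrix.det_mul, mul_right_comm, Matrix.det_diagonal, Matrix.det_diagonal,
    ← Finset.prod_mul_distrib, Finset.prod_congr rfl fun f _ => rowFactor_mul_colFactor_self f,
    Finset.prod_const_one, one_mul, reduced, Matrix.det_mul, Matrix.det_transpose, Matrix.det_mul,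
    Matrix.det_transpose, det_subParent hd₀, one_mul, one_mul, det_stair hd₀]

end BrauerTree

end

theorem mainTheorem4 {k : Type u} [Field k] {V : Type v} [Finite V] (Γ : BrauerTree V)
    (d₀ : Γ.graph.Dart) (hd₀ : d₀.fst = Γ.exc) :
    Nonempty (GradedAlgebra (Γ.greenGrading k d₀)) ∧
    (Γ.gradedCartan k d₀).det =
      ∑ t ∈ Finset.range (Γ.mult * Γ.numEdges + 1),
        (LaurentPolynomial.T ((t * Γ.numEdges : ℕ) : ℤ) : LaurentPolynomial ℤ) ∧
    ∀ (V' : Type w) [Finite V'] (Γ' : BrauerTree V') (d₀' : Γ'.graph.Dart),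
      d₀'.fst = Γ'.exc → Γ'.mult = Γ.mult → Γ'.numEdges = Γ.numEdges →
        (Γ'.gradedCartan k d₀').det = (Γ.gradedCartan k d₀).det := by
  refine ⟨QuiverAlgebra.nonempty_gradedAlgebra BrauerTree.linearIndependent_pathBasis
    (BrauerTree.span_pathBasis hd₀) (BrauerTree.greenGrading_eq_span hd₀),
    BrauerTree.det_gradedCartan k hd₀, fun V' _ Γ' d₀' h hm he => ?_⟩
  rw [BrauerTree.det_gradedCartan k h, BrauerTree.det_gradedCartan k hd₀, hm, he]
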